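/- Let $M$ be a connected oriented (Hausdorff) smooth surface and let $\Sigma\subset TM$ be a smooth Finsler structure: an embedded hypersurface whose basepoint projection $\pi:\Sigma\to M$ is a surjective submersion and each of whose fibers $\Sigma_x=\Sigma\cap T_xM$ is a smooth, closed, strictly convex curve whose convex hull contains $0_x$ in its interior. Let $(\omega_1,\omega_2,\omega_3)$ be Cartan's canonical coframing of $\Sigma$, i.e. the unique coframing such that 1. $\omega_1\wedge\omega_2$ is a positive multiple of the $\pi$-pullback of any positive $2$-form on $M$; 2. $(\gamma')^*\omega_1=dt$ and $(\gamma')^*\omega_2=0$ for the tangential lift $\gamma'$ of every curve $\gamma$ in $M$ with $\gamma'(t)\in\Sigma$ for all $t$; 3. $d\omega_1\wedge\omega_2=0$, $\ \omega_1\wedge d\omega_1=\omega_2\wedge d\omega_2$, $\ d\omega_1=\omega_3\wedge\omega_2$ and $\omega_3\wedge d\omega_2=0$. Suppose that $K\equiv1$, i.e. that for some functions $I,J$ on $\Sigma$ $$d\omega_1=-\omega_2\wedge\omega_3,\qquad d\omega_2=-\omega_3\wedge(\omega_1-I\,\omega_2),\qquad d\omega_3=-(\omega_1-J\,\omega_3)\wedge\omega_2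 ,$$ and that $\Sigma$ is geodesically complete, i.e. that the vector field $X_1$ of the frame dual to $(\omega_1,\omega_2,\omega_3)$ is complete; let $\Psi_t:\Sigma\to\Sigma$ denote its flow. For $p\in M$, an angle measure on $\Sigma_p$ is a smooth parametrization $\iota_p:S^1=\mathbb R/2\pi\mathbb Z\to\Sigma_p$ with $\iota_p^*\omega_3=r(p)\,d\theta$, where $r(p)=\frac1{2\pi}\int_{\Sigma_p}\omega_3>0$ and $\Sigma_p$ is oriented by $\omega_3>0$. Then, for every $p\in M$ and every angle measure $\iota_p$ on $\Sigma_p$, the formula $$E_p(\sin t\cos\theta,\ \sin t\sin\theta,\ \cos t)=\pi\bigl(\Psi_t(\iota_p(\theta))\bigr),\qquad 0\le t\le\pi,\ \theta\in\mathbb R,$$ gives a well-defined map $E_p:S^2\to M$, which is a homeomorphism, is smooth away from the two poles $(0,0,\pm1)$, and preserves orientation (at every point other than the poles its differential is an orientation-preserving linear isomorphism, where $S^2$ has its standard orientation as the boundary of the unit ball). In particular, $M$ is homeomorphic to $S^2$, and the diameter of $M$ as a Finsler space, i.e. the supremum over all $(x,y)\in M\times M$ of the infimum of the $\Sigma$-lengths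 of curves from $x$ to $y$, is equal to $\pi$. -/

import Mathlib

open scoped Manifold ContDiff ENNReal

noncomputable section

namespace FinslerSurface

/-! ## Orientations of a surface -/

section Orientation

/-- The alternating 2-form `τ` on `V` is positive for the orientation `o`. -/
def IsPositiveForm {V : Type*} [AddCommGroup V] [Module ℝ V]
    (o : Orientation ℝ V (Fin 2)) (τ : V [⋀^Fin 2]→ₗ[ℝ] ℝ) : Prop :=
  ∃ h : τ ≠ 0, rayOfNeZero ℝ τ h = o

/-- `(a, b)` is a positively oriented basis of the oriented plane `V`. -/
def IsPositivePair {V : Type*} [AddCommGroup V] [Module ℝ V]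
    (o : Orientation ℝ V (Fin 2)) (a b : V) : Prop :=
  ∀ τ : V [⋀^Fin 2]→ₗ[ℝ] ℝ, IsPositiveForm o τ → 0 < τ ![a, b]

variable {M : Type*} [TopologicalSpace M] [ChartedSpace (EuclideanSpace ℝ (Fin 2)) M]
  [IsManifold (𝓡 2) ∞ M]

/-- A family of orientations of the tangent planes is an orientation of the surface if every point
has a neighbourhood with a continuous positively oriented frame. -/
def IsOrientation (o : ∀ x : M, Orientation ℝ (TangentSpace (𝓡 2) x) (Fin 2)) : Prop :=
  ∀ x₀ : M, ∃ U ∈ nhds x₀, ∃ X Y : ∀ x : M, TangentSpace (𝓡 2) x,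
    ContinuousOn (fun x => (⟨x, X x⟩ : TangentBundle (𝓡 2) M)) U ∧
    ContinuousOn (fun x => (⟨x, Y x⟩ : TangentBundle (𝓡 2) M)) U ∧
    ∀ x ∈ U, IsPositivePair (o x) (X x) (Y x)

end Orientation

/-! ## Differential forms on a 3-manifold, coframings -/

section Forms

variable {S : Type*} [TopologicalSpace S] [ChartedSpace (EuclideanSpace ℝ (Fin 3)) S]

/-- The expression of a 1-form in the preferred chart at `u₀`, i.e. its pullback by the inverse of
that chart. -/
def formInChart (α : ∀ u : S, TangentSpace (𝓡 3) u →L[ℝ] ℝ) (u₀ : S)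
    (y : EuclideanSpace ℝ (Fin 3)) : EuclideanSpace ℝ (Fin 3) →L[ℝ] ℝ :=
  (α ((extChartAt (𝓡 3) u₀).symm y)).comp
    (mfderiv 𝓘(ℝ, EuclideanSpace ℝ (Fin 3)) (𝓡 3) (extChartAt (𝓡 3) u₀).symm y)

/-- A 1-form is smooth if its expressions in charts are. -/
def IsSmoothForm (α : ∀ u : S, TangentSpace (𝓡 3) u →L[ℝ] ℝ) : Prop :=
  ∀ u₀ : S, ContDiffOn ℝ ∞ (formInChart α u₀) (extChartAt (𝓡 3) u₀).target

/-- The exterior derivative `dα(V, W)` of a smooth 1-form at `u`. It is computed in the preferred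
chart at `u`, in which tangent vectors at `u` are their own coordinate expressions. -/
def extD (α : ∀ u : S, TangentSpace (𝓡 3) u →L[ℝ] ℝ) (u : S) (V W : TangentSpace (𝓡 3) u) : ℝ :=
  fderiv ℝ (formInChart α u) (extChartAt (𝓡 3) u u) V W -
    fderiv ℝ (formInChart α u) (extChartAt (𝓡 3) u u) W V

/-- The wedge product of two covectors. -/
def wedge {V : Type*} (α β : V → ℝ) (v w : V) : ℝ := α v * β w - α w * β v

/-- The wedge product of a covector and an alternating 2-form. -/
def wedge₁₂ {V : Type*} (α : V → ℝ) (β : V → V → ℝ) (u v w : V) : ℝ :=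
  α u * β v w - α v * β u w + α w * β u v

variable (S) in
/-- A (smooth) coframing of a 3-manifold: a smooth family of isomorphisms
`(ω₁, ω₂, ω₃) : T_u S → ℝ³`. -/
structure Coframing where
  equiv : ∀ u : S, TangentSpace (𝓡 3) u ≃L[ℝ] (Fin 3 → ℝ)
  smooth : ∀ i : Fin 3, IsSmoothForm fun u =>
    (ContinuousLinearMap.proj (R := ℝ) (φ := fun _ : Fin 3 => ℝ) i).comp
      (equiv u).toContinuousLinearMap

namespace Coframing

variable (η : Coframing S)

/-- The 1-form with index `i`, so that `form 0`, `form 1`, `form 2` are `ω₁`, `ω₂`, `ω₃`. -/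
def form (i : Fin 3) (u : S) : TangentSpace (𝓡 3) u →L[ℝ] ℝ :=
  (ContinuousLinearMap.proj (R := ℝ) (φ := fun _ : Fin 3 => ℝ) i).comp
    (η.equiv u).toContinuousLinearMap

/-- The vector fields dual to the coframing: `dual 0`, `dual 1`, `dual 2` are `X₁`, `X₂`, `X₃`. -/
def dual (i : Fin 3) (u : S) : TangentSpace (𝓡 3) u :=
  (η.equiv u).symm (Pi.single i 1)

/-- The structure equations with invariants `I`, `J`, `K`:
`dω₁ = -ω₂ ∧ ω₃`, `dω₂ = -ω₃ ∧ (ω₁ - I ω₂)`, `dω₃ = -(K ω₁ - J ω₃) ∧ ω₂`. -/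
def StructureEquations (I J K : S → ℝ) : Prop :=
  ∀ (u : S) (V W : TangentSpace (𝓡 3) u),
    extD (η.form 0) u V W = -wedge (η.form 1 u) (η.form 2 u) V W ∧
    extD (η.form 1) u V W = -wedge (η.form 2 u) (η.form 0 u - I u • η.form 1 u) V W ∧
    extD (η.form 2) u V W = -wedge (K u • η.form 0 u - J u • η.form 2 u) (η.form 1 u) V W

end Coframing

/-- A vector field is complete if through every point there is an integral curve defined for
all (forward and backward) time. -/
def IsCompleteField (X : ∀ u : S, TangentSpace (𝓡 3) u) : Prop :=
  ∀ u : S, ∃ γ : ℝ → S, γ 0 = u ∧ IsMIntegralCurve γ X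

/-- The time-`t` flow of a complete vector field. -/
def flow {X : ∀ u : S, TangentSpace (𝓡 3) u} (hX : IsCompleteField X) (t : ℝ) (u : S) : S :=
  Classical.choose (hX u) t

end Forms

/-! ## Finsler structures -/

section Finsler

variable {M : Type*} [TopologicalSpace M] [ChartedSpace (EuclideanSpace ℝ (Fin 2)) M]
  [IsManifold (𝓡 2) ∞ M]

/-- The fibre `Σ_x = Σ ∩ T_x M`, as a subset of `T_x M`. -/
def fiber (Sig : Set (TangentBundle (𝓡 2) M)) (x : M) : Set (TangentSpace (𝓡 2) x) :=
  {v | (⟨x, v⟩ : TangentBundle (𝓡 2) M) ∈ Sig}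

/-- The basepoint projection `π : Σ → M`. -/
def basepoint {Sig : Set (TangentBundle (𝓡 2) M)} (u : Sig) : M :=
  (u : TangentBundle (𝓡 2) M).proj

/-- `Σ ⊂ TM` is a smooth Finsler structure: an embedded hypersurface whose basepoint projection is
a surjective submersion (so each `Σ_x` is a smooth curve), such that each `Σ_x` is a closed strictly
convex curve, i.e. the boundary curve of a compact strictly convex set, namely its convex hull, and
this convex hull contains the origin in its interior. -/
structure IsFinslerStructure (Sig : Set (TangentBundle (𝓡 2) M))
    [ChartedSpace (EuclideanSpace ℝ (Fin 3)) Sig] : Prop where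
  embedded : Manifold.IsSmoothEmbedding (𝓡 3) (𝓡 2).tangent ∞
    (Subtype.val : Sig → TangentBundle (𝓡 2) M)
  submersion : Manifold.IsSubmersion (𝓡 3) (𝓡 2) ∞ (basepoint : Sig → M)
  surjective : Function.Surjective (basepoint : Sig → M)
  compact : ∀ x : M, IsCompact (fiber Sig x)
  strictlyConvex : ∀ x : M, StrictConvex ℝ (convexHull ℝ (fiber Sig x))
  boundary : ∀ x : M, fiber Sig x = frontier (convexHull ℝ (fiber Sig x))
  zero_mem : ∀ x : M, (0 : TangentSpace (𝓡 2) x) ∈ interior (convexHull ℝ (fiber Sig x))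

/-- The Finsler metric `F : TM → ℝ`: on `T_x M` it is the non-symmetric norm with unit
curve `Σ_x`. -/
def finslerNorm (Sig : Set (TangentBundle (𝓡 2) M)) (x : M) (v : TangentSpace (𝓡 2) x) : ℝ :=
  gauge (convexHull ℝ (fiber Sig x)) v

/-- The oriented Finsler distance from `x` to `y`: the infimum of `∫ F(γ'(t)) dt` over the `C¹`
paths `γ` from `x` to `y`. -/
def finslerDist (Sig : Set (TangentBundle (𝓡 2) M)) (x y : M) : ℝ≥0∞ :=
  letI : ∀ z : M, ENorm (TangentSpace (𝓡 2) z) :=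
    fun z => ⟨fun v => ENNReal.ofReal (finslerNorm Sig z v)⟩
  Manifold.riemannianEDist (𝓡 2) x y

/-- The diameter as a Finsler space. -/
def finslerDiam (Sig : Set (TangentBundle (𝓡 2) M)) : ℝ≥0∞ :=
  ⨆ (x : M) (y : M), finslerDist Sig x y

variable {Sig : Set (TangentBundle (𝓡 2) M)} [ChartedSpace (EuclideanSpace ℝ (Fin 3)) Sig]

/-- The differential `π'(u) : T_u Σ → T_{π(u)} M`. -/
def basepointD (u : Sig) : TangentSpace (𝓡 3) u →L[ℝ] TangentSpace (𝓡 2) (basepoint u) :=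
  mfderiv (𝓡 3) (𝓡 2) (basepoint : Sig → M) u

/-- `η = (ω₁, ω₂, ω₃)` is Cartan's canonical coframing on the Finsler structure `Σ` of the surface
`M` oriented by `o`. In `lift`, the vectors `V ∈ T_u Σ` that project to the vector
`u ∈ T_{π(u)} M` are exactly the velocities at `u` of the tangential lifts of `Σ`-curves, so that
this is the condition `γ'^* ω₁ = dt`, `γ'^* ω₂ = 0` on tangential lifts. -/
structure IsCanonicalCoframing (o : ∀ x : M, Orientation ℝ (TangentSpace (𝓡 2) x) (Fin 2))
    (η : Coframing Sig) : Prop where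
  /-- `ω₁ ∧ ω₂` is a positive multiple of the `π`-pullback of any positive 2-form. -/
  area : ∀ (u : Sig) (τ : TangentSpace (𝓡 2) (basepoint u) [⋀^Fin 2]→ₗ[ℝ] ℝ),
    IsPositiveForm (o (basepoint u)) τ → ∃ c : ℝ, 0 < c ∧ ∀ V W : TangentSpace (𝓡 3) u,
      wedge (η.form 0 u) (η.form 1 u) V W = c * τ ![basepointD u V, basepointD u W]
  lift : ∀ (u : Sig) (V : TangentSpace (𝓡 3) u),
    basepointD u V = (u : TangentBundle (𝓡 2) M).snd → η.form 0 u V = 1 ∧ η.form 1 u V = 0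
  /-- `dω₁ ∧ ω₂ = 0` -/
  d₁_wedge : ∀ (u : Sig) (V₁ V₂ V₃ : TangentSpace (𝓡 3) u),
    wedge₁₂ (η.form 1 u) (extD (η.form 0) u) V₁ V₂ V₃ = 0
  /-- `ω₁ ∧ dω₁ = ω₂ ∧ dω₂` -/
  balance : ∀ (u : Sig) (V₁ V₂ V₃ : TangentSpace (𝓡 3) u),
    wedge₁₂ (η.form 0 u) (extD (η.form 0) u) V₁ V₂ V₃ =
      wedge₁₂ (η.form 1 u) (extD (η.form 1) u) V₁ V₂ V₃
  /-- `dω₁ = ω₃ ∧ ω₂` -/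
  d₁ : ∀ (u : Sig) (V W : TangentSpace (𝓡 3) u),
    extD (η.form 0) u V W = wedge (η.form 2 u) (η.form 1 u) V W
  /-- `ω₃ ∧ dω₂ = 0` -/
  d₂ : ∀ (u : Sig) (V₁ V₂ V₃ : TangentSpace (𝓡 3) u),
    wedge₁₂ (η.form 2 u) (extD (η.form 1) u) V₁ V₂ V₃ = 0

/-- The velocity `dι/dθ` of a map from the circle, parametrized by the angle `θ`. -/
def angularVelocity (ι : Circle → Sig) (θ : ℝ) : TangentSpace (𝓡 3) (ι (Circle.exp θ)) :=
  mfderiv 𝓘(ℝ, ℝ) (𝓡 3) (fun s : ℝ => ι (Circle.exp s)) θ (1 : ℝ)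

/-- `ι : S¹ → Σ_p` is an angle measure: a smooth parametrization of `Σ_p` with
`ι^* ω₃ = r(p) dθ`, where `r(p) > 0` is `1/(2π)` times the integral of `ω₃` over `Σ_p` (oriented by
`ω₃ > 0`); this integral is computed in the parametrization `ι`. -/
structure IsAngleMeasure (η : Coframing Sig) (p : M) (ι : Circle → Sig) : Prop where
  smooth : ContMDiff (𝓡 1) (𝓡 3) ∞ ι
  bijOn : Set.BijOn ι Set.univ {u : Sig | basepoint u = p}
  pos : ∀ θ : ℝ, 0 < η.form 2 (ι (Circle.exp θ)) (angularVelocity ι θ)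
  pullback : ∀ θ : ℝ, η.form 2 (ι (Circle.exp θ)) (angularVelocity ι θ) =
    (1 / (2 * Real.pi)) *
      ∫ s in (0 : ℝ)..(2 * Real.pi), η.form 2 (ι (Circle.exp s)) (angularVelocity ι s)

end Finsler

/-! ## The round sphere -/

/-- The unit sphere in Euclidean 3-space. -/
abbrev Sphere2 : Type := Metric.sphere (0 : EuclideanSpace ℝ (Fin 3)) 1

/-- The point `(sin t cos θ, sin t sin θ, cos t)` of the unit sphere. -/
def polarPoint (t θ : ℝ) : Sphere2 :=
  ⟨!₂[Real.sin t * Real.cos θ, Real.sin t * Real.sin θ, Real.cos t], by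
    rw [mem_sphere_zero_iff_norm, EuclideanSpace.norm_eq, Real.sqrt_eq_one]
    simp only [Fin.sum_univ_three, Real.norm_eq_abs, sq_abs, Matrix.cons_val]
    nlinarith [Real.sin_sq_add_cos_sq t, Real.sin_sq_add_cos_sq θ]⟩

/-- The inclusion `T_x S² → ℝ³`. -/
def sphereInclD (x : Sphere2) : TangentSpace (𝓡 2) x →L[ℝ] EuclideanSpace ℝ (Fin 3) :=
  mfderiv (𝓡 2) 𝓘(ℝ, EuclideanSpace ℝ (Fin 3))
    (Subtype.val : Sphere2 → EuclideanSpace ℝ (Fin 3)) x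

/-- `(v, w)` is a positive basis of `T_x S²` for the standard orientation of the sphere as the
boundary of the ball (outward normal first): `det(x, v, w) > 0`. -/
def IsPositiveOnSphere (x : Sphere2) (v w : TangentSpace (𝓡 2) x) : Prop :=
  0 < Matrix.det (fun i j : Fin 3 =>
    (![(x : EuclideanSpace ℝ (Fin 3)), sphereInclD x v, sphereInclD x w] i) j)

/-- `E` is smooth near `x`, and its differential at `x` takes positive bases to positive bases;
so near `x`, `E` is an orientation-preserving local diffeomorphism. -/
def IsSmoothOrientationPreservingAt {M : Type*} [TopologicalSpace M]
    [ChartedSpace (EuclideanSpace ℝ (Fin 2)) M] [IsManifold (𝓡 2) ∞ M]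
    (o : ∀ x : M, Orientation ℝ (TangentSpace (𝓡 2) x) (Fin 2)) (E : Sphere2 → M)
    (x : Sphere2) : Prop :=
  ContMDiffAt (𝓡 2) (𝓡 2) ∞ E x ∧
  ∀ v w : TangentSpace (𝓡 2) x, IsPositiveOnSphere x v w →
    IsPositivePair (o (E x)) (mfderiv (𝓡 2) (𝓡 2) E x v) (mfderiv (𝓡 2) (𝓡 2) E x w)

end FinslerSurface

end

noncomputable section

namespace FinslerSurface

open Set Filter Topology Function

local notation "E2" => EuclideanSpace ℝ (Fin 2)
local notation "E3" => EuclideanSpace ℝ (Fin 3)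

/-! ## Smooth dependence of ODE solutions on the initial conditions -/

section SmoothODE

universe u

/-! Since `K = 1`, the flow `Ψ_t` of `X₁` preserves `ω₁` and rotates the pair `(ω₂, ω₃)` through the
angle `t` (`IsUnitFlow.form_mfderiv`). The projection `π'` kills `X₃` and sends `X₁` at `u` to the
vector `u`. Hence the differential of `(t, u) ↦ π (Ψ_t u)` is explicit
(`IsUnitSurface.mfderiv_geo`): turning the initial vector by `ω₃` moves the endpoint by `sin t` in
the normal direction. So polar coordinates at a point `p` are a local diffeomorphism for `0 < t <
π`, and at `t = π` all geodesics from `p` arrive at a single antipode (`antipode_eq`). The set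
reached in times `[0, π]` is compact, and open away from `p` and its antipode. Two points do not
disconnect a surface, so this set is `M` (`exists_geo_eq`), and both `M` and `Σ` are compact.

Injectivity rests on variations of length. Write `ω₁ = λ_u ∘ π'`. Strict convexity of the indicatrix
makes `λ_u` its supporting covector at `u`, so `λ_u` determines `u` (`covec_le_one`,
`eq_of_covec_eq`), and the first variation of length is given by `λ` at the endpoints.

A shortest geodesic loop of length less than `π`, taken over all basepoints, would close up
smoothly, and its second variation in the normal direction would be negative; so there is none
(`geo_ne`). If the antipode of `p` is not `p`, let two geodesics from `p` to a common endpoint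
maximize the difference of their lengths. If the maximum were positive, then either they would
arrive with the same velocity or one of the lengths would be `0` or `π`; each case yields a
forbidden loop or return (`injective_of_antipode_ne`). Finally, the antipodal map is not the
identity on any open set because its differential reverses normals, and approximation together with
the connectedness of small punctured neighbourhoods excludes fixed points altogether
(`antipode_ne`).

The map from the sphere is then a continuous bijection from a compact space to a Hausdorff one. Away
from the poles its orientation is read off from the factor `r sin t > 0` in its differential. For
the diameter, geodesics give the bound `π` from above; from below, the polar radius `ρ` satisfies
`dρ = λ ≤ F`, so no curve from `p` to its antipode is shorter than `π`. -/

/-- The pointwise evaluation of a continuous family of operators on a continuous family of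
vectors, as a continuous bilinear map. -/
def pointwiseApply (K : Type*) [TopologicalSpace K] [CompactSpace K] (E F : Type*)
    [NormedAddCommGroup E] [NormedSpace ℝ E] [NormedAddCommGroup F] [NormedSpace ℝ F] :
    C(K, E →L[ℝ] F) →L[ℝ] C(K, E) →L[ℝ] C(K, F) :=
  LinearMap.mkContinuous₂
    (LinearMap.mk₂ ℝ (fun (A : C(K, E →L[ℝ] F)) (h : C(K, E)) =>
      (⟨fun k => A k (h k), A.continuous.clm_apply h.continuous⟩ : C(K, F)))
      (fun A B h => by ext; simp) (fun c A h => by ext; simp)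
      (fun A h k => by ext; simp) (fun c A h => by ext; simp)) 1
    (fun A h => by
      rw [one_mul]
      refine (ContinuousMap.norm_le _ (by positivity)).2 fun k => ?_
      exact ((A k).le_opNorm (h k)).trans
        (mul_le_mul (A.norm_coe_le_norm k) (h.norm_coe_le_norm k) (norm_nonneg _) (norm_nonneg A)))

@[simp] theorem pointwiseApply_apply {K : Type*} [TopologicalSpace K] [CompactSpace K]
    {E F : Type*} [NormedAddCommGroup E] [NormedSpace ℝ E] [NormedAddCommGroup F]
    [NormedSpace ℝ F] (A : C(K, E →L[ℝ] F)) (h : C(K, E)) (k : K) :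
    pointwiseApply K E F A h k = A k (h k) := rfl

/-- The mean value inequality is applied at each point of `K`. Its error is uniform because `γ ↦ f'
∘ γ` is continuous for the sup norm, `K` being compact. -/
theorem hasFDerivAt_postcomp {K : Type*} [TopologicalSpace K] [CompactSpace K]
    {E F : Type*} [NormedAddCommGroup E] [NormedSpace ℝ E] [NormedAddCommGroup F]
    [NormedSpace ℝ F] (f : C(E, F)) (f' : C(E, E →L[ℝ] F)) (hf : ∀ x, HasFDerivAt f (f' x) x)
    (γ : C(K, E)) :
    HasFDerivAt (fun γ : C(K, E) => f.comp γ) (pointwiseApply K E F (f'.comp γ)) γ := by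
  rw [hasFDerivAt_iff_isLittleO_nhds_zero, Asymptotics.isLittleO_iff]
  intro c hc
  obtain ⟨δ, hδ, H⟩ : ∃ δ > 0, ∀ ⦃x : C(K, E)⦄, dist x γ < δ →
      dist (f'.comp x) (f'.comp γ) < c :=
    (Metric.continuousAt_iff (f := fun γ : C(K, E) => f'.comp γ) (a := γ)).1
      (ContinuousMap.continuous_postcomp f').continuousAt c hc
  filter_upwards [Metric.ball_mem_nhds (0 : C(K, E)) hδ] with h hh
  rw [mem_ball_zero_iff] at hh
  refine (ContinuousMap.norm_le _ (by positivity)).2 fun k => ?_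
  have key : ∀ x ∈ segment ℝ (γ k) (γ k + h k), ‖f' x - f' (γ k)‖ ≤ c := by
    intro x hx
    rw [segment_eq_image'] at hx
    obtain ⟨s, hs, rfl⟩ := hx
    have h1 : dist (γ + s • h) γ < δ := by
      rw [dist_eq_norm, add_sub_cancel_left, norm_smul, Real.norm_eq_abs, abs_of_nonneg hs.1]
      exact lt_of_le_of_lt (mul_le_of_le_one_left (norm_nonneg _) hs.2) hh
    have h2 := (ContinuousMap.dist_apply_le_dist (f := f'.comp (γ + s • h)) (g := f'.comp γ) k).trans
      (H h1).le
    rw [dist_eq_norm] at h2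
    simpa using h2
  have := (convex_segment (γ k) (γ k + h k)).norm_image_sub_le_of_norm_hasFDerivWithin_le'
    (f := f) (f' := f') (φ := f' (γ k)) (C := c) (fun x _ => (hf x).hasFDerivWithinAt) key
    (left_mem_segment ℝ _ _) (right_mem_segment ℝ _ _)
  simp only [ContinuousMap.sub_apply, ContinuousMap.comp_apply, ContinuousMap.add_apply,
    pointwiseApply_apply]
  refine (by simpa using this : _ ≤ c * ‖h k‖).trans ?_
  exact mul_le_mul_of_nonneg_left (h.norm_coe_le_norm k) hc.le

/-- The derivative at `γ` depends linearly on `f' ∘ γ`, which is again a superposition operator,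
with values in `E →L[ℝ] F`. The induction therefore ranges over all targets `F`, and `E` and `F`
share a universe. -/
theorem contDiff_postcomp_nat {K : Type u} [TopologicalSpace K] [CompactSpace K]
    {E : Type u} [NormedAddCommGroup E] [NormedSpace ℝ E] (n : ℕ) :
    ∀ {F : Type u} [NormedAddCommGroup F] [NormedSpace ℝ F] (f : C(E, F)), ContDiff ℝ n f →
      ContDiff ℝ n (fun γ : C(K, E) => f.comp γ) := by
  induction n with
  | zero =>
    intro F _ _ f _
    exact contDiff_zero.2 (ContinuousMap.continuous_postcomp f)
  | succ n ih =>
    intro F _ _ f hf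
    have hf1 : ContDiff ℝ (n + 1 : ℕ∞ω) f := by exact_mod_cast hf
    have h := (contDiff_succ_iff_fderiv.1 hf1)
    let f' : C(E, E →L[ℝ] F) := ⟨fderiv ℝ f, h.2.2.continuous⟩
    have hD : ∀ γ : C(K, E), HasFDerivAt (fun γ : C(K, E) => f.comp γ)
        (pointwiseApply K E F (f'.comp γ)) γ :=
      hasFDerivAt_postcomp f f' fun x => (h.1 x).hasFDerivAt
    have hgoal : ContDiff ℝ (n + 1 : ℕ∞ω) (fun γ : C(K, E) => f.comp γ) := by
      refine contDiff_succ_iff_fderiv.2 ⟨fun γ => (hD γ).differentiableAt, by simp, ?_⟩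
      have : fderiv ℝ (fun γ : C(K, E) => f.comp γ) =
          fun γ => pointwiseApply K E F (f'.comp γ) := funext fun γ => (hD γ).fderiv
      rw [this]
      exact (pointwiseApply K E F).contDiff.comp (ih f' h.2.2)
    exact_mod_cast hgoal

/-- The superposition operator of a smooth map is smooth. -/
theorem contDiff_postcomp {K : Type u} [TopologicalSpace K] [CompactSpace K]
    {E F : Type u} [NormedAddCommGroup E] [NormedSpace ℝ E] [NormedAddCommGroup F]
    [NormedSpace ℝ F] (f : C(E, F)) (hf : ContDiff ℝ ∞ f) :
    ContDiff ℝ ∞ (fun γ : C(K, E) => f.comp γ) :=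
  contDiff_infty.2 fun n => contDiff_postcomp_nat n f (contDiff_infty.1 hf n)

/-- Integration from `0` of continuous functions on `[-2, 2]`. -/
def primitive (E : Type*) [NormedAddCommGroup E] [NormedSpace ℝ E] [CompleteSpace E] :
    C(Icc (-2 : ℝ) 2, E) →L[ℝ] C(Icc (-2 : ℝ) 2, E) :=
  LinearMap.mkContinuous
    { toFun := fun γ => ⟨fun s => ∫ τ in (0 : ℝ)..s, γ (projIcc (-2) 2 (by norm_num) τ), by
        have hc : Continuous fun τ : ℝ => γ (projIcc (-2) 2 (by norm_num) τ) :=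
          γ.continuous.comp continuous_projIcc
        exact (intervalIntegral.continuous_primitive
          (fun a b => hc.intervalIntegrable a b) 0).comp continuous_subtype_val⟩
      map_add' := fun γ δ => by
        ext s
        have hc : ∀ γ : C(Icc (-2 : ℝ) 2, E),
          Continuous fun τ : ℝ => γ (projIcc (-2) 2 (by norm_num) τ) :=
          fun γ => γ.continuous.comp continuous_projIcc
        simp only [ContinuousMap.coe_mk, ContinuousMap.add_apply]
        exact intervalIntegral.integral_add ((hc γ).intervalIntegrable _ _)
          ((hc δ).intervalIntegrable _ _)
      map_smul' := fun c γ => by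
        ext s
        simp [intervalIntegral.integral_smul] } 2
    (fun γ => by
      refine (ContinuousMap.norm_le _ (by positivity)).2 fun s => ?_
      refine (intervalIntegral.norm_integral_le_of_norm_le_const
        (fun τ _ => γ.norm_coe_le_norm _)).trans ?_
      rw [mul_comm, sub_zero]
      exact mul_le_mul_of_nonneg_right (abs_le.2 ⟨s.2.1, s.2.2⟩) (norm_nonneg _))

/-- Near time `0` the integral curves of a smooth vector field `f`, slowed down by a factor `t`,
form a smooth family of curves on `[-2, 2]`. -/
theorem exists_smooth_family_of_solutions {E : Type} [NormedAddCommGroup E] [NormedSpace ℝ E]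
    [CompleteSpace E] (f : E → E) (hf : ContDiff ℝ ∞ f) (x₀ : E) :
    ∃ Γ : ℝ × E → ℝ → E, (∀ ε > 0, ∀ᶠ p in 𝓝 (0, x₀), ∀ s, dist (Γ p s) x₀ < ε) ∧
      ContDiffAt ℝ ∞ (fun p => Γ p 1) (0, x₀) ∧
      ∀ᶠ p in 𝓝 (0, x₀), Γ p 0 = p.2 ∧
        ∀ s ∈ Ioo (-2 : ℝ) 2, HasDerivAt (Γ p) (p.1 • f (Γ p s)) s := by
  let X := C(Icc (-2 : ℝ) 2, E)
  let fc : C(E, E) := ⟨f, hf.continuous⟩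
  let cst : E →L[ℝ] X := ContinuousLinearMap.const ℝ (Icc (-2 : ℝ) 2)
  -- The zeros of `A` are the solutions of `γ = x + t ∫ f(γ)`. At `t = 0` the derivative in `γ` is
  -- the identity, so the implicit function theorem applies to any smooth `f`. The interval `[-2,
  -- 2]` makes the evaluation time `1` an interior point.
  let A : (ℝ × E) × X → X := fun q => q.2 - cst q.1.2 - q.1.1 • primitive E (fc.comp q.2)
  have hA : ContDiff ℝ ∞ A := by
    have h1 : ContDiff ℝ ∞ fun q : (ℝ × E) × X => fc.comp q.2 :=
      (contDiff_postcomp fc hf).comp contDiff_snd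
    have h2 : ContDiff ℝ ∞ fun q : (ℝ × E) × X => primitive E (fc.comp q.2) :=
      (primitive E).contDiff.comp h1
    have h3 : ContDiff ℝ ∞ fun q : (ℝ × E) × X => cst q.1.2 :=
      cst.contDiff.comp (contDiff_snd.comp contDiff_fst)
    exact (contDiff_snd.sub h3).sub ((contDiff_fst.comp contDiff_fst).smul h2)
  let H : (ℝ × E) × X → (ℝ × E) × X := fun q => (q.1, A q)
  have hH : ContDiff ℝ ∞ H := contDiff_fst.prodMk hA
  let q₀ : (ℝ × E) × X := ((0, x₀), cst x₀)
  let J₀ : X := primitive E (fc.comp (cst x₀))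
  -- the partial derivative in the first variable
  let L : (ℝ × E) →L[ℝ] X := -(cst.comp (ContinuousLinearMap.snd ℝ ℝ E)) -
    (ContinuousLinearMap.fst ℝ ℝ E).smulRight J₀
  have hAd : HasFDerivAt A (L.coprod (ContinuousLinearMap.id ℝ X)) q₀ := by
    have h1 : HasFDerivAt (fun q : (ℝ × E) × X => primitive E (fc.comp q.2))
        (fderiv ℝ (fun q : (ℝ × E) × X => primitive E (fc.comp q.2)) q₀) q₀ := by
      have : ContDiff ℝ ∞ fun q : (ℝ × E) × X => primitive E (fc.comp q.2) :=
        (primitive E).contDiff.comp ((contDiff_postcomp fc hf).comp contDiff_snd)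
      exact (this.differentiable (by simp) q₀).hasFDerivAt
    have h2 : HasFDerivAt (fun q : (ℝ × E) × X => q.1.1)
        ((ContinuousLinearMap.fst ℝ ℝ E).comp (ContinuousLinearMap.fst ℝ (ℝ × E) X)) q₀ :=
      ((ContinuousLinearMap.fst ℝ ℝ E).comp (ContinuousLinearMap.fst ℝ (ℝ × E) X)).hasFDerivAt
    have h3 : HasFDerivAt (fun q : (ℝ × E) × X => q.2 - cst q.1.2)
        (ContinuousLinearMap.snd ℝ (ℝ × E) X -
          cst.comp ((ContinuousLinearMap.snd ℝ ℝ E).comp (ContinuousLinearMap.fst ℝ (ℝ × E) X)))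
        q₀ := (ContinuousLinearMap.snd ℝ (ℝ × E) X - cst.comp ((ContinuousLinearMap.snd ℝ ℝ E).comp
          (ContinuousLinearMap.fst ℝ (ℝ × E) X))).hasFDerivAt
    refine (h3.sub (h2.smul h1)).congr_fderiv ?_
    ext v s <;> simp [L, q₀, J₀]
  -- The derivative of `H` is block triangular with identities on the diagonal, so changing the sign
  -- of `L` inverts it.
  let e : ((ℝ × E) × X) ≃L[ℝ] ((ℝ × E) × X) :=
    ContinuousLinearEquiv.equivOfInverse
      ((ContinuousLinearMap.fst ℝ (ℝ × E) X).prod (L.coprod (ContinuousLinearMap.id ℝ X)))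
      ((ContinuousLinearMap.fst ℝ (ℝ × E) X).prod ((-L).coprod (ContinuousLinearMap.id ℝ X)))
      (fun v => Prod.ext (by simp) (by simp; abel))
      (fun v => Prod.ext (by simp) (by simp; abel))
  have hHd : HasFDerivAt H (e : ((ℝ × E) × X) →L[ℝ] ((ℝ × E) × X)) q₀ :=
    (hasFDerivAt_fst).prodMk hAd
  have hH' := hH.contDiffAt (x := q₀)
  have hn : (∞ : ℕ∞ω) ≠ 0 := by simp
  let Hi := hH'.localInverse hHd hn
  have hq₀ : H q₀ = ((0, x₀), 0) := by
    simp [H, A, q₀]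
  have hHi : ContDiffAt ℝ ∞ Hi ((0, x₀), 0) := hq₀ ▸ hH'.to_localInverse hHd hn
  have hHi0 : Hi ((0, x₀), 0) = q₀ := hq₀ ▸ hH'.localInverse_apply_image hHd hn
  have hright : ∀ᶠ z in 𝓝 ((0, x₀), (0 : X)), H (Hi z) = z :=
    hq₀ ▸ (hH'.hasStrictFDerivAt' hHd hn).eventually_right_inverse
  let ι : ℝ × E → (ℝ × E) × X := fun p => (p, 0)
  have hι : ContDiff ℝ ∞ ι := contDiff_id.prodMk contDiff_const
  let γ : ℝ × E → X := fun p => (Hi (ι p)).2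
  have hγ : ContDiffAt ℝ ∞ γ (0, x₀) :=
    contDiffAt_snd.comp _ (ContDiffAt.comp (0, x₀) hHi hι.contDiffAt)
  have hγ0 : γ (0, x₀) = cst x₀ := by simp [γ, ι, hHi0, q₀]
  let pr : ℝ → Icc (-2 : ℝ) 2 := projIcc (-2) 2 (by norm_num)
  refine ⟨fun p s => γ p (pr s), ?_, ?_, ?_⟩
  · intro ε hε
    have h1 := Metric.tendsto_nhds.1 hγ.continuousAt ε hε
    rw [hγ0] at h1
    filter_upwards [h1] with p hp s
    exact lt_of_le_of_lt (ContinuousMap.dist_apply_le_dist (f := γ p) (g := cst x₀) (pr s)) hp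
  · exact (ContinuousMap.evalCLM ℝ (pr 1)).contDiff.contDiffAt.comp _ hγ
  · have h1 : ∀ᶠ p in 𝓝 (0, x₀), H (Hi (ι p)) = ι p :=
      hι.continuous.continuousAt.eventually hright
    filter_upwards [h1] with p hp
    have hp1 : (Hi (ι p)).1 = p := congrArg Prod.fst hp
    have hp2 : γ p - cst p.2 - p.1 • primitive E (fc.comp (γ p)) = 0 := by
      have := congrArg Prod.snd hp
      simp only [H, A, ι] at this
      rw [show (Hi (p, (0 : X))).1 = p from hp1] at this
      exact this
    have hint : ∀ s : Icc (-2 : ℝ) 2, γ p s = p.2 + p.1 • ∫ τ in (0 : ℝ)..s, f (γ p (pr τ)) := by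
      intro s
      have : γ p s - p.2 - p.1 • ∫ τ in (0 : ℝ)..s, f (γ p (pr τ)) = 0 :=
        congrArg (fun g : X => g s) hp2
      rw [sub_sub, sub_eq_zero] at this
      exact this
    have hc : Continuous fun τ : ℝ => f (γ p (pr τ)) :=
      hf.continuous.comp ((γ p).continuous.comp continuous_projIcc)
    constructor
    · have h0 : pr 0 = ⟨0, by norm_num⟩ := projIcc_of_mem _ _
      change γ p (pr 0) = p.2
      rw [h0, hint]; simp
    · intro s hs
      have hd : HasDerivAt (fun s : ℝ => p.2 + p.1 • ∫ τ in (0 : ℝ)..s, f (γ p (pr τ)))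
          (p.1 • f (γ p (pr s))) s :=
        ((intervalIntegral.integral_hasDerivAt_right (hc.intervalIntegrable _ _)
          hc.aestronglyMeasurable.stronglyMeasurableAtFilter hc.continuousAt).const_smul
            p.1).const_add p.2
      refine hd.congr_of_eventuallyEq ?_
      filter_upwards [Ioo_mem_nhds hs.1 hs.2] with r hr
      have hr' : pr r = ⟨r, hr.1.le, hr.2.le⟩ := projIcc_of_mem _ ⟨hr.1.le, hr.2.le⟩
      change γ p (pr r) = _
      rw [hr', hint]

end SmoothODE

/-! ## Vector fields in charts and their flows -/

section ChartCalculus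

variable {E : Type} [NormedAddCommGroup E] [NormedSpace ℝ E]
  {S : Type*} [TopologicalSpace S] [ChartedSpace E S] [IsManifold 𝓘(ℝ, E) ∞ S]

theorem hasMFDerivAt_extChartAt_symm {u₀ : S} {y : E} (hy : y ∈ (extChartAt 𝓘(ℝ, E) u₀).target) :
    HasMFDerivAt 𝓘(ℝ, E) 𝓘(ℝ, E) (extChartAt 𝓘(ℝ, E) u₀).symm y
      (mfderiv 𝓘(ℝ, E) 𝓘(ℝ, E) (extChartAt 𝓘(ℝ, E) u₀).symm y) := by
  have : IsManifold 𝓘(ℝ, E) 1 S := IsManifold.of_le (n := ∞) (by simp)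
  have h := mdifferentiableWithinAt_extChartAt_symm (I := 𝓘(ℝ, E)) hy
  rw [ModelWithCorners.range_eq_univ, mdifferentiableWithinAt_univ] at h
  exact h.hasMFDerivAt

theorem mfderiv_extChartAt_symm_apply {u₀ : S} {y : E}
    (hy : y ∈ (extChartAt 𝓘(ℝ, E) u₀).target)
    (v : TangentSpace 𝓘(ℝ, E) ((extChartAt 𝓘(ℝ, E) u₀).symm y)) :
    mfderiv 𝓘(ℝ, E) 𝓘(ℝ, E) (extChartAt 𝓘(ℝ, E) u₀).symm y
      (mfderiv 𝓘(ℝ, E) 𝓘(ℝ, E) (extChartAt 𝓘(ℝ, E) u₀) ((extChartAt 𝓘(ℝ, E) u₀).symm y) v)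
      = v := by
  have : IsManifold 𝓘(ℝ, E) 1 S := IsManifold.of_le (n := ∞) (by simp)
  have h := mfderivWithin_extChartAt_symm_comp_mfderiv_extChartAt (I := 𝓘(ℝ, E)) hy
  rw [ModelWithCorners.range_eq_univ, mfderivWithin_univ] at h
  exact congrArg (fun L => L v) h

theorem mfderiv_extChartAt_apply_symm {u₀ : S} {y : E}
    (hy : y ∈ (extChartAt 𝓘(ℝ, E) u₀).target) (v : E) :
    mfderiv 𝓘(ℝ, E) 𝓘(ℝ, E) (extChartAt 𝓘(ℝ, E) u₀) ((extChartAt 𝓘(ℝ, E) u₀).symm y)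
      (mfderiv 𝓘(ℝ, E) 𝓘(ℝ, E) (extChartAt 𝓘(ℝ, E) u₀).symm y v) = v := by
  have : IsManifold 𝓘(ℝ, E) 1 S := IsManifold.of_le (n := ∞) (by simp)
  have h := mfderiv_extChartAt_comp_mfderivWithin_extChartAt_symm (I := 𝓘(ℝ, E)) hy
  rw [ModelWithCorners.range_eq_univ, mfderivWithin_univ] at h
  exact congrArg (fun L => L v) h

theorem mfderiv_extChartAt_self_apply (u₀ : S) (v : TangentSpace 𝓘(ℝ, E) u₀) :
    mfderiv 𝓘(ℝ, E) 𝓘(ℝ, E) (extChartAt 𝓘(ℝ, E) u₀) u₀ v = v := by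
  have : IsManifold 𝓘(ℝ, E) 1 S := IsManifold.of_le (n := ∞) (by simp)
  exact congrArg (fun L => L v) (mfderiv_extChartAt_self (I := 𝓘(ℝ, E)) (x := u₀))

theorem mfderiv_extChartAt_symm_self_apply (u₀ : S) (v : E) :
    mfderiv 𝓘(ℝ, E) 𝓘(ℝ, E) (extChartAt 𝓘(ℝ, E) u₀).symm (extChartAt 𝓘(ℝ, E) u₀ u₀) v = v := by
  have : IsManifold 𝓘(ℝ, E) 1 S := IsManifold.of_le (n := ∞) (by simp)
  have h := mfderivWithin_range_extChartAt_symm (I := 𝓘(ℝ, E)) (x := u₀)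
  rw [ModelWithCorners.range_eq_univ, mfderivWithin_univ] at h
  exact congrArg (fun L => L v) h

theorem isOpen_extChartAt_target' (u₀ : S) : IsOpen (extChartAt 𝓘(ℝ, E) u₀).target :=
  isOpen_extChartAt_target u₀

/-- The expression of a vector field in the preferred chart at `u₀`. -/
def vecInChart (X : ∀ u : S, TangentSpace 𝓘(ℝ, E) u) (u₀ : S) (y : E) : E :=
  mfderiv 𝓘(ℝ, E) 𝓘(ℝ, E) (extChartAt 𝓘(ℝ, E) u₀) ((extChartAt 𝓘(ℝ, E) u₀).symm y)
    (X ((extChartAt 𝓘(ℝ, E) u₀).symm y))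

/-- A vector field is smooth if its expressions in charts are. -/
def IsSmoothField (X : ∀ u : S, TangentSpace 𝓘(ℝ, E) u) : Prop :=
  ∀ u₀ : S, ContDiffOn ℝ ∞ (vecInChart X u₀) (extChartAt 𝓘(ℝ, E) u₀).target

theorem mfderiv_symm_vecInChart (X : ∀ u : S, TangentSpace 𝓘(ℝ, E) u) {u₀ : S} {y : E}
    (hy : y ∈ (extChartAt 𝓘(ℝ, E) u₀).target) :
    mfderiv 𝓘(ℝ, E) 𝓘(ℝ, E) (extChartAt 𝓘(ℝ, E) u₀).symm y (vecInChart (E := E) X u₀ y) =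
      X ((extChartAt 𝓘(ℝ, E) u₀).symm y) :=
  mfderiv_extChartAt_symm_apply hy _

/-- The trivialization of the tangent bundle at `u₀` reads a vector through the differential of the
preferred chart, which is how `vecInChart` reads it. -/
theorem IsSmoothField.contMDiff {X : ∀ u : S, TangentSpace 𝓘(ℝ, E) u} (hX : IsSmoothField X) :
    ContMDiff 𝓘(ℝ, E) 𝓘(ℝ, E).tangent ∞
      (fun u => (⟨u, X u⟩ : TangentBundle 𝓘(ℝ, E) S)) := by
  have : IsManifold 𝓘(ℝ, E) 1 S := IsManifold.of_le (n := ∞) (by simp)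
  intro u₀
  refine (Bundle.contMDiffAt_section (F := E) (E := TangentSpace 𝓘(ℝ, E)) (s := X) u₀).2 ?_
  have h1 : ContMDiffAt 𝓘(ℝ, E) 𝓘(ℝ, E) ∞
      (fun u => vecInChart X u₀ (extChartAt 𝓘(ℝ, E) u₀ u)) u₀ := by
    have ht := (isOpen_extChartAt_target' u₀).mem_nhds (mem_extChartAt_target (I := 𝓘(ℝ, E)) u₀)
    exact ((hX u₀).contDiffAt ht).contMDiffAt.comp u₀ contMDiffAt_extChartAt
  refine h1.congr_of_eventuallyEq ?_
  filter_upwards [chart_source_mem_nhds E u₀] with u hu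
  have := TangentBundle.continuousLinearMapAt_trivializationAt (I := 𝓘(ℝ, E)) hu
  have h2 := congrArg (fun L => L (X u)) this
  have hu' : u ∈ (extChartAt 𝓘(ℝ, E) u₀).source := by rwa [extChartAt_source]
  rw [vecInChart, (extChartAt 𝓘(ℝ, E) u₀).left_inv hu']
  refine Eq.trans ?_ h2
  exact (Bundle.Trivialization.coe_linearMapAt_of_mem (R := ℝ)
    (trivializationAt E (TangentSpace 𝓘(ℝ, E)) u₀) (by simpa using hu) ▸ rfl)

/-- If `Φ` has the expression `φ` in a chart, then its derivative is obtained from that of `φ`. -/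
theorem hasMFDerivAt_symm_comp {P : Type*} [NormedAddCommGroup P] [NormedSpace ℝ P] {u₀ : S}
    {φ : P → E} {φ' : P →L[ℝ] E} {z : P} (hz : φ z ∈ (extChartAt 𝓘(ℝ, E) u₀).target)
    (hφ : HasFDerivAt φ φ' z) :
    HasMFDerivAt 𝓘(ℝ, P) 𝓘(ℝ, E) (fun z => (extChartAt 𝓘(ℝ, E) u₀).symm (φ z)) z
      ((mfderiv 𝓘(ℝ, E) 𝓘(ℝ, E) (extChartAt 𝓘(ℝ, E) u₀).symm (φ z)).comp φ') :=
  (hasMFDerivAt_extChartAt_symm hz).comp z hφ.hasMFDerivAt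

end ChartCalculus

/-! ### Smoothness of the flow of a complete vector field. -/

section Flow

variable {E : Type} [NormedAddCommGroup E] [NormedSpace ℝ E] [FiniteDimensional ℝ E]
  {S : Type*} [TopologicalSpace S] [T2Space S] [ChartedSpace E S] [IsManifold 𝓘(ℝ, E) ∞ S]

/-- The field is cut off in a chart to one defined on all of `E`. Solutions starting near `u₀` over
short times stay where the cutoff equals `1`, and uniqueness of integral curves identifies them with
`Ψ`. -/
theorem exists_local_flow_inChart {X : ∀ u : S, TangentSpace 𝓘(ℝ, E) u} (hX : IsSmoothField X)
    {Ψ : ℝ → S → S} (h0 : ∀ u, Ψ 0 u = u)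
    (hΨ : ∀ u, IsMIntegralCurve (I := 𝓘(ℝ, E)) (fun t => Ψ t u) X)
    (u₀ : S) :
    ∃ g : ℝ × E → E, ContDiffAt ℝ ∞ g (0, extChartAt 𝓘(ℝ, E) u₀ u₀) ∧
      ∀ᶠ p in 𝓝 ((0 : ℝ), extChartAt 𝓘(ℝ, E) u₀ u₀), g p ∈ (extChartAt 𝓘(ℝ, E) u₀).target ∧
        Ψ p.1 ((extChartAt 𝓘(ℝ, E) u₀).symm p.2) = (extChartAt 𝓘(ℝ, E) u₀).symm (g p) := by
  have : IsManifold 𝓘(ℝ, E) 1 S := IsManifold.of_le (n := ∞) (by simp)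
  set φ := extChartAt 𝓘(ℝ, E) u₀ with hφ
  have hto : IsOpen φ.target := isOpen_extChartAt_target' u₀
  have hx₀ : φ u₀ ∈ φ.target := mem_extChartAt_target u₀
  obtain ⟨R, hR, hRt⟩ := Metric.isOpen_iff.1 hto _ hx₀
  let χ : ContDiffBump (φ u₀) := ⟨R / 4, R / 2, by positivity, by linarith⟩
  let f : E → E := fun y => χ y • vecInChart X u₀ y
  have hf : ContDiff ℝ ∞ f := by
    rw [contDiff_iff_contDiffAt]
    intro y
    by_cases hy : y ∈ φ.target
    · exact χ.contDiff.contDiffAt.smul ((hX u₀).contDiffAt (hto.mem_nhds hy))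
    · have hy' : y ∉ Metric.closedBall (φ u₀) (R / 2) := fun h =>
        hy (hRt (Metric.closedBall_subset_ball (by linarith) h))
      have : f =ᶠ[𝓝 y] fun _ => 0 := by
        filter_upwards [Metric.isClosed_closedBall.isOpen_compl.mem_nhds hy'] with z hz
        have : χ z = 0 := χ.zero_of_le_dist (by
          simp only [mem_compl_iff, Metric.mem_closedBall, not_le] at hz
          exact hz.le)
        simp [f, this]
      exact contDiffAt_const.congr_of_eventuallyEq this
  obtain ⟨Γ, hΓ1, hΓ2, hΓ3⟩ := exists_smooth_family_of_solutions f hf (φ u₀)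
  refine ⟨fun p => Γ p 1, hΓ2, ?_⟩
  filter_upwards [hΓ1 (R / 4) (by positivity), hΓ3] with p hp1 hp2
  have hin : ∀ s, Γ p s ∈ φ.target := fun s =>
    hRt (Metric.ball_subset_ball (by linarith) (Metric.mem_ball.2 (hp1 s)))
  have hfe : ∀ s, f (Γ p s) = vecInChart X u₀ (Γ p s) := fun s => by
    have : χ (Γ p s) = 1 := χ.one_of_mem_closedBall (Metric.mem_closedBall.2 (hp1 s).le)
    simp [f, this]
  refine ⟨hin 1, ?_⟩
  have hc1 : IsMIntegralCurveOn (I := 𝓘(ℝ, E)) (fun s => φ.symm (Γ p s)) (p.1 • X)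
      (Ioo (-2) 2) := by
    intro s hs
    have h1 := hasMFDerivAt_symm_comp (S := S) (hin s) (hp2.2 s hs).hasFDerivAt
    refine (h1.congr_mfderiv ?_).hasMFDerivWithinAt
    let L : E →L[ℝ] E := mfderiv 𝓘(ℝ, E) 𝓘(ℝ, E) φ.symm (Γ p s)
    have hL : L (vecInChart X u₀ (Γ p s)) = X (φ.symm (Γ p s)) :=
      mfderiv_symm_vecInChart X (hin s)
    refine ContinuousLinearMap.ext fun (r : ℝ) => ?_
    change L (r • (p.1 • f (Γ p s))) = (r • (p.1 • X (φ.symm (Γ p s))) : E)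
    rw [hfe, map_smul, map_smul, hL]
    rfl
  -- Slowing time down by `p.1` turns the flow line into an integral curve of `p.1 • X`; its value
  -- at `s = 1` is the flow at time `p.1`.
  have hc2 : IsMIntegralCurveOn (I := 𝓘(ℝ, E)) (fun s => Ψ (s * p.1) (φ.symm p.2)) (p.1 • X)
      (Ioo (-2) 2) := ((hΨ (φ.symm p.2)).comp_mul p.1).isMIntegralCurveOn _
  have hsm : ContMDiff 𝓘(ℝ, E) 𝓘(ℝ, E).tangent 1
      (fun u => (⟨u, (p.1 • X) u⟩ : TangentBundle 𝓘(ℝ, E) S)) :=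
    (ContMDiff.smul_section (contMDiff_const (c := p.1)) hX.contMDiff).of_le (by simp)
  have := isMIntegralCurveOn_Ioo_eqOn_of_contMDiff_boundaryless (t₀ := 0) (by norm_num) hsm
    hc2 hc1 (by simp [h0, hp2.1]) (by norm_num : (1 : ℝ) ∈ Ioo (-2 : ℝ) 2)
  simpa using this

theorem contMDiffAt_flow_zero {X : ∀ u : S, TangentSpace 𝓘(ℝ, E) u} (hX : IsSmoothField X)
    {Ψ : ℝ → S → S} (h0 : ∀ u, Ψ 0 u = u)
    (hΨ : ∀ u, IsMIntegralCurve (I := 𝓘(ℝ, E)) (fun t => Ψ t u) X)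
    (u₀ : S) :
    ContMDiffAt (𝓘(ℝ, ℝ).prod 𝓘(ℝ, E)) 𝓘(ℝ, E) ∞ (fun p : ℝ × S => Ψ p.1 p.2) (0, u₀) := by
  obtain ⟨g, hg, key⟩ := exists_local_flow_inChart hX h0 hΨ u₀
  set φ := extChartAt 𝓘(ℝ, E) u₀ with hφ
  have hto : IsOpen φ.target := isOpen_extChartAt_target' u₀
  have hsnd : ContMDiffAt (𝓘(ℝ, ℝ).prod 𝓘(ℝ, E)) 𝓘(ℝ, E) ∞ (fun p : ℝ × S => φ p.2) (0, u₀) :=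
    ContMDiffAt.comp (g := φ) (f := fun p : ℝ × S => p.2) (0, u₀)
      (contMDiffAt_extChartAt (I := 𝓘(ℝ, E)) (x := u₀)) contMDiffAt_snd
  have hc : ContMDiffAt (𝓘(ℝ, ℝ).prod 𝓘(ℝ, E)) 𝓘(ℝ, ℝ × E) ∞
      (fun p : ℝ × S => (p.1, φ p.2)) (0, u₀) :=
    ContMDiffAt.prodMk_space (f := fun p : ℝ × S => p.1) contMDiffAt_fst hsnd
  have h1 : ContMDiffAt (𝓘(ℝ, ℝ).prod 𝓘(ℝ, E)) 𝓘(ℝ, E) ∞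
      (fun p : ℝ × S => g (p.1, φ p.2)) (0, u₀) :=
    ContMDiffAt.comp (I' := 𝓘(ℝ, ℝ × E)) (g := g) (f := fun p : ℝ × S => (p.1, φ p.2)) (0, u₀)
      hg.contMDiffAt hc
  have hlim : Tendsto (fun p : ℝ × S => (p.1, φ p.2)) (𝓝 ((0 : ℝ), u₀)) (𝓝 ((0 : ℝ), φ u₀)) :=
    hc.continuousAt
  have hkey' : ∀ᶠ p in 𝓝 ((0 : ℝ), u₀), g (p.1, φ p.2) ∈ φ.target ∧
      Ψ p.1 (φ.symm (φ p.2)) = φ.symm (g (p.1, φ p.2)) := hlim.eventually key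
  have h2 : ContMDiffAt (𝓘(ℝ, ℝ).prod 𝓘(ℝ, E)) 𝓘(ℝ, E) ∞
      (fun p : ℝ × S => φ.symm (g (p.1, φ p.2))) (0, u₀) := by
    have ht : g (0, φ u₀) ∈ φ.target := hkey'.self_of_nhds.1
    have h3 : ContMDiffAt 𝓘(ℝ, E) 𝓘(ℝ, E) ∞ φ.symm (g (0, φ u₀)) :=
      (contMDiffOn_extChartAt_symm u₀).contMDiffAt (hto.mem_nhds ht)
    exact ContMDiffAt.comp (g := φ.symm) (f := fun p : ℝ × S => g (p.1, φ p.2)) (0, u₀) h3 h1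
  refine h2.congr_of_eventuallyEq ?_
  have hsrc : ∀ᶠ p : ℝ × S in 𝓝 ((0 : ℝ), u₀), p.2 ∈ φ.source :=
    (continuousAt_snd (p := ((0 : ℝ), u₀))).eventually
      (extChartAt_source_mem_nhds (I := 𝓘(ℝ, E)) u₀)
  filter_upwards [hkey', hsrc] with p hp hp'
  rw [← hp.2, φ.left_inv hp']

/-- The flow property. -/
theorem flow_add {X : ∀ u : S, TangentSpace 𝓘(ℝ, E) u} (hX : IsSmoothField X)
    {Ψ : ℝ → S → S} (h0 : ∀ u, Ψ 0 u = u)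
    (hΨ : ∀ u, IsMIntegralCurve (I := 𝓘(ℝ, E)) (fun t => Ψ t u) X) (s t : ℝ) (u : S) :
    Ψ (s + t) u = Ψ s (Ψ t u) := by
  have : IsManifold 𝓘(ℝ, E) 1 S := IsManifold.of_le (n := ∞) (by simp)
  have := isMIntegralCurve_Ioo_eq_of_contMDiff_boundaryless (t₀ := 0) (hX.contMDiff.of_le (by simp))
    ((hΨ u).comp_add t) (hΨ (Ψ t u)) (by simp [h0])
  exact congrFun this s

/-- The flow of a smooth complete vector field is smooth. -/
theorem contMDiff_flow {X : ∀ u : S, TangentSpace 𝓘(ℝ, E) u} (hX : IsSmoothField X)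
    {Ψ : ℝ → S → S} (h0 : ∀ u, Ψ 0 u = u)
    (hΨ : ∀ u, IsMIntegralCurve (I := 𝓘(ℝ, E)) (fun t => Ψ t u) X) :
    ContMDiff (𝓘(ℝ, ℝ).prod 𝓘(ℝ, E)) 𝓘(ℝ, E) ∞ (fun p : ℝ × S => Ψ p.1 p.2) := by
  have hadd := flow_add hX h0 hΨ
  have hloc := contMDiffAt_flow_zero hX h0 hΨ
  -- For finite `n`, being `C^n` at a point is an open condition; this is used in `step` below.
  rw [contMDiff_infty]
  rintro n ⟨t₀, u₀⟩
  -- The times at which the flow map is `C^n` at `u₀` form a clopen set: `Ψ_r = Ψ_{r-s} ∘ Ψ_s`, and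
  -- `Ψ` is jointly smooth near time `0` at `Ψ_t u₀`.
  let A : Set ℝ := {t | ContMDiffAt 𝓘(ℝ, E) 𝓘(ℝ, E) n (fun u => Ψ t u) u₀}
  have step : ∀ t : ℝ, ∃ ε > 0, ∀ s, |s - t| < ε → ∀ r, |r - t| < ε → s ∈ A →
      ContMDiffAt (𝓘(ℝ, ℝ).prod 𝓘(ℝ, E)) 𝓘(ℝ, E) n (fun p : ℝ × S => Ψ p.1 p.2) (r, u₀) := by
    intro t
    have h1 : ∀ᶠ p in 𝓝 ((0 : ℝ), Ψ t u₀), ContMDiffAt (𝓘(ℝ, ℝ).prod 𝓘(ℝ, E)) 𝓘(ℝ, E) n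
        (fun p : ℝ × S => Ψ p.1 p.2) p := by
      have : IsManifold 𝓘(ℝ, E) n S := IsManifold.of_le (n := ∞) (by exact_mod_cast le_top)
      exact (contMDiffAt_iff_contMDiffAt_nhds (by simp)).1
        (contMDiffAt_infty.1 (hloc (Ψ t u₀)) n)
    have hcont : Tendsto (fun q : ℝ × ℝ => (q.2 - q.1, Ψ q.1 u₀)) (𝓝 (t, t))
        (𝓝 ((0 : ℝ), Ψ t u₀)) := by
      have hc : Continuous fun q : ℝ × ℝ => (q.2 - q.1, Ψ q.1 u₀) :=
        (continuous_snd.sub continuous_fst).prodMk ((hΨ u₀).continuous.comp continuous_fst)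
      simpa using hc.tendsto (t, t)
    obtain ⟨ε, hε, H⟩ := Metric.eventually_nhds_iff.1 (hcont.eventually h1)
    refine ⟨ε, hε, fun s hs r hr hsA => ?_⟩
    have h2 := @H (s, r) (by
      rw [Prod.dist_eq, Real.dist_eq, Real.dist_eq]; exact max_lt hs hr)
    have h3 : ContMDiffAt (𝓘(ℝ, ℝ).prod 𝓘(ℝ, E)) (𝓘(ℝ, ℝ).prod 𝓘(ℝ, E)) n
        (fun p : ℝ × S => (p.1 - s, Ψ s p.2)) (r, u₀) := by
      refine ContMDiffAt.prodMk ?_ (ContMDiffAt.comp (r, u₀) (g := fun u => Ψ s u) hsA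
        contMDiffAt_snd)
      exact contMDiffAt_fst.sub contMDiffAt_const
    have h4 := ContMDiffAt.comp (r, u₀) (g := fun p : ℝ × S => Ψ p.1 p.2) h2 h3
    refine h4.congr_of_eventuallyEq (Eventually.of_forall fun p => ?_)
    change Ψ p.1 p.2 = Ψ (p.1 - s) (Ψ s p.2)
    rw [← hadd, sub_add_cancel]
  have slice : ∀ r, ContMDiffAt (𝓘(ℝ, ℝ).prod 𝓘(ℝ, E)) 𝓘(ℝ, E) n
      (fun p : ℝ × S => Ψ p.1 p.2) (r, u₀) → r ∈ A := fun r h =>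
    ContMDiffAt.comp u₀ (g := fun p : ℝ × S => Ψ p.1 p.2) (f := fun u => (r, u)) h
      (contMDiffAt_const.prodMk contMDiffAt_id)
  have hA : IsClopen A := by
    constructor
    · refine isClosed_of_closure_subset fun t ht => ?_
      obtain ⟨ε, hε, H⟩ := step t
      obtain ⟨s, hsA, hs⟩ := Metric.mem_closure_iff.1 ht ε hε
      rw [dist_comm, Real.dist_eq] at hs
      exact slice t (H s hs t (by simpa using hε) hsA)
    · rw [Metric.isOpen_iff]
      intro t ht
      obtain ⟨ε, hε, H⟩ := step t
      exact ⟨ε, hε, fun r hr => slice r (H t (by simpa using hε) r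
        (by rwa [Metric.mem_ball, Real.dist_eq] at hr) ht)⟩
  have h0A : (0 : ℝ) ∈ A := by
    refine contMDiffAt_id.congr_of_eventuallyEq (Eventually.of_forall fun u => ?_)
    simp [h0]
  have hAu : A = univ := hA.eq_univ ⟨0, h0A⟩
  obtain ⟨ε, hε, H⟩ := step t₀
  exact H t₀ (by simpa using hε) t₀ (by simpa using hε) (hAu ▸ mem_univ t₀)

end Flow

/-! ## Smooth forms, pullbacks, and the flow of a coframing of curvature one -/

section FormCalculus

variable {S : Type*} [TopologicalSpace S] [ChartedSpace (EuclideanSpace ℝ (Fin 3)) S]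
  [IsManifold (𝓡 3) ∞ S]

/-- The differential of a map from a normed space to a manifold. -/
def pushD {E : Type} [NormedAddCommGroup E] [NormedSpace ℝ E]
    {N : Type*} [TopologicalSpace N] [ChartedSpace E N]
    {P : Type*} [NormedAddCommGroup P] [NormedSpace ℝ P] (Φ : P → N) (z : P) :
    P →L[ℝ] TangentSpace 𝓘(ℝ, E) (Φ z) :=
  mfderiv 𝓘(ℝ, P) 𝓘(ℝ, E) Φ z

theorem formInChart_apply_mfderiv (α : ∀ u : S, TangentSpace (𝓡 3) u →L[ℝ] ℝ) {u₀ u : S}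
    (hu : u ∈ (extChartAt (𝓡 3) u₀).source) (v : TangentSpace (𝓡 3) u) :
    formInChart α u₀ (extChartAt (𝓡 3) u₀ u)
      (mfderiv (𝓡 3) 𝓘(ℝ, EuclideanSpace ℝ (Fin 3)) (extChartAt (𝓡 3) u₀) u v) = α u v := by
  obtain ⟨y, hy, rfl⟩ : ∃ y ∈ (extChartAt (𝓡 3) u₀).target, (extChartAt (𝓡 3) u₀).symm y = u :=
    ⟨_, (extChartAt (𝓡 3) u₀).map_source hu, (extChartAt (𝓡 3) u₀).left_inv hu⟩
  rw [(extChartAt (𝓡 3) u₀).right_inv hy]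
  exact congrArg (α _) (mfderiv_extChartAt_symm_apply hy v)

theorem hasFDerivAt_extChartAt_comp {E : Type} [NormedAddCommGroup E] [NormedSpace ℝ E]
    {N : Type*} [TopologicalSpace N] [ChartedSpace E N] [IsManifold 𝓘(ℝ, E) ∞ N]
    {P : Type*} [NormedAddCommGroup P] [NormedSpace ℝ P]
    {Φ : P → N} {z : P} {u₀ : N} (hΦ : MDifferentiableAt 𝓘(ℝ, P) 𝓘(ℝ, E) Φ z)
    (hz : Φ z ∈ (extChartAt 𝓘(ℝ, E) u₀).source) :
    HasFDerivAt (𝕜 := ℝ) (E := P) (F := E) (fun z => extChartAt 𝓘(ℝ, E) u₀ (Φ z))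
      ((mfderiv 𝓘(ℝ, E) 𝓘(ℝ, E) (extChartAt 𝓘(ℝ, E) u₀) (Φ z)).comp
        (mfderiv 𝓘(ℝ, P) 𝓘(ℝ, E) Φ z) : P →L[ℝ] E) z := by
  have : IsManifold 𝓘(ℝ, E) 1 N := IsManifold.of_le (n := ∞) (by simp)
  rw [extChartAt_source] at hz
  have h := (mdifferentiableAt_extChartAt (I := 𝓘(ℝ, E)) hz).hasMFDerivAt.comp z hΦ.hasMFDerivAt
  exact hasMFDerivAt_iff_hasFDerivAt.1 h

theorem fderiv_extChartAt_comp {E : Type} [NormedAddCommGroup E] [NormedSpace ℝ E]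
    {N : Type*} [TopologicalSpace N] [ChartedSpace E N] [IsManifold 𝓘(ℝ, E) ∞ N]
    {P : Type*} [NormedAddCommGroup P] [NormedSpace ℝ P]
    {Φ : P → N} {z : P} {u₀ : N} (hΦ : MDifferentiableAt 𝓘(ℝ, P) 𝓘(ℝ, E) Φ z)
    (hz : Φ z ∈ (extChartAt 𝓘(ℝ, E) u₀).source) (w : P) :
    fderiv ℝ (E := P) (F := E) (fun z => extChartAt 𝓘(ℝ, E) u₀ (Φ z)) z w =
      mfderiv 𝓘(ℝ, E) 𝓘(ℝ, E) (extChartAt 𝓘(ℝ, E) u₀) (Φ z)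
        (pushD Φ z w) :=
  congrArg (fun L : P →L[ℝ] E => L w)
    (HasFDerivAt.fderiv (𝕜 := ℝ) (E := P) (F := E) (hasFDerivAt_extChartAt_comp hΦ hz))

theorem contDiffAt_extChartAt_comp {E : Type} [NormedAddCommGroup E] [NormedSpace ℝ E]
    {N : Type*} [TopologicalSpace N] [ChartedSpace E N] [IsManifold 𝓘(ℝ, E) ∞ N]
    {P : Type*} [NormedAddCommGroup P] [NormedSpace ℝ P] {n : ℕ∞ω} (hn : n ≤ (∞ : ℕ∞ω))
    {Φ : P → N} {z : P} {u₀ : N} (hΦ : ContMDiffAt 𝓘(ℝ, P) 𝓘(ℝ, E) n Φ z)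
    (hz : Φ z ∈ (extChartAt 𝓘(ℝ, E) u₀).source) :
    ContDiffAt ℝ n (fun z => extChartAt 𝓘(ℝ, E) u₀ (Φ z)) z := by
  rw [extChartAt_source] at hz
  exact ((contMDiffAt_extChartAt' (I := 𝓘(ℝ, E)) (n := ∞) hz).of_le hn |>.comp z hΦ).contDiffAt

theorem eventually_mdifferentiableAt {E : Type} [NormedAddCommGroup E] [NormedSpace ℝ E]
    {N : Type*} [TopologicalSpace N] [ChartedSpace E N] [IsManifold 𝓘(ℝ, E) ∞ N]
    {P : Type*} [NormedAddCommGroup P] [NormedSpace ℝ P]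
    {Φ : P → N} {z : P} (hΦ : ContMDiffAt 𝓘(ℝ, P) 𝓘(ℝ, E) ∞ Φ z) :
    ∀ᶠ z' in 𝓝 z, MDifferentiableAt 𝓘(ℝ, P) 𝓘(ℝ, E) Φ z' := by
  have : IsManifold 𝓘(ℝ, E) 1 N := IsManifold.of_le (n := ∞) (by simp)
  filter_upwards [(contMDiffAt_iff_contMDiffAt_nhds (n := 1) (by simp)).1
    (hΦ.of_le (by simp : (1 : ℕ∞ω) ≤ (∞ : ℕ∞ω)))] with z' hz'
  exact hz'.mdifferentiableAt (by simp)

/-- It replaces a pullback, whose terms live in varying tangent spaces, by a composition of maps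
between fixed normed spaces that can be differentiated. -/
theorem eventuallyEq_formInChart (α : ∀ u : S, TangentSpace (𝓡 3) u →L[ℝ] ℝ) {P : Type*}
    [NormedAddCommGroup P] [NormedSpace ℝ P] {Φ : P → S} {z₀ : P} {u₀ : S}
    (hΦ : ContMDiffAt 𝓘(ℝ, P) (𝓡 3) ∞ Φ z₀) (hz : Φ z₀ ∈ (extChartAt (𝓡 3) u₀).source) (w : P) :
    (fun z => α (Φ z) (pushD Φ z w)) =ᶠ[𝓝 z₀] fun z =>
      formInChart α u₀ (extChartAt (𝓡 3) u₀ (Φ z))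
        (fderiv ℝ (fun z => extChartAt (𝓡 3) u₀ (Φ z)) z w) := by
  have hs : ∀ᶠ z in 𝓝 z₀, Φ z ∈ (extChartAt (𝓡 3) u₀).source :=
    hΦ.continuousAt.eventually ((isOpen_extChartAt_source (I := 𝓡 3) u₀).mem_nhds hz)
  filter_upwards [hs, eventually_mdifferentiableAt hΦ] with z hz1 hz2
  exact (formInChart_apply_mfderiv α hz1 _).symm.trans
    (congrArg (formInChart α u₀ _) (fderiv_extChartAt_comp hz2 hz1 w).symm)

/-- The coefficients of the pullback of a smooth form by a smooth map are smooth. -/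
theorem IsSmoothForm.contDiffAt_pullback {α : ∀ u : S, TangentSpace (𝓡 3) u →L[ℝ] ℝ}
    (hα : IsSmoothForm α) {P : Type*}
    [NormedAddCommGroup P] [NormedSpace ℝ P] {Φ : P → S} {z₀ : P}
    (hΦ : ContMDiffAt 𝓘(ℝ, P) (𝓡 3) ∞ Φ z₀) (w : P) :
    ContDiffAt ℝ ∞ (fun z => α (Φ z) (pushD Φ z w)) z₀ := by
  have hsrc := mem_extChartAt_source (I := 𝓡 3) (Φ z₀)
  refine ContDiffAt.congr_of_eventuallyEq ?_ (eventuallyEq_formInChart α hΦ hsrc w)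
  have hφ := contDiffAt_extChartAt_comp le_rfl hΦ hsrc
  have h1 : ContDiffAt ℝ ∞ (formInChart α (Φ z₀)) (extChartAt (𝓡 3) (Φ z₀) (Φ z₀)) :=
    (hα (Φ z₀)).contDiffAt
      ((isOpen_extChartAt_target (I := 𝓡 3) (Φ z₀)).mem_nhds (mem_extChartAt_target (Φ z₀)))
  exact (ContDiffAt.comp z₀ h1 hφ).clm_apply
    ((hφ.fderiv_right (m := ∞) (by simp)).clm_apply contDiffAt_const)

/-- The exterior derivative commutes with pullbacks. -/
theorem IsSmoothForm.fderiv_pullback_sub {α : ∀ u : S, TangentSpace (𝓡 3) u →L[ℝ] ℝ}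
    (hα : IsSmoothForm α) {P : Type*}
    [NormedAddCommGroup P] [NormedSpace ℝ P] {Φ : P → S} {z₀ : P}
    (hΦ : ContMDiffAt 𝓘(ℝ, P) (𝓡 3) ∞ Φ z₀) (v w : P) :
    fderiv ℝ (fun z => α (Φ z) (pushD Φ z w)) z₀ v -
      fderiv ℝ (fun z => α (Φ z) (pushD Φ z v)) z₀ w =
    extD α (Φ z₀) (pushD Φ z₀ v) (pushD Φ z₀ w) := by
  have hsrc := mem_extChartAt_source (I := 𝓡 3) (Φ z₀)
  rw [(eventuallyEq_formInChart α hΦ hsrc w).fderiv_eq,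
    (eventuallyEq_formInChart α hΦ hsrc v).fderiv_eq]
  have hφ := contDiffAt_extChartAt_comp le_rfl hΦ hsrc
  set φ : P → EuclideanSpace ℝ (Fin 3) := fun z => extChartAt (𝓡 3) (Φ z₀) (Φ z) with hφdef
  have h1 : ContDiffAt ℝ ∞ (formInChart α (Φ z₀)) (φ z₀) :=
    (hα (Φ z₀)).contDiffAt
      ((isOpen_extChartAt_target (I := 𝓡 3) (Φ z₀)).mem_nhds (mem_extChartAt_target (Φ z₀)))
  have h1d := (h1.differentiableAt (by simp)).hasFDerivAt
  have hφd := (hφ.differentiableAt (by simp)).hasFDerivAt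
  have hφ2 := ((hφ.fderiv_right (m := ∞) (by simp)).differentiableAt (by simp)).hasFDerivAt
  have hcomp : HasFDerivAt (fun z => formInChart α (Φ z₀) (φ z))
    ((fderiv ℝ (formInChart α (Φ z₀)) (φ z₀)).comp (fderiv ℝ φ z₀)) z₀ := h1d.comp z₀ hφd
  have hD : ∀ w, HasFDerivAt (fun z => formInChart α (Φ z₀) (φ z) (fderiv ℝ φ z w)) _ z₀ :=
    fun w => hcomp.clm_apply (hφ2.clm_apply (hasFDerivAt_const w z₀))
  have hsym : IsSymmSndFDerivAt ℝ φ z₀ := hφ.isSymmSndFDerivAt (by simpa using (by exact_mod_cast le_top : ((2 : ℕ∞) : ℕ∞ω) ≤ ((⊤ : ℕ∞) : ℕ∞ω)))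
  have hmf : ∀ v : P, pushD Φ z₀ v = fderiv ℝ φ z₀ v := by
    intro v
    exact (mfderiv_extChartAt_self_apply (Φ z₀) _).symm.trans
      (fderiv_extChartAt_comp (hΦ.mdifferentiableAt (by simp)) hsrc v).symm
  rw [(hD w).fderiv, (hD v).fderiv]
  unfold extD
  rw [hmf v, hmf w]
  -- The terms with second derivatives of `Φ` cancel by symmetry, leaving the antisymmetrized
  -- derivative of the coefficients.
  have hs := hsym v w
  simp [hs]
  ring_nf
  rfl

end FormCalculus

/-! ### The frame dual to a coframing. -/

section Coframing

variable {S : Type*} [TopologicalSpace S] [ChartedSpace (EuclideanSpace ℝ (Fin 3)) S]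
  [IsManifold (𝓡 3) ∞ S] (η : Coframing S)

theorem Coframing.smooth_form (i : Fin 3) : IsSmoothForm (η.form i) := η.smooth i

theorem Coframing.form_dual (i j : Fin 3) (u : S) :
    η.form i u (η.dual j u) = if i = j then 1 else 0 := by
  have : η.equiv u (η.dual j u) = Pi.single j 1 := (η.equiv u).apply_symm_apply _
  change (η.equiv u (η.dual j u)) i = _
  rw [this, Pi.single_apply]

theorem Coframing.ext_form {u : S} {V W : TangentSpace (𝓡 3) u}
    (h : ∀ i, η.form i u V = η.form i u W) : V = W :=
  (η.equiv u).injective (funext h)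

theorem Coframing.sum_dual {u : S} (V : TangentSpace (𝓡 3) u) :
    V = η.form 0 u V • η.dual 0 u + η.form 1 u V • η.dual 1 u + η.form 2 u V • η.dual 2 u := by
  refine η.ext_form fun i => ?_
  simp only [map_add, map_smul, η.form_dual, smul_eq_mul]
  fin_cases i <;> simp

/-- In a chart the coframing is a smooth family of invertible operators, and inversion of operators
is smooth. -/
theorem Coframing.isSmoothField_dual (i : Fin 3) : IsSmoothField (η.dual i) := by
  intro u₀ y hy
  have hto := isOpen_extChartAt_target (I := 𝓡 3) u₀
  let A : EuclideanSpace ℝ (Fin 3) → (EuclideanSpace ℝ (Fin 3) →L[ℝ] (Fin 3 → ℝ)) := fun y =>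
    (η.equiv ((extChartAt (𝓡 3) u₀).symm y)).toContinuousLinearMap.comp
      (mfderiv 𝓘(ℝ, EuclideanSpace ℝ (Fin 3)) (𝓡 3) (extChartAt (𝓡 3) u₀).symm y)
  have hA : ContDiffOn ℝ ∞ A (extChartAt (𝓡 3) u₀).target := by
    rw [contDiffOn_clm_apply]
    intro v
    rw [contDiffOn_pi]
    intro j
    exact (η.smooth_form j u₀).clm_apply contDiffOn_const
  let e : ∀ y ∈ (extChartAt (𝓡 3) u₀).target,
      EuclideanSpace ℝ (Fin 3) ≃L[ℝ] TangentSpace (𝓡 3) ((extChartAt (𝓡 3) u₀).symm y) :=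
    fun y hy => ContinuousLinearEquiv.equivOfInverse
      (mfderiv 𝓘(ℝ, EuclideanSpace ℝ (Fin 3)) (𝓡 3) (extChartAt (𝓡 3) u₀).symm y)
      (mfderiv (𝓡 3) 𝓘(ℝ, EuclideanSpace ℝ (Fin 3)) (extChartAt (𝓡 3) u₀)
        ((extChartAt (𝓡 3) u₀).symm y))
      (mfderiv_extChartAt_apply_symm hy) (mfderiv_extChartAt_symm_apply hy)
  have hAe : ∀ y (hy : y ∈ (extChartAt (𝓡 3) u₀).target),
      A y = ((e y hy).trans (η.equiv ((extChartAt (𝓡 3) u₀).symm y)) :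
        EuclideanSpace ℝ (Fin 3) →L[ℝ] (Fin 3 → ℝ)) := fun y hy => rfl
  have hinv : ContDiffAt ℝ ∞ (fun y => (A y).inverse (Pi.single i 1)) y := by
    have h1 : ContDiffAt ℝ ∞ ContinuousLinearMap.inverse (A y) := by
      rw [hAe y hy]; exact contDiffAt_map_inverse _
    exact (h1.comp y (hA.contDiffAt (hto.mem_nhds hy))).clm_apply contDiffAt_const
  refine (hinv.congr_of_eventuallyEq ?_).contDiffWithinAt
  filter_upwards [hto.mem_nhds hy] with z hz
  rw [hAe z hz, ContinuousLinearMap.inverse_equiv]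
  rfl

end Coframing

/-! ## The flow of `X₁` rotates the coframing -/

section Push

variable {E : Type} [NormedAddCommGroup E] [NormedSpace ℝ E]
  {N : Type*} [TopologicalSpace N] [ChartedSpace E N]
  {P : Type*} [NormedAddCommGroup P] [NormedSpace ℝ P]

theorem pushD_eq_of_hasMFDerivAt {Φ : P → N} {z : P}
    {L : P →L[ℝ] TangentSpace 𝓘(ℝ, E) (Φ z)}
    (h : HasMFDerivAt 𝓘(ℝ, P) 𝓘(ℝ, E) Φ z L) : pushD (E := E) Φ z = L :=
  h.mfderiv

/-- Chain rule, inner map between normed spaces. -/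
theorem pushD_comp {Q : Type*} [NormedAddCommGroup Q] [NormedSpace ℝ Q] {Φ : P → N} {f : Q → P}
    {z : Q} {f' : Q →L[ℝ] P} (hΦ : MDifferentiableAt 𝓘(ℝ, P) 𝓘(ℝ, E) Φ (f z))
    (hf : HasFDerivAt f f' z) (w : Q) :
    pushD (E := E) (fun z => Φ (f z)) z w = pushD (E := E) Φ (f z) (f' w) :=
  congrArg (fun L => L w) (HasMFDerivAt.comp z hΦ.hasMFDerivAt hf.hasMFDerivAt).mfderiv

/-- Chain rule, outer map between manifolds. -/
theorem pushD_outer {E' : Type} [NormedAddCommGroup E'] [NormedSpace ℝ E']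
    {N' : Type*} [TopologicalSpace N'] [ChartedSpace E' N'] {Φ : P → N} {z : P} {g : N → N'}
    (hg : MDifferentiableAt 𝓘(ℝ, E) 𝓘(ℝ, E') g (Φ z))
    (hΦ : MDifferentiableAt 𝓘(ℝ, P) 𝓘(ℝ, E) Φ z) (w : P) :
    pushD (E := E') (fun z => g (Φ z)) z w =
      mfderiv 𝓘(ℝ, E) 𝓘(ℝ, E') g (Φ z) (pushD (E := E) Φ z w) :=
  congrArg (fun L => L w) (HasMFDerivAt.comp z hg.hasMFDerivAt hΦ.hasMFDerivAt).mfderiv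

theorem pushD_extChartAt_symm_self [IsManifold 𝓘(ℝ, E) ∞ N] (u : N) (v : E) :
    pushD (E := E) (extChartAt 𝓘(ℝ, E) u).symm (extChartAt 𝓘(ℝ, E) u u) v = v :=
  mfderiv_extChartAt_symm_self_apply u v

theorem contMDiffAt_extChartAt_symm_target [IsManifold 𝓘(ℝ, E) ∞ N] {u : N} {y : E}
    (hy : y ∈ (extChartAt 𝓘(ℝ, E) u).target) :
    ContMDiffAt 𝓘(ℝ, E) 𝓘(ℝ, E) ∞ (extChartAt 𝓘(ℝ, E) u).symm y :=
  (contMDiffOn_extChartAt_symm u).contMDiffAt ((isOpen_extChartAt_target u).mem_nhds hy)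

end Push

section Rotation

variable {S : Type*} [TopologicalSpace S] [ChartedSpace (EuclideanSpace ℝ (Fin 3)) S]

/-- `Ψ` is the flow of `X₁` and the structure equations hold with `K = 1`. -/
structure IsUnitFlow (η : Coframing S) (Ψ : ℝ → S → S) : Prop where
  zero : ∀ u, Ψ 0 u = u
  curve : ∀ u, IsMIntegralCurve (I := 𝓡 3) (fun t => Ψ t u) (η.dual 0)
  eqs : ∃ I J : S → ℝ, η.StructureEquations I J (fun _ => 1)

namespace IsUnitFlow

variable [T2Space S] [IsManifold (𝓡 3) ∞ S] {η : Coframing S} {Ψ : ℝ → S → S}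

theorem add (h : IsUnitFlow η Ψ) (s t : ℝ) (u : S) : Ψ (s + t) u = Ψ s (Ψ t u) :=
  flow_add (η.isSmoothField_dual 0) h.zero h.curve s t u

theorem contMDiff (h : IsUnitFlow η Ψ) :
    ContMDiff (𝓘(ℝ, ℝ).prod (𝓡 3)) (𝓡 3) ∞ (fun p : ℝ × S => Ψ p.1 p.2) :=
  contMDiff_flow (η.isSmoothField_dual 0) h.zero h.curve

theorem contMDiff_time (h : IsUnitFlow η Ψ) (t : ℝ) : ContMDiff (𝓡 3) (𝓡 3) ∞ (Ψ t) :=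
  h.contMDiff.comp (contMDiff_const.prodMk contMDiff_id)

/-- The flow composed with smooth maps into time and space is smooth. -/
theorem contMDiffAt_comp (h : IsUnitFlow η Ψ) {P : Type*} [NormedAddCommGroup P]
    [NormedSpace ℝ P] {τ : P → ℝ} {ν : P → S} {z : P} (hτ : ContDiffAt ℝ ∞ τ z)
    (hν : ContMDiffAt 𝓘(ℝ, P) (𝓡 3) ∞ ν z) :
    ContMDiffAt 𝓘(ℝ, P) (𝓡 3) ∞ (fun z => Ψ (τ z) (ν z)) z :=
  ContMDiffAt.comp (g := fun p : ℝ × S => Ψ p.1 p.2) (f := fun z => (τ z, ν z)) z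
    (h.contMDiff (τ z, ν z)) (hτ.contMDiffAt.prodMk hν)

/-- Derivative of `z ↦ Ψ (τ z) (ν z)`. -/
theorem pushD_comp (h : IsUnitFlow η Ψ) {P : Type*} [NormedAddCommGroup P]
    [NormedSpace ℝ P] {τ : P → ℝ} {ν : P → S} {z : P} {τ' : P →L[ℝ] ℝ}
    (hτ : HasFDerivAt τ τ' z)
    (hν : MDifferentiableAt 𝓘(ℝ, P) (𝓡 3) ν z) (w : P) :
    pushD (fun z => Ψ (τ z) (ν z)) z w =
      τ' w • η.dual 0 (Ψ (τ z) (ν z)) +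
        mfderiv (𝓡 3) (𝓡 3) (Ψ (τ z)) (ν z) (pushD ν z w) := by
  have hd := (h.contMDiff (τ z, ν z)).mdifferentiableAt (by simp)
  have h1 : HasMFDerivAt 𝓘(ℝ, P) (𝓘(ℝ, ℝ).prod (𝓡 3)) (fun z => (τ z, ν z)) z
      (ContinuousLinearMap.prod τ' (pushD ν z)) :=
    hτ.hasMFDerivAt.prodMk hν.hasMFDerivAt
  have h2 := (HasMFDerivAt.comp (g := fun p : ℝ × S => Ψ p.1 p.2) z hd.hasMFDerivAt h1).mfderiv
  refine (congrArg (fun L => L w) h2).trans ?_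
  have h3 := mfderiv_prod_eq_add_apply hd
    (v := ((τ' w, pushD ν z w) : TangentSpace (𝓘(ℝ, ℝ).prod (𝓡 3)) (τ z, ν z)))
  refine h3.trans ?_
  congr 1
  exact congrArg (fun L => L (τ' w)) (h.curve (ν z) (τ z)).mfderiv

/-- This is Cartan's formula for the Lie derivative along `X₁`. On `ℝ × chart`, the pullback of the
form evaluates on the time direction to the constant `ω_i(X₁)`, so only one term of the exterior
derivative survives. -/
theorem hasDerivAt_form (h : IsUnitFlow η Ψ) (i : Fin 3) (u : S) (V : TangentSpace (𝓡 3) u)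
    (t : ℝ) :
    HasDerivAt (fun t => η.form i (Ψ t u) (mfderiv (𝓡 3) (𝓡 3) (Ψ t) u V))
      (extD (η.form i) (Ψ t u) (η.dual 0 (Ψ t u)) (mfderiv (𝓡 3) (𝓡 3) (Ψ t) u V)) t := by
  let φ := extChartAt (𝓡 3) u
  let V' : E3 := V
  let ν : ℝ × E3 → S := fun z => φ.symm z.2
  have hto := isOpen_extChartAt_target (I := 𝓡 3) u
  have hut : φ u ∈ φ.target := mem_extChartAt_target u
  have hν : ∀ z : ℝ × E3, z.2 ∈ φ.target → ContMDiffAt 𝓘(ℝ, ℝ × E3) (𝓡 3) ∞ ν z := fun z hz =>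
    ContMDiffAt.comp z (contMDiffAt_extChartAt_symm_target hz)
      (contDiff_snd.contMDiff.contMDiffAt)
  let Φ : ℝ × E3 → S := fun z => Ψ z.1 (ν z)
  have hΦ : ContMDiffAt 𝓘(ℝ, ℝ × E3) (𝓡 3) ∞ Φ (t, φ u) :=
    h.contMDiffAt_comp contDiffAt_fst (hν _ hut)
  have hΦd : ∀ z : ℝ × E3, z.2 ∈ φ.target → ∀ w : ℝ × E3, pushD Φ z w =
      w.1 • η.dual 0 (Φ z) + mfderiv (𝓡 3) (𝓡 3) (Ψ z.1) (ν z)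
        (pushD φ.symm z.2 w.2) := fun z hz w => by
    refine (h.pushD_comp hasFDerivAt_fst ((hν z hz).mdifferentiableAt (by simp)) w).trans ?_
    refine congrArg (fun W => w.1 • η.dual 0 (Φ z) + mfderiv (𝓡 3) (𝓡 3) (Ψ z.1) (ν z) W) ?_
    exact FinslerSurface.pushD_comp (Φ := φ.symm) ((contMDiffAt_extChartAt_symm_target hz).mdifferentiableAt
      (by simp)) hasFDerivAt_snd w
  -- the pullback of the form in the time direction is constant
  have hv : ∀ z : ℝ × E3, z.2 ∈ φ.target → pushD Φ z ((1 : ℝ), (0 : E3)) = η.dual 0 (Φ z) := by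
    intro z hz
    rw [hΦd z hz]
    simp
  have hA : (fun z => η.form i (Φ z) (pushD Φ z ((1 : ℝ), (0 : E3))))
      =ᶠ[𝓝 (t, φ u)] fun _ => if i = 0 then 1 else 0 := by
    filter_upwards [continuousAt_snd.eventually (hto.mem_nhds hut)] with z hz
    rw [hv z hz, η.form_dual]
  have hmain := (η.smooth_form i).fderiv_pullback_sub hΦ ((1 : ℝ), (0 : E3)) ((0 : ℝ), V')
  rw [hA.fderiv_eq] at hmain
  have hw : ∀ t, pushD Φ (t, φ u) ((0 : ℝ), V') =
      mfderiv (𝓡 3) (𝓡 3) (Ψ t) (φ.symm (φ u)) (pushD φ.symm (φ u) V') := by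
    intro t
    rw [hΦd _ hut]
    simp [ν]
  rw [hv _ hut, hw t] at hmain
  have hdiff := ((η.smooth_form i).contDiffAt_pullback hΦ ((0 : ℝ), V')).differentiableAt
    (by simp)
  have hcurve : HasDerivAt (fun s : ℝ => (s, φ u)) ((1 : ℝ), (0 : E3)) t :=
    (hasDerivAt_id t).prodMk (hasDerivAt_const t (φ u))
  have hfin := hdiff.hasFDerivAt.comp_hasDerivAt t hcurve
  have hsub : φ.symm (φ u) = u := extChartAt_to_inv (I := 𝓡 3) u
  have hV : pushD φ.symm (φ u) V' = V' := pushD_extChartAt_symm_self u V'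
  -- The equality `φ.symm (φ u) = u` is not definitional, so the tangent spaces differ; quantifying
  -- over `u'` lets the equality be substituted.
  have e1 : ∀ (u' : S) (hu' : u' = u) (W : TangentSpace (𝓡 3) u') (hW : W = V') (s : ℝ),
      η.form i (Ψ s u') (mfderiv (𝓡 3) (𝓡 3) (Ψ s) u' W) =
      η.form i (Ψ s u) (mfderiv (𝓡 3) (𝓡 3) (Ψ s) u V) := by rintro _ rfl _ rfl s; rfl
  have e2 : ∀ (u' : S) (hu' : u' = u) (W : TangentSpace (𝓡 3) u') (hW : W = V') (s : ℝ),
      extD (η.form i) (Ψ s u') (η.dual 0 (Ψ s u')) (mfderiv (𝓡 3) (𝓡 3) (Ψ s) u' W) =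
      extD (η.form i) (Ψ s u) (η.dual 0 (Ψ s u)) (mfderiv (𝓡 3) (𝓡 3) (Ψ s) u V) := by
    rintro _ rfl _ rfl s; rfl
  have hd' : fderiv ℝ (fun z => η.form i (Φ z) (pushD Φ z ((0 : ℝ), V')))
      (t, φ u) ((1 : ℝ), (0 : E3)) =
      extD (η.form i) (Ψ t u) (η.dual 0 (Ψ t u)) (mfderiv (𝓡 3) (𝓡 3) (Ψ t) u V) := by
    refine Eq.trans ?_ (e2 _ hsub _ hV t)
    refine Eq.trans ?_ hmain
    simp
  rw [hd'] at hfin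
  refine hfin.congr_of_eventuallyEq (Eventually.of_forall fun s => ?_)
  change _ = η.form i (Φ (s, φ u)) (pushD Φ (s, φ u) ((0 : ℝ), V'))
  rw [hw s]
  exact (e1 _ hsub _ hV s).symm

theorem mfderiv_time_zero (h : IsUnitFlow η Ψ) (i : Fin 3) (u : S) (V : TangentSpace (𝓡 3) u) :
    η.form i (Ψ 0 u) (mfderiv (𝓡 3) (𝓡 3) (Ψ 0) u V) = η.form i u V := by
  have h0 : Ψ 0 = id := funext h.zero
  rw [h0, mfderiv_id]
  rfl

/-- Contracting the structure equations with `X₁` removes `I` and `J` and leaves `B₀' = 0`, `B₁' =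
B₂`, `B₂' = -B₁`, whose solutions are rotations. -/
theorem form_mfderiv (h : IsUnitFlow η Ψ) (t : ℝ) (u : S) (V : TangentSpace (𝓡 3) u) :
    η.form 0 (Ψ t u) (mfderiv (𝓡 3) (𝓡 3) (Ψ t) u V) = η.form 0 u V ∧
    η.form 1 (Ψ t u) (mfderiv (𝓡 3) (𝓡 3) (Ψ t) u V) =
      Real.cos t * η.form 1 u V + Real.sin t * η.form 2 u V ∧
    η.form 2 (Ψ t u) (mfderiv (𝓡 3) (𝓡 3) (Ψ t) u V) =
      -Real.sin t * η.form 1 u V + Real.cos t * η.form 2 u V := by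
  obtain ⟨I, J, hIJ⟩ := h.eqs
  set B : Fin 3 → ℝ → ℝ := fun i t => η.form i (Ψ t u) (mfderiv (𝓡 3) (𝓡 3) (Ψ t) u V) with hB
  have hd0 : ∀ t, HasDerivAt (B 0) 0 t := fun t => by
    refine (h.hasDerivAt_form 0 u V t).congr_deriv ?_
    rw [(hIJ _ _ _).1]
    simp [wedge, η.form_dual]
  have hd1 : ∀ t, HasDerivAt (B 1) (B 2 t) t := fun t => by
    refine (h.hasDerivAt_form 1 u V t).congr_deriv ?_
    rw [(hIJ _ _ _).2.1]
    simp [wedge, η.form_dual, hB]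
  have hd2 : ∀ t, HasDerivAt (B 2) (-B 1 t) t := fun t => by
    refine (h.hasDerivAt_form 2 u V t).congr_deriv ?_
    rw [(hIJ _ _ _).2.2]
    simp [wedge, η.form_dual, hB]
  have hz : ∀ i, B i 0 = η.form i u V := fun i => h.mfderiv_time_zero i u V
  have c0 : B 0 t = B 0 0 :=
    is_const_of_deriv_eq_zero (fun t => (hd0 t).differentiableAt) (fun t => (hd0 t).deriv) t 0
  -- Rotating `(B 1, B 2)` back through the angle `t` gives conserved quantities.
  have c1 : Real.cos t * B 1 t - Real.sin t * B 2 t = Real.cos 0 * B 1 0 - Real.sin 0 * B 2 0 := by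
    have hD : ∀ t, HasDerivAt (fun t => Real.cos t * B 1 t - Real.sin t * B 2 t) 0 t := fun t => by
      refine (((Real.hasDerivAt_cos t).mul (hd1 t)).sub
        ((Real.hasDerivAt_sin t).mul (hd2 t))).congr_deriv ?_
      ring
    exact is_const_of_deriv_eq_zero (f := fun t => Real.cos t * B 1 t - Real.sin t * B 2 t)
      (fun t => (hD t).differentiableAt) (fun t => (hD t).deriv) t 0
  have c2 : Real.sin t * B 1 t + Real.cos t * B 2 t = Real.sin 0 * B 1 0 + Real.cos 0 * B 2 0 := by
    have hD : ∀ t, HasDerivAt (fun t => Real.sin t * B 1 t + Real.cos t * B 2 t) 0 t := fun t => by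
      refine (((Real.hasDerivAt_sin t).mul (hd1 t)).add
        ((Real.hasDerivAt_cos t).mul (hd2 t))).congr_deriv ?_
      ring
    exact is_const_of_deriv_eq_zero (f := fun t => Real.sin t * B 1 t + Real.cos t * B 2 t)
      (fun t => (hD t).differentiableAt) (fun t => (hD t).deriv) t 0
  simp only [Real.cos_zero, Real.sin_zero, one_mul, zero_mul, sub_zero, zero_add, hz] at c0 c1 c2
  have hsc := Real.sin_sq_add_cos_sq t
  refine ⟨c0, ?_, ?_⟩
  · change B 1 t = _
    rw [← c1, ← c2]; linear_combination (-B 1 t) * hsc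
  · change B 2 t = _
    rw [← c1, ← c2]; linear_combination (-B 2 t) * hsc

end IsUnitFlow

end Rotation

/-! ## The inverse function theorem on manifolds, and a connectedness lemma -/

section InverseFunction

variable {E : Type*} [NormedAddCommGroup E] [NormedSpace ℝ E] [FiniteDimensional ℝ E]
  {H : Type*} [TopologicalSpace H] {I : ModelWithCorners ℝ E H} [I.Boundaryless]
  {N : Type*} [TopologicalSpace N] [ChartedSpace H N] [IsManifold I ∞ N]
  {E' : Type*} [NormedAddCommGroup E'] [NormedSpace ℝ E'] [FiniteDimensional ℝ E']
  {H' : Type*} [TopologicalSpace H'] {I' : ModelWithCorners ℝ E' H'} [I'.Boundaryless]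
  {N' : Type*} [TopologicalSpace N'] [ChartedSpace H' N'] [IsManifold I' ∞ N']

/-- The inverse function theorem in charts; in equal dimensions an injective differential is
invertible. `K` is defined everywhere but is an inverse only near the two points. -/
theorem exists_smooth_localInverse {Φ : N → N'} {x : N} (hΦ : ContMDiffAt I I' ∞ Φ x)
    (hdim : Module.finrank ℝ E = Module.finrank ℝ E')
    (hinj : ∀ v : TangentSpace I x, mfderiv I I' Φ x v = 0 → v = 0) :
    ∃ K : N' → N, K (Φ x) = x ∧ ContMDiffAt I' I ∞ K (Φ x) ∧
      (∀ᶠ y in 𝓝 (Φ x), Φ (K y) = y) ∧ ∀ᶠ z in 𝓝 x, K (Φ z) = z := by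
  set φ := extChartAt I x
  set φ' := extChartAt I' (Φ x)
  set f : E → E' := fun y => φ' (Φ (φ.symm y)) with hf
  have hfc : ContDiffAt ℝ ∞ f (φ x) := by
    have h := (contMDiffAt_iff.1 hΦ).2
    rw [I.range_eq_univ, contDiffWithinAt_univ] at h
    exact h
  have hd : fderiv ℝ f (φ x) = mfderiv I I' Φ x := by
    rw [(hΦ.mdifferentiableAt (by simp)).mfderiv, I.range_eq_univ, fderivWithin_univ]
    rfl
  have hi : Injective (fderiv ℝ f (φ x) : E →ₗ[ℝ] E') :=
    (injective_iff_map_eq_zero _).2 fun v hv => hinj v (by rw [← hd]; exact hv)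
  let e : E ≃L[ℝ] E' := (LinearEquiv.ofInjectiveOfFinrankEq _ hi hdim).toContinuousLinearEquiv
  have he : HasFDerivAt f (e : E →L[ℝ] E') (φ x) :=
    (hfc.differentiableAt (by simp)).hasFDerivAt.congr_fderiv (by ext v; rfl)
  have hxt : φ x ∈ φ.target := mem_extChartAt_target x
  have hxx : φ.symm (φ x) = x := extChartAt_to_inv x
  have hfx : f (φ x) = φ' (Φ x) := by simp only [hf, hxx]
  set g := hfc.localInverse he (by simp) with hg
  have hg0 : g (φ' (Φ x)) = φ x := by
    rw [← hfx]; exact hfc.localInverse_apply_image he (by simp)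
  have hgc : ContDiffAt ℝ ∞ g (φ' (Φ x)) := by
    rw [← hfx]; exact hfc.to_localInverse he (by simp)
  have hstr := hfc.hasStrictFDerivAt' he (by simp)
  have hr : ∀ᶠ y in 𝓝 (φ' (Φ x)), f (g y) = y := by
    rw [← hfx]; exact hstr.eventually_right_inverse
  have hl : ∀ᶠ y in 𝓝 (φ x), g (f y) = y := hstr.eventually_left_inverse
  refine ⟨fun y => φ.symm (g (φ' y)), ?_, ?_, ?_, ?_⟩
  · simp only [hg0, hxx]
  · have h1 : ContMDiffAt 𝓘(ℝ, E) I ∞ φ.symm (g (φ' (Φ x))) := by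
      rw [hg0]
      exact (contMDiffOn_extChartAt_symm x).contMDiffAt
        (extChartAt_target_mem_nhds x)
    exact h1.comp (Φ x) (hgc.contMDiffAt.comp (Φ x) contMDiffAt_extChartAt)
  · have hc : ContinuousAt (fun y => φ.symm (g (φ' y))) (Φ x) := by
      have h1 : ContinuousAt φ.symm (g (φ' (Φ x))) := by
        rw [hg0]; exact continuousAt_extChartAt_symm x
      exact h1.comp (f := fun y => g (φ' y))
        (hgc.continuousAt.comp (f := φ') (continuousAt_extChartAt (Φ x)))
    -- The chart `φ'` is injective only on its source, so `Φ (K y)` has to lie there before `φ'` can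
    -- be cancelled.
    have hgt : ∀ᶠ y in 𝓝 (Φ x), Φ (φ.symm (g (φ' y))) ∈ φ'.source := by
      have h2 : ContinuousAt (fun y => Φ (φ.symm (g (φ' y)))) (Φ x) := by
        refine ContinuousAt.comp (g := Φ) ?_ hc
        simp only [hg0, hxx]
        exact hΦ.continuousAt
      refine h2.eventually ?_
      simp only [hg0, hxx]
      exact extChartAt_source_mem_nhds (Φ x)
    filter_upwards [(continuousAt_extChartAt (Φ x)).eventually hr, hgt,
      extChartAt_source_mem_nhds (I := I') (Φ x)] with y h1 h2 h3
    exact φ'.injOn h2 h3 h1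
  · filter_upwards [(continuousAt_extChartAt x).eventually hl,
      extChartAt_source_mem_nhds (I := I) x] with y h1 h2
    simp only [hf] at h1
    rw [φ.left_inv h2] at h1
    rw [h1, φ.left_inv h2]

end InverseFunction

section Puncture

/-- Removing a point from an open preconnected set does not disconnect it if this is so locally. -/
theorem isPreconnected_diff_singleton {X : Type*} [TopologicalSpace X] [T1Space X] {O : Set X}
    (hO : IsOpen O) (hc : IsPreconnected O) {x : X}
    (hx : ∀ V ∈ 𝓝 x, ∃ U ⊆ V, U ∈ 𝓝 x ∧ IsPreconnected (U \ {x}) ∧ (U \ {x}).Nonempty) :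
    IsPreconnected (O \ {x}) := by
  by_cases hxO : x ∈ O
  swap
  · rwa [diff_singleton_eq_self hxO]
  -- If a punctured neighbourhood of `x` lies in `A`, then `A` with `x` adjoined is still open, and
  -- a separation of the punctured set becomes one of `O`.
  have key : ∀ A B : Set X, IsOpen A → IsOpen B → O \ {x} ⊆ A ∪ B → (O \ {x} ∩ A).Nonempty →
      (O \ {x} ∩ B).Nonempty → O \ {x} ∩ (A ∩ B) = ∅ →
      ∀ U ⊆ O, U ∈ 𝓝 x → U \ {x} ⊆ A → False := by
    intro A B hA hB hAB hAn hBn hd U hU hUx hUA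
    have hO' : IsOpen (O \ {x}) := hO.sdiff isClosed_singleton
    have hAo : IsOpen (insert x (O \ {x} ∩ A)) := by
      have : insert x (O \ {x} ∩ A) = interior U ∪ (O \ {x} ∩ A) := by
        ext z
        constructor
        · rintro (rfl | hz)
          · exact Or.inl (mem_interior_iff_mem_nhds.2 hUx)
          · exact Or.inr hz
        · rintro (hz | hz)
          · by_cases hzx : z = x
            · exact Or.inl hzx
            · have := interior_subset hz
              exact Or.inr ⟨⟨hU this, hzx⟩, hUA ⟨this, hzx⟩⟩
          · exact Or.inr hz
      rw [this]
      exact isOpen_interior.union (hO'.inter hA)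
    obtain ⟨z, hzO, hz1, hz2⟩ := hc _ (O \ {x} ∩ B) hAo (hO'.inter hB) (by
        intro z hz
        by_cases hzx : z = x
        · exact Or.inl (Or.inl hzx)
        · rcases hAB ⟨hz, hzx⟩ with h | h
          · exact Or.inl (Or.inr ⟨⟨hz, hzx⟩, h⟩)
          · exact Or.inr ⟨⟨hz, hzx⟩, h⟩)
      ⟨x, hxO, Or.inl rfl⟩ (by
        obtain ⟨z, hz, hzB⟩ := hBn
        exact ⟨z, hz.1, hz, hzB⟩)
    rcases hz1 with rfl | hz1
    · exact hz2.1.2 rfl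
    · exact (hd ▸ ⟨hz2.1, hz1.2, hz2.2⟩ : z ∈ (∅ : Set X))
  intro A B hA hB hAB hAn hBn
  by_contra hne
  rw [not_nonempty_iff_eq_empty] at hne
  obtain ⟨U, hUO, hUx, hUc, z, hz⟩ := hx O (hO.mem_nhds hxO)
  have hUd : U \ {x} ⊆ O \ {x} := diff_subset_diff_left hUO
  have hor : U \ {x} ⊆ A ∨ U \ {x} ⊆ B := by
    refine isPreconnected_iff_subset_of_disjoint.1 hUc A B hA hB (hUd.trans hAB) ?_
    exact subset_eq_empty (inter_subset_inter_left _ hUd) hne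
  rcases hor with h | h
  · exact key A B hA hB hAB hAn hBn hne U hUO hUx h
  · exact key B A hB hA (by rwa [union_comm]) hBn hAn (by rwa [inter_comm B A]) U hUO hUx h

/-- Points of a surface have arbitrarily small neighbourhoods that remain connected when the
point is removed. -/
theorem exists_nhds_isPreconnected_diff {M : Type*} [TopologicalSpace M]
    [ChartedSpace (EuclideanSpace ℝ (Fin 2)) M] (x : M) (V : Set M) (hV : V ∈ 𝓝 x) :
    ∃ U ⊆ V, U ∈ 𝓝 x ∧ IsPreconnected (U \ {x}) ∧ (U \ {x}).Nonempty := by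
  let φ := chartAt (EuclideanSpace ℝ (Fin 2)) x
  have h1 : φ.target ∩ φ.symm ⁻¹' V ∈ 𝓝 (φ x) :=
    inter_mem (φ.open_target.mem_nhds (mem_chart_target _ x))
      ((φ.continuousAt_symm (mem_chart_target _ x)).preimage_mem_nhds
        (by rw [φ.left_inv (mem_chart_source _ x)]; exact hV))
  obtain ⟨r, hr, hball⟩ := Metric.mem_nhds_iff.1 h1
  have hinj : InjOn φ.symm (Metric.ball (φ x) r) := fun a ha b hb hab =>
    φ.symm.injOn (hball ha).1 (hball hb).1 hab
  have him : φ.symm '' (Metric.ball (φ x) r) \ {x} = φ.symm '' (Metric.ball (φ x) r \ {φ x}) := by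
    rw [hinj.image_diff_subset (singleton_subset_iff.2 (Metric.mem_ball_self hr)), image_singleton,
      φ.left_inv (mem_chart_source _ x)]
  have hconn : IsPreconnected (Metric.ball (φ x) r \ {φ x}) := by
    have hr2 : 1 < Module.rank ℝ (EuclideanSpace ℝ (Fin 2)) := by
      rw [← Module.finrank_eq_rank]; simp
    let b := OpenPartialHomeomorph.univBall (φ x) r
    have hb0 : b 0 = φ x := OpenPartialHomeomorph.univBall_apply_zero _ _
    have hbs : b.source = univ := OpenPartialHomeomorph.univBall_source _ _
    have hbt : b.target = Metric.ball (φ x) r := OpenPartialHomeomorph.univBall_target _ hr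
    -- The punctured ball is the image of the punctured plane, which is connected because the
    -- dimension exceeds one.
    have : Metric.ball (φ x) r \ {φ x} = b '' {0}ᶜ := by
      rw [compl_eq_univ_diff, ← hbs, (b.injOn).image_diff_subset (by simp [hbs]), image_singleton,
        hb0, b.image_source_eq_target, hbt]
    rw [this]
    exact (isConnected_compl_singleton_of_one_lt_rank hr2 0).isPreconnected.image _
      (b.continuousOn.mono (by simp [hbs]))
  refine ⟨φ.symm '' (Metric.ball (φ x) r), ?_, ?_, ?_, ?_⟩
  · rintro _ ⟨y, hy, rfl⟩; exact (hball hy).2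
  · have := φ.symm.image_mem_nhds (mem_chart_target _ x) (Metric.ball_mem_nhds (φ x) hr)
    rwa [φ.left_inv (mem_chart_source _ x)] at this
  · rw [him]
    exact hconn.image _ (φ.continuousOn_symm.mono fun y hy => (hball hy.1).1)
  · rw [him]
    refine Nonempty.image _ ?_
    have : (𝓝[≠] (φ x)).NeBot := Module.punctured_nhds_neBot ℝ _ _
    obtain ⟨y, hy, hy'⟩ := (this.nonempty_of_mem (inter_mem
      (mem_nhdsWithin_of_mem_nhds (Metric.ball_mem_nhds (φ x) hr)) self_mem_nhdsWithin))
    exact ⟨y, hy, hy'⟩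

end Puncture

/-! ## The canonical coframing and the basepoint projection -/

section

variable {M : Type*} [TopologicalSpace M] [T2Space M]
  [ChartedSpace (EuclideanSpace ℝ (Fin 2)) M] [IsManifold (𝓡 2) ∞ M]

/-- `Σ` is Hausdorff as a subspace of `TM`, which the uniqueness of integral curves requires. -/
instance t2Space_tangentBundle : T2Space (TangentBundle (𝓡 2) M) := by
  refine ⟨fun p q hpq => ?_⟩
  have hproj : Continuous (Bundle.TotalSpace.proj : TangentBundle (𝓡 2) M → M) :=
    FiberBundle.continuous_proj _ _
  by_cases h : p.proj = q.proj
  · let e := trivializationAt (EuclideanSpace ℝ (Fin 2)) (TangentSpace (𝓡 2)) p.proj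
    have hp : p ∈ e.source := e.mem_source.2 (FiberBundle.mem_baseSet_trivializationAt' p.proj)
    have hq : q ∈ e.source := e.mem_source.2 (h ▸ FiberBundle.mem_baseSet_trivializationAt' p.proj)
    have hne : e p ≠ e q := fun he => hpq (e.toOpenPartialHomeomorph.injOn hp hq he)
    obtain ⟨A, B, hA, hB, hpA, hqB, hAB⟩ := t2_separation hne
    refine ⟨e.source ∩ e ⁻¹' A, e.source ∩ e ⁻¹' B,
      e.toOpenPartialHomeomorph.isOpen_inter_preimage hA,
      e.toOpenPartialHomeomorph.isOpen_inter_preimage hB, ⟨hp, hpA⟩, ⟨hq, hqB⟩, ?_⟩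
    exact disjoint_left.2 fun z hz hz' => disjoint_left.1 hAB hz.2 hz'.2
  · obtain ⟨A, B, hA, hB, hpA, hqB, hAB⟩ := t2_separation h
    exact ⟨_, _, hA.preimage hproj, hB.preimage hproj, hpA, hqB, hAB.preimage _⟩

end

/-- In a plane with an alternating form, two vectors with nonzero area span. -/
theorem exists_eq_smul_add_smul {V : Type*} [AddCommGroup V] [Module ℝ V]
    (hV : Module.finrank ℝ V = 2) {τ : V [⋀^Fin 2]→ₗ[ℝ] ℝ} {a b : V} (h : τ ![a, b] ≠ 0) (v : V) :
    ∃ x y : ℝ, v = x • a + y • b := by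
  have : FiniteDimensional ℝ V := Module.finite_of_finrank_pos (by omega)
  have hli : LinearIndependent ℝ ![a, b] := by
    by_contra hc
    exact h (τ.map_linearDependent _ hc)
  have : v ∈ Submodule.span ℝ (range ![a, b]) := by
    rw [hli.span_eq_top_of_card_eq_finrank' (by simp [hV])]; trivial
  simp only [Matrix.range_cons, Matrix.range_empty, union_empty, singleton_union] at this
  obtain ⟨x, y, hxy⟩ := Submodule.mem_span_pair.1 this
  exact ⟨x, y, hxy.symm⟩

section Basepoint

variable {M : Type*} [TopologicalSpace M]
  [ChartedSpace (EuclideanSpace ℝ (Fin 2)) M] [IsManifold (𝓡 2) ∞ M]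
  {Sig : Set (TangentBundle (𝓡 2) M)}

/-- The point `u` of `Σ` as a tangent vector. -/
def vec (u : Sig) : TangentSpace (𝓡 2) (basepoint u) := (u : TangentBundle (𝓡 2) M).snd

theorem continuous_basepoint : Continuous (basepoint : Sig → M) :=
  (FiberBundle.continuous_proj (EuclideanSpace ℝ (Fin 2)) (TangentSpace (𝓡 2))).comp
    continuous_subtype_val

/-- The point of `Σ` given by a vector in the fibre. -/
def ofVec {m : M} (v : TangentSpace (𝓡 2) m) (hv : v ∈ fiber Sig m) : Sig := ⟨⟨m, v⟩, hv⟩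

theorem eq_of_vec_eq {u w : Sig} (h : basepoint u = basepoint w)
    (hv : (vec u : EuclideanSpace ℝ (Fin 2)) = vec w) : u = w := by
  obtain ⟨⟨m, v⟩, hu⟩ := u
  obtain ⟨⟨m', v'⟩, hw⟩ := w
  obtain rfl : m = m' := h
  obtain rfl : v = v' := hv
  rfl

theorem vec_mem_fiber (u : Sig) : vec u ∈ fiber Sig (basepoint u) := u.2

variable [ChartedSpace (EuclideanSpace ℝ (Fin 3)) Sig]

theorem IsFinslerStructure.contMDiff_basepoint (h : IsFinslerStructure Sig) :
    ContMDiff (𝓡 3) (𝓡 2) ∞ (basepoint : Sig → M) := h.submersion.contMDiff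

/-- The vector transverse to `u` dual to `ω₂`. -/
def normal (η : Coframing Sig) (u : Sig) : TangentSpace (𝓡 2) (basepoint u) :=
  basepointD u (η.dual 1 u)

variable {o : ∀ x : M, Orientation ℝ (TangentSpace (𝓡 2) x) (Fin 2)} {η : Coframing Sig}

namespace IsCanonicalCoframing

variable (h : IsCanonicalCoframing o η)
include h

variable [IsManifold (𝓡 3) ∞ Sig]

/-- With the constant absorbed, `ω₁ ∧ ω₂` is the pullback of one area form. It takes the value `1`
on the images of `X₁` and `X₂`, which therefore span the tangent plane. -/
theorem exists_area (u : Sig) : ∃ τ : TangentSpace (𝓡 2) (basepoint u) [⋀^Fin 2]→ₗ[ℝ] ℝ,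
    τ ![basepointD u (η.dual 0 u), normal η u] ≠ 0 ∧ ∀ V W : TangentSpace (𝓡 3) u,
      wedge (η.form 0 u) (η.form 1 u) V W = τ ![basepointD u V, basepointD u W] := by
  let τ₀ := (o (basepoint u)).someVector
  obtain ⟨c, hc, hτ⟩ := h.area u τ₀
    ⟨Module.Ray.someVector_ne_zero _, Module.Ray.someVector_ray _⟩
  have key : ∀ V W : TangentSpace (𝓡 3) u,
      wedge (η.form 0 u) (η.form 1 u) V W = (c • τ₀) ![basepointD u V, basepointD u W] := hτ
  refine ⟨c • τ₀, ?_, key⟩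
  rw [normal, ← key]
  simp [wedge, η.form_dual]

/-- Subtracting a combination of `X₁` and `X₂` from `X₃` gives a vector in the kernel of `π'`.
Pairing it with `X₁` and `X₂` under `ω₁ ∧ ω₂` shows that both coefficients vanish. -/
theorem basepointD_dual_two (u : Sig) : basepointD u (η.dual 2 u) = 0 := by
  obtain ⟨τ, h0, hτ⟩ := h.exists_area u
  obtain ⟨x, y, hxy⟩ := exists_eq_smul_add_smul (by exact finrank_euclideanSpace_fin) h0
    (basepointD u (η.dual 2 u))
  have hker : basepointD u (η.dual 2 u - x • η.dual 0 u - y • η.dual 1 u) = 0 := by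
    rw [map_sub, map_sub, map_smul, map_smul, hxy, normal]
    abel
  have hz : ∀ W, τ ![(0 : TangentSpace (𝓡 2) (basepoint u)), W] = 0 := fun W =>
    τ.map_coord_zero 0 rfl
  have e0 := hτ (η.dual 2 u - x • η.dual 0 u - y • η.dual 1 u) (η.dual 0 u)
  have e1 := hτ (η.dual 2 u - x • η.dual 0 u - y • η.dual 1 u) (η.dual 1 u)
  rw [hker, hz] at e0 e1
  simp [wedge, η.form_dual] at e0 e1
  rw [hxy, e0, e1]
  simp

/-- Some `x X₁ + y X₂` projects to `u`; the lifting condition forces `x = 1` and `y = 0`. -/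
theorem basepointD_dual_zero (u : Sig) : basepointD u (η.dual 0 u) = vec u := by
  obtain ⟨τ, h0, hτ⟩ := h.exists_area u
  obtain ⟨x, y, hxy⟩ := exists_eq_smul_add_smul (by exact finrank_euclideanSpace_fin) h0
    (vec u)
  have hV : basepointD u (x • η.dual 0 u + y • η.dual 1 u) = vec u := by
    rw [map_add, map_smul, map_smul, hxy, normal]
  have := h.lift u _ hV
  simp [η.form_dual] at this
  rw [hxy, this.1, this.2]
  simp

theorem basepointD_apply (u : Sig) (V : TangentSpace (𝓡 3) u) :
    basepointD u V = η.form 0 u V • vec u + η.form 1 u V • normal η u := by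
  conv_lhs => rw [η.sum_dual V]
  rw [map_add, map_add, map_smul, map_smul, map_smul, h.basepointD_dual_two,
    h.basepointD_dual_zero, smul_zero, add_zero]
  rfl

theorem eq_zero_of_smul_add_smul {u : Sig} {x y : ℝ}
    (hxy : x • vec u + y • normal η u = 0) : x = 0 ∧ y = 0 := by
  obtain ⟨τ, h0, hτ⟩ := h.exists_area u
  have hV : basepointD u (x • η.dual 0 u + y • η.dual 1 u) = 0 := by
    rw [map_add, map_smul, map_smul, h.basepointD_dual_zero]; exact hxy
  have hz : ∀ W, τ ![(0 : TangentSpace (𝓡 2) (basepoint u)), W] = 0 := fun W =>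
    τ.map_coord_zero 0 rfl
  have e0 := hτ (x • η.dual 0 u + y • η.dual 1 u) (η.dual 0 u)
  have e1 := hτ (x • η.dual 0 u + y • η.dual 1 u) (η.dual 1 u)
  rw [hV, hz] at e0 e1
  simp [wedge, η.form_dual] at e0 e1
  exact ⟨e1, e0⟩

theorem form_eq_of_basepointD_eq {u : Sig} {V W : TangentSpace (𝓡 3) u}
    (hVW : basepointD u V = basepointD u W) :
    η.form 0 u V = η.form 0 u W ∧ η.form 1 u V = η.form 1 u W := by
  have h1 : basepointD u (V - W) = 0 := by rw [map_sub, hVW, sub_self]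
  rw [h.basepointD_apply] at h1
  have := h.eq_zero_of_smul_add_smul h1
  simp only [map_sub] at this
  exact ⟨sub_eq_zero.1 this.1, sub_eq_zero.1 this.2⟩

theorem exists_basepointD_eq (u : Sig) (v : TangentSpace (𝓡 2) (basepoint u)) :
    ∃ V : TangentSpace (𝓡 3) u, basepointD u V = v := by
  obtain ⟨τ, h0, hτ⟩ := h.exists_area u
  obtain ⟨x, y, hxy⟩ := exists_eq_smul_add_smul (by exact finrank_euclideanSpace_fin) h0 v
  exact ⟨x • η.dual 0 u + y • η.dual 1 u, by rw [map_add, map_smul, map_smul, hxy, normal]⟩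

/-- `ω₁` vanishes on the kernel of `π'`, so it descends through any linear right inverse of `π'`. -/
theorem exists_covec (u : Sig) : ∃ l : TangentSpace (𝓡 2) (basepoint u) →L[ℝ] ℝ,
    ∀ V : TangentSpace (𝓡 3) u, l (basepointD u V) = η.form 0 u V := by
  let p : EuclideanSpace ℝ (Fin 3) →ₗ[ℝ] EuclideanSpace ℝ (Fin 2) :=
    (basepointD u).toLinearMap
  obtain ⟨g, hg⟩ := p.exists_rightInverse_of_surjective
    (LinearMap.range_eq_top.2 (h.exists_basepointD_eq u))
  let f : EuclideanSpace ℝ (Fin 3) →ₗ[ℝ] ℝ := (η.form 0 u).toLinearMap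
  refine ⟨(f ∘ₗ g).toContinuousLinearMap, fun V => ?_⟩
  refine (h.form_eq_of_basepointD_eq (u := u) (V := g (basepointD u V)) (W := V) ?_).1
  exact LinearMap.congr_fun hg (basepointD u V)

end IsCanonicalCoframing

open Classical in
/-- The covector `λ_u` on `T_{π(u)} M` with `ω₁ = λ_u ∘ π'`. -/
def covec (η : Coframing Sig) (u : Sig) : TangentSpace (𝓡 2) (basepoint u) →L[ℝ] ℝ :=
  if h : ∃ l : TangentSpace (𝓡 2) (basepoint u) →L[ℝ] ℝ,
    ∀ V : TangentSpace (𝓡 3) u, l (basepointD u V) = η.form 0 u V then h.choose else 0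

namespace IsCanonicalCoframing

variable (h : IsCanonicalCoframing o η)
include h

variable [IsManifold (𝓡 3) ∞ Sig]

theorem covec_basepointD (u : Sig) (V : TangentSpace (𝓡 3) u) :
    covec η u (basepointD u V) = η.form 0 u V := by
  rw [covec, dif_pos (h.exists_covec u)]
  exact (h.exists_covec u).choose_spec V

theorem covec_vec (u : Sig) : covec η u (vec u) = 1 := by
  rw [← h.basepointD_dual_zero, h.covec_basepointD]
  simp [η.form_dual]

theorem covec_normal (u : Sig) : covec η u (normal η u) = 0 := by
  rw [normal, h.covec_basepointD]
  simp [η.form_dual]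

/-- A covector killing the normal is a multiple of `λ_u`. -/
theorem apply_eq_mul_covec {u : Sig} {l : TangentSpace (𝓡 2) (basepoint u) →L[ℝ] ℝ}
    (hl : l (normal η u) = 0) (v : TangentSpace (𝓡 2) (basepoint u)) :
    l v = l (vec u) * covec η u v := by
  obtain ⟨V, rfl⟩ := h.exists_basepointD_eq u v
  rw [h.covec_basepointD, h.basepointD_apply]
  simp [hl, mul_comm]

end IsCanonicalCoframing

end Basepoint

/-! ## The geodesic flow of a Finsler surface of curvature one -/

theorem IsUnitFlow.mfderiv_apply {S : Type*} [TopologicalSpace S]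
    [ChartedSpace (EuclideanSpace ℝ (Fin 3)) S] [T2Space S] [IsManifold (𝓡 3) ∞ S]
    {η : Coframing S} {Ψ : ℝ → S → S} (h : IsUnitFlow η Ψ) (p : ℝ × S) (τ : ℝ)
    (V : TangentSpace (𝓡 3) p.2) :
    mfderiv (𝓘(ℝ, ℝ).prod (𝓡 3)) (𝓡 3) (fun p : ℝ × S => Ψ p.1 p.2) p
      ((τ, V) : TangentSpace (𝓘(ℝ, ℝ).prod (𝓡 3)) p) =
      τ • η.dual 0 (Ψ p.1 p.2) + mfderiv (𝓡 3) (𝓡 3) (Ψ p.1) p.2 V := by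
  refine (mfderiv_prod_eq_add_apply ((h.contMDiff p).mdifferentiableAt (by simp))).trans ?_
  congr 1
  exact congrArg (fun L => L τ) (h.curve p.2 p.1).mfderiv

section Surface

variable {M : Type*} [TopologicalSpace M] [T2Space M]
  [ChartedSpace (EuclideanSpace ℝ (Fin 2)) M] [IsManifold (𝓡 2) ∞ M]
  {Sig : Set (TangentBundle (𝓡 2) M)}
  [ChartedSpace (EuclideanSpace ℝ (Fin 3)) Sig] [IsManifold (𝓡 3) ∞ Sig]
  {o : ∀ x : M, Orientation ℝ (TangentSpace (𝓡 2) x) (Fin 2)} {η : Coframing Sig}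
  {Ψ : ℝ → Sig → Sig}

/-- A Finsler surface with its canonical coframing and complete geodesic flow `Ψ`, of
curvature one. -/
structure IsUnitSurface (o : ∀ x : M, Orientation ℝ (TangentSpace (𝓡 2) x) (Fin 2))
    (η : Coframing Sig) (Ψ : ℝ → Sig → Sig) : Prop where
  finsler : IsFinslerStructure Sig
  canon : IsCanonicalCoframing o η
  flow : IsUnitFlow η Ψ

namespace IsUnitSurface

variable (h : IsUnitSurface o η Ψ)
include h

theorem contMDiff_geo :
    ContMDiff (𝓘(ℝ, ℝ).prod (𝓡 3)) (𝓡 2) ∞ (fun p : ℝ × Sig => basepoint (Ψ p.1 p.2)) :=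
  h.finsler.contMDiff_basepoint.comp h.flow.contMDiff

theorem continuous_geo : Continuous (fun p : ℝ × Sig => basepoint (Ψ p.1 p.2)) :=
  h.contMDiff_geo.continuous

theorem mdifferentiableAt_basepoint (u : Sig) :
    MDifferentiableAt (𝓡 3) (𝓡 2) (basepoint : Sig → M) u :=
  (h.finsler.contMDiff_basepoint u).mdifferentiableAt (by simp)

/-- This is the Jacobi field formula of curvature one: the tangential part of a variation is
constant, and the normal part is a combination of `cos t` and `sin t`. -/
theorem basepointD_flow (t : ℝ) (u : Sig) (τ : ℝ) (V : TangentSpace (𝓡 3) u) :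
    basepointD (Ψ t u) (τ • η.dual 0 (Ψ t u) + mfderiv (𝓡 3) (𝓡 3) (Ψ t) u V) =
      (τ + η.form 0 u V) • vec (Ψ t u) +
        (Real.cos t * η.form 1 u V + Real.sin t * η.form 2 u V) • normal η (Ψ t u) := by
  obtain ⟨h0, h1, h2⟩ := h.flow.form_mfderiv t u V
  rw [h.canon.basepointD_apply]
  simp only [map_add, map_smul, η.form_dual, h0, h1]
  simp

theorem mfderiv_geo (p : ℝ × Sig) (τ : ℝ) (V : TangentSpace (𝓡 3) p.2) :
    mfderiv (𝓘(ℝ, ℝ).prod (𝓡 3)) (𝓡 2) (fun p : ℝ × Sig => basepoint (Ψ p.1 p.2)) p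
      ((τ, V) : TangentSpace (𝓘(ℝ, ℝ).prod (𝓡 3)) p) =
      (τ + η.form 0 p.2 V) • vec (Ψ p.1 p.2) +
        (Real.cos p.1 * η.form 1 p.2 V + Real.sin p.1 * η.form 2 p.2 V) •
          normal η (Ψ p.1 p.2) := by
  have h1 := (HasMFDerivAt.comp (g := (basepoint : Sig → M)) p
    (h.mdifferentiableAt_basepoint (Ψ p.1 p.2)).hasMFDerivAt
    ((h.flow.contMDiff p).mdifferentiableAt (by simp)).hasMFDerivAt).mfderiv
  refine (congrArg (fun L => L ((τ, V) : TangentSpace (𝓘(ℝ, ℝ).prod (𝓡 3)) p)) h1).trans ?_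
  exact (congrArg (basepointD (Ψ p.1 p.2)) (h.flow.mfderiv_apply p τ V)).trans
    (h.basepointD_flow p.1 p.2 τ V)

/-- Derivative of a family of points on geodesics. -/
theorem pushD_geo {P : Type*} [NormedAddCommGroup P] [NormedSpace ℝ P] {τ : P → ℝ} {ν : P → Sig}
    {z : P} {τ' : P →L[ℝ] ℝ} (hτ : HasFDerivAt τ τ' z)
    (hν : MDifferentiableAt 𝓘(ℝ, P) (𝓡 3) ν z) (w : P) :
    pushD (E := E2) (fun z => basepoint (Ψ (τ z) (ν z))) z w =
      (τ' w + η.form 0 (ν z) (pushD (E := E3) ν z w)) • vec (Ψ (τ z) (ν z)) +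
        (Real.cos (τ z) * η.form 1 (ν z) (pushD (E := E3) ν z w) +
          Real.sin (τ z) * η.form 2 (ν z) (pushD (E := E3) ν z w)) •
          normal η (Ψ (τ z) (ν z)) := by
  have h1 : HasMFDerivAt 𝓘(ℝ, P) (𝓘(ℝ, ℝ).prod (𝓡 3)) (fun z => (τ z, ν z)) z
      (ContinuousLinearMap.prod τ' (pushD (E := E3) ν z)) :=
    hτ.hasMFDerivAt.prodMk hν.hasMFDerivAt
  have h2 := (HasMFDerivAt.comp (g := fun p : ℝ × Sig => basepoint (Ψ p.1 p.2)) z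
    ((h.contMDiff_geo _).mdifferentiableAt (by simp)).hasMFDerivAt h1).mfderiv
  refine (congrArg (fun L => L w) h2).trans ?_
  exact h.mfderiv_geo (τ z, ν z) (τ' w) (pushD (E := E3) ν z w)

/-- Two points are joined by a geodesic depending smoothly on them, near a nonconjugate pair. -/
theorem exists_geodesic_inverse (u : Sig) {t : ℝ} (ht : Real.sin t ≠ 0) :
    ∃ K : M × M → ℝ × Sig, K (basepoint u, basepoint (Ψ t u)) = (t, u) ∧
      ContMDiffAt ((𝓡 2).prod (𝓡 2)) (𝓘(ℝ, ℝ).prod (𝓡 3)) ∞ K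
        (basepoint u, basepoint (Ψ t u)) ∧
      (∀ᶠ q in 𝓝 (basepoint u, basepoint (Ψ t u)),
        basepoint (K q).2 = q.1 ∧ basepoint (Ψ (K q).1 (K q).2) = q.2) ∧
      ∀ᶠ p in 𝓝 (t, u), K (basepoint p.2, basepoint (Ψ p.1 p.2)) = p := by
  let G : ℝ × Sig → M × M := fun p => (basepoint p.2, basepoint (Ψ p.1 p.2))
  have hG : ContMDiff (𝓘(ℝ, ℝ).prod (𝓡 3)) ((𝓡 2).prod (𝓡 2)) ∞ G :=
    (h.finsler.contMDiff_basepoint.comp contMDiff_snd).prodMk h.contMDiff_geo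
  obtain ⟨K, hK0, hK1, hK2, hK3⟩ := exists_smooth_localInverse (hG (t, u))
    (by simp) (by
      rintro ⟨τ, V⟩ hv
      have hd1 : HasMFDerivAt (𝓘(ℝ, ℝ).prod (𝓡 3)) (𝓡 2) (fun p : ℝ × Sig => basepoint p.2) (t, u)
          ((basepointD u).comp (ContinuousLinearMap.snd ℝ ℝ E3)) :=
        HasMFDerivAt.comp (g := (basepoint : Sig → M)) (t, u)
          (h.mdifferentiableAt_basepoint u).hasMFDerivAt
          (hasMFDerivAt_snd (I := 𝓘(ℝ, ℝ)) (I' := 𝓡 3) (t, u))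
      have hd2 := ((h.contMDiff_geo (t, u)).mdifferentiableAt (by simp)).hasMFDerivAt
      have hd := (hd1.prodMk hd2).mfderiv
      have hv' := (congrArg (fun L => L ((τ, V) : TangentSpace (𝓘(ℝ, ℝ).prod (𝓡 3)) (t, u)))
        hd).symm.trans hv
      have e1 : basepointD u V = 0 := congrArg Prod.fst hv'
      have e2 := (h.mfderiv_geo (t, u) τ V).symm.trans (congrArg Prod.snd hv')
      have e1' := (h.canon.basepointD_apply u V).symm.trans e1
      -- A fixed initial point kills `ω₁` and `ω₂` of `V`. A fixed endpoint then gives `τ = 0` and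
      -- `sin t · ω₃(V) = 0`, so nonconjugacy means `sin t ≠ 0`.
      obtain ⟨a1, a2⟩ := h.canon.eq_zero_of_smul_add_smul e1'
      obtain ⟨b1, b2⟩ : τ + η.form 0 u V = 0 ∧
          Real.cos t * η.form 1 u V + Real.sin t * η.form 2 u V = 0 :=
        h.canon.eq_zero_of_smul_add_smul e2
      have b1' : τ = 0 := by linear_combination b1 - a1
      have b2' : η.form 2 u V = 0 :=
        (mul_eq_zero.1 (by linear_combination b2 - Real.cos t * a2)).resolve_left ht
      have hV : V = (0 : TangentSpace (𝓡 3) u) := η.ext_form (fun i => by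
        rw [map_zero]
        fin_cases i
        · exact a1
        · exact a2
        · exact b2')
      exact Prod.ext b1' hV)
  exact ⟨K, hK0, hK1, hK2.mono fun q hq => ⟨congrArg Prod.fst hq, congrArg Prod.snd hq⟩, hK3⟩

/-- Near each point, `Σ` is smoothly parametrized by the basepoint and a fibre coordinate. -/
theorem exists_fiber_coordinate (u : Sig) :
    ∃ (c : Sig → ℝ) (L : M × ℝ → Sig), L (basepoint u, c u) = u ∧
      ContMDiffAt (𝓡 3) 𝓘(ℝ, ℝ) ∞ c u ∧
      ContMDiffAt ((𝓡 2).prod 𝓘(ℝ, ℝ)) (𝓡 3) ∞ L (basepoint u, c u) ∧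
      (∀ᶠ q in 𝓝 (basepoint u, c u), basepoint (L q) = q.1 ∧ c (L q) = q.2) ∧
      ∀ᶠ w in 𝓝 u, L (basepoint w, c w) = w := by
  -- The preferred chart at `u` has identity differential at `u`, so `c` has differential `ω₃`
  -- there, which completes `π'` to an injective map.
  let l : E3 →L[ℝ] ℝ := η.form 2 u
  let c : Sig → ℝ := fun w => l (extChartAt (𝓡 3) u w)
  have hc : ContMDiffAt (𝓡 3) 𝓘(ℝ, ℝ) ∞ c u :=
    (l.contDiff.contMDiff _).comp u contMDiffAt_extChartAt
  have hcd : ∀ V, mfderiv (𝓡 3) 𝓘(ℝ, ℝ) c u V = η.form 2 u V := by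
    intro V
    have := (HasMFDerivAt.comp u (l.hasFDerivAt.hasMFDerivAt)
      (((contMDiffAt_extChartAt (I := 𝓡 3) (n := ∞) (x := u)).mdifferentiableAt
        (by simp)).hasMFDerivAt)).mfderiv
    refine (congrArg (fun L => L V) this).trans ?_
    exact congrArg l (mfderiv_extChartAt_self_apply u V)
  let B : Sig → M × ℝ := fun w => (basepoint w, c w)
  have hB : ContMDiffAt (𝓡 3) ((𝓡 2).prod 𝓘(ℝ, ℝ)) ∞ B u :=
    (h.finsler.contMDiff_basepoint u).prodMk hc
  obtain ⟨L, hL0, hL1, hL2, hL3⟩ := exists_smooth_localInverse hB (by simp) (by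
    intro V hV
    have hd := ((h.mdifferentiableAt_basepoint u).hasMFDerivAt.prodMk
      (hc.mdifferentiableAt (by simp)).hasMFDerivAt).mfderiv
    have hv' := (congrArg (fun L => L V) hd).symm.trans hV
    have e1 : basepointD u V = 0 := congrArg Prod.fst hv'
    have e2 : η.form 2 u V = 0 := (hcd V).symm.trans (congrArg Prod.snd hv')
    rw [h.canon.basepointD_apply] at e1
    obtain ⟨a1, a2⟩ := h.canon.eq_zero_of_smul_add_smul e1
    exact η.ext_form (fun i => by
        fin_cases i
        · simpa using a1
        · simpa using a2
        · simpa using e2))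
  exact ⟨c, L, hL0, hc, hL1, hL2.mono fun q hq => ⟨congrArg Prod.fst hq, congrArg Prod.snd hq⟩,
    hL3⟩

end IsUnitSurface

end Surface

/-! ## The fibres of `Σ` -/

section Fiber

variable {M : Type*} [TopologicalSpace M]
  [ChartedSpace (EuclideanSpace ℝ (Fin 2)) M] [IsManifold (𝓡 2) ∞ M]
  {Sig : Set (TangentBundle (𝓡 2) M)}

/-- `γ` is a continuous parametrization of the fibre `Σ_m` by an angle. -/
structure IsFiberParam (m : M) (γ : ℝ → Sig) : Prop where
  continuous : Continuous γ
  base : ∀ θ, basepoint (γ θ) = m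
  surj : ∀ u : Sig, basepoint u = m → ∃ θ, γ θ = u
  eq_iff : ∀ θ θ', γ θ = γ θ' ↔ Real.cos θ = Real.cos θ' ∧ Real.sin θ = Real.sin θ'

theorem exists_angle {x y : ℝ} (h : x ^ 2 + y ^ 2 = 1) : ∃ θ, x = Real.cos θ ∧ y = Real.sin θ := by
  have hn : ‖(⟨x, y⟩ : ℂ)‖ = 1 := by
    rw [Complex.norm_def, Complex.normSq_mk, Real.sqrt_eq_one]; linarith
  have h1 := Complex.norm_mul_cos_arg (⟨x, y⟩ : ℂ)
  have h2 := Complex.norm_mul_sin_arg (⟨x, y⟩ : ℂ)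
  rw [hn, one_mul] at h1 h2
  exact ⟨_, h1.symm, h2.symm⟩

namespace IsFiberParam

variable {m : M} {γ : ℝ → Sig} (h : IsFiberParam m γ)
include h

theorem fiber_eq : {u : Sig | basepoint u = m} = γ '' Icc 0 (2 * Real.pi) := by
  ext u
  constructor
  · intro hu
    obtain ⟨θ, rfl⟩ := h.surj u hu
    have hp := Real.two_pi_pos
    obtain ⟨θ', hθ', k, hk⟩ : ∃ θ' ∈ Icc 0 (2 * Real.pi), ∃ k : ℤ, θ' = θ - k * (2 * Real.pi) :=
      ⟨toIcoMod hp 0 θ, by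
        have := toIcoMod_mem_Ico hp 0 θ
        exact ⟨this.1, by simpa using this.2.le⟩, toIcoDiv hp 0 θ, by
        rw [toIcoMod]; simp⟩
    refine ⟨θ', hθ', (h.eq_iff _ _).2 ?_⟩
    rw [hk]
    exact ⟨Real.cos_sub_int_mul_two_pi θ k, Real.sin_sub_int_mul_two_pi θ k⟩
  · rintro ⟨θ, -, rfl⟩
    exact h.base θ

theorem isCompact : IsCompact {u : Sig | basepoint u = m} :=
  h.fiber_eq ▸ isCompact_Icc.image h.continuous

theorem isPreconnected : IsPreconnected {u : Sig | basepoint u = m} :=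
  h.fiber_eq ▸ isPreconnected_Icc.image _ h.continuous.continuousOn

end IsFiberParam

/-- A homeomorphism of the plane carries the convex body to the unit disc, and hence its frontier
`Σ_m` to the unit circle. Continuity is enough for compactness and connectedness of the fibres and
for topological polar coordinates. -/
theorem IsFinslerStructure.exists_isFiberParam [ChartedSpace (EuclideanSpace ℝ (Fin 3)) Sig]
    (h : IsFinslerStructure Sig) (m : M) : ∃ γ : ℝ → Sig, IsFiberParam m γ := by
  let F : Set E2 := fiber Sig m
  have hb : Bornology.IsBounded (convexHull ℝ F) :=
    isBounded_convexHull.2 (IsCompact.isBounded (h.compact m))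
  obtain ⟨g, -, -, hg⟩ := exists_homeomorph_image_interior_closure_frontier_eq_unitBall
    (convex_convexHull ℝ F) ⟨0, h.zero_mem m⟩ hb
  have hF : frontier (convexHull ℝ F) = F := (h.boundary m).symm
  rw [hF] at hg
  let v : ℝ → E2 := fun θ => !₂[Real.cos θ, Real.sin θ]
  have hv : ∀ θ, v θ ∈ Metric.sphere (0 : E2) 1 := by
    intro θ
    rw [mem_sphere_zero_iff_norm, EuclideanSpace.norm_eq, Real.sqrt_eq_one]
    simp [v]
  have hgv : ∀ θ, g.symm (v θ) ∈ F := by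
    intro θ
    obtain ⟨w, hw, hwv⟩ := hg ▸ hv θ
    rw [← hwv, g.symm_apply_apply]
    exact hw
  have hvc : Continuous v := by
    refine (PiLp.continuous_toLp 2 (fun _ : Fin 2 => ℝ)).comp (continuous_pi fun i => ?_)
    fin_cases i
    · exact Real.continuous_cos
    · exact Real.continuous_sin
  refine ⟨fun θ => ofVec (g.symm (v θ)) (hgv θ), ?_, fun θ => rfl, ?_, ?_⟩
  · exact Continuous.subtype_mk ((FiberBundle.continuous_totalSpaceMk E2 (TangentSpace (𝓡 2)) m).comp
      (g.symm.continuous.comp hvc)) _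
  · intro u hu
    obtain ⟨⟨m', w⟩, hw⟩ := u
    obtain rfl : m' = m := hu
    have hgw : g w ∈ Metric.sphere (0 : E2) 1 := hg ▸ mem_image_of_mem g hw
    rw [mem_sphere_zero_iff_norm, EuclideanSpace.norm_eq, Real.sqrt_eq_one] at hgw
    simp only [Fin.sum_univ_two, Real.norm_eq_abs, sq_abs] at hgw
    obtain ⟨θ, h0, h1⟩ := exists_angle hgw
    refine ⟨θ, eq_of_vec_eq rfl ?_⟩
    change g.symm (v θ) = w
    refine g.symm_apply_eq.2 ?_
    ext i
    fin_cases i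
    · exact h0.symm
    · exact h1.symm
  · intro θ θ'
    constructor
    · intro he
      have h1 : g.symm (v θ) = g.symm (v θ') :=
        eq_of_heq ((Bundle.TotalSpace.mk.injEq _ _ _ _).mp (congrArg Subtype.val he)).2
      have h2 := g.symm.injective h1
      exact ⟨congrFun (congrArg WithLp.ofLp h2) 0, congrFun (congrArg WithLp.ofLp h2) 1⟩
    · rintro ⟨h0, h1⟩
      refine eq_of_vec_eq rfl ?_
      change g.symm (v θ) = g.symm (v θ')
      simp only [v, h0, h1]

end Fiber

/-! ### Curves inside a fibre and the common endpoint at time `π`. -/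

section Surface

variable {M : Type*} [TopologicalSpace M] [T2Space M]
  [ChartedSpace (EuclideanSpace ℝ (Fin 2)) M] [IsManifold (𝓡 2) ∞ M]
  {Sig : Set (TangentBundle (𝓡 2) M)}
  [ChartedSpace (EuclideanSpace ℝ (Fin 3)) Sig] [IsManifold (𝓡 3) ∞ Sig]
  {o : ∀ x : M, Orientation ℝ (TangentSpace (𝓡 2) x) (Fin 2)} {η : Coframing Sig}
  {Ψ : ℝ → Sig → Sig}

namespace IsUnitSurface

variable (h : IsUnitSurface o η Ψ)
include h

theorem pushD_basepoint {P : Type*} [NormedAddCommGroup P] [NormedSpace ℝ P] {ν : P → Sig} {z : P}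
    (hν : MDifferentiableAt 𝓘(ℝ, P) (𝓡 3) ν z) (w : P) :
    pushD (E := E2) (fun z => basepoint (ν z)) z w = basepointD (ν z) (pushD (E := E3) ν z w) :=
  pushD_outer (h.mdifferentiableAt_basepoint _) hν w

/-- The velocity of a curve in a fibre is a multiple of `X₃`. -/
theorem pushD_vertical {P : Type*} [NormedAddCommGroup P] [NormedSpace ℝ P] {ν : P → Sig} {z : P}
    (hν : MDifferentiableAt 𝓘(ℝ, P) (𝓡 3) ν z) {m : M} (hm : ∀ᶠ z' in 𝓝 z, basepoint (ν z') = m)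
    (w : P) : η.form 0 (ν z) (pushD (E := E3) ν z w) = 0 ∧
      η.form 1 (ν z) (pushD (E := E3) ν z w) = 0 := by
  have h1 : HasMFDerivAt 𝓘(ℝ, P) (𝓡 2) (fun z => basepoint (ν z)) z
      (0 : P →L[ℝ] E2) :=
    (hasMFDerivAt_const m z).congr_of_eventuallyEq hm
  have h2 : basepointD (ν z) (pushD (E := E3) ν z w) = 0 :=
    (h.pushD_basepoint hν w).symm.trans (congrArg (fun L => L w) h1.mfderiv)
  rw [h.canon.basepointD_apply] at h2
  exact h.canon.eq_zero_of_smul_add_smul h2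

/-- A smooth map with `df(X₃) = 0` is constant on the fibres. -/
theorem eq_of_mfderiv_dual_two {f : Sig → M} (hf : ContMDiff (𝓡 3) (𝓡 2) ∞ f)
    (h0 : ∀ u, mfderiv (𝓡 3) (𝓡 2) f u (η.dual 2 u) = 0) {u w : Sig}
    (huw : basepoint u = basepoint w) : f u = f w := by
  have hloc : ∀ u : Sig, ∀ᶠ w in 𝓝 u, basepoint w = basepoint u → f w = f u := by
    intro u
    obtain ⟨c, L, hL0, hc, hLs, hL, hw⟩ := h.exists_fiber_coordinate u
    let ν : ℝ → Sig := fun s => L (basepoint u, s)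
    have hcm : ContMDiffAt 𝓘(ℝ, ℝ) ((𝓡 2).prod 𝓘(ℝ, ℝ)) ∞ (fun s : ℝ => (basepoint u, s)) (c u) :=
      contMDiffAt_const.prodMk contMDiffAt_id
    have hν : ContMDiffAt 𝓘(ℝ, ℝ) (𝓡 3) ∞ ν (c u) := hLs.comp (c u) hcm
    have hν0 : ν (c u) = u := hL0
    have hb : ∀ᶠ s in 𝓝 (c u), basepoint (ν s) = basepoint u :=
      (hcm.continuousAt.eventually hL).mono fun s hs => hs.1
    let φ := extChartAt (𝓡 2) (f u)
    let g : ℝ → E2 := fun s => φ (f (ν s))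
    have hsrc : ∀ᶠ s in 𝓝 (c u), f (ν s) ∈ φ.source := by
      have : ContinuousAt (fun s => f (ν s)) (c u) := hf.continuous.continuousAt.comp hν.continuousAt
      refine this.eventually ?_
      change φ.source ∈ 𝓝 (f (ν (c u)))
      rw [hν0]
      exact extChartAt_source_mem_nhds _
    have hall : ∀ᶠ s in 𝓝 (c u), f (ν s) ∈ φ.source ∧ HasFDerivAt g (0 : ℝ →L[ℝ] E2) s := by
      filter_upwards [eventually_mdifferentiableAt hν, hb.eventually_nhds, hsrc] with s h1 h2 h3
      refine ⟨h3, ?_⟩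
      have hfν : MDifferentiableAt 𝓘(ℝ, ℝ) (𝓡 2) (fun s => f (ν s)) s :=
        ((hf (ν s)).mdifferentiableAt (by simp)).comp s h1
      have hd := hasFDerivAt_extChartAt_comp hfν h3
      refine HasFDerivAt.congr_fderiv (𝕜 := ℝ) (E := ℝ) (F := E2) hd ?_
      ext1
      have e1 : pushD (E := E2) (fun s => f (ν s)) s (1 : ℝ) = 0 := by
        refine (pushD_outer ((hf (ν s)).mdifferentiableAt (by simp)) h1 (1 : ℝ)).trans ?_
        obtain ⟨a, b⟩ := h.pushD_vertical h1 h2 (1 : ℝ)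
        have e2 := η.sum_dual (pushD (E := E3) ν s (1 : ℝ))
        rw [a, b, zero_smul, zero_smul, zero_add, zero_add] at e2
        refine (congrArg (mfderiv (𝓡 3) (𝓡 2) f (ν s)) e2).trans ?_
        refine (map_smul (mfderiv (𝓡 3) (𝓡 2) f (ν s)) _ _).trans ?_
        refine (congrArg (fun v => η.form 2 (ν s) (pushD (E := E3) ν s (1 : ℝ)) • v)
          (h0 (ν s))).trans ?_
        exact smul_zero _
      exact (congrArg (mfderiv (𝓡 2) 𝓘(ℝ, E2) φ (f (ν s))) e1).trans (map_zero _)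
    obtain ⟨r, hr, hball⟩ := Metric.eventually_nhds_iff_ball.1 hall
    have hconst : ∀ s ∈ Metric.ball (c u) r, f (ν s) = f u := by
      intro s hs
      have hcu := Metric.mem_ball_self hr (x := c u)
      have := Metric.isOpen_ball.is_const_of_fderiv_eq_zero (𝕜 := ℝ)
        (convex_ball (c u) r).isPreconnected
        (fun s hs => (hball s hs).2.differentiableAt.differentiableWithinAt)
        (fun s hs => (hball s hs).2.fderiv) hs hcu
      have h2 := φ.injOn (hball s hs).1 (hball _ hcu).1 this
      rwa [hν0] at h2
    filter_upwards [hw, hc.continuousAt.eventually (Metric.ball_mem_nhds _ hr)] with w h1 h2 h3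
    refine Eq.trans ?_ (hconst _ h2)
    conv_lhs => rw [← h1, h3]
  obtain ⟨γ, hγ⟩ := h.finsler.exists_isFiberParam (basepoint w)
  have hlc : IsLocallyConstant (fun θ => f (γ θ)) := by
    rw [IsLocallyConstant.iff_eventually_eq]
    intro θ
    filter_upwards [hγ.continuous.continuousAt.eventually (hloc (γ θ))] with θ' h1
    exact h1 (by rw [hγ.base, hγ.base])
  obtain ⟨θ, rfl⟩ := hγ.surj u huw
  obtain ⟨θ', rfl⟩ := hγ.surj w rfl
  exact hlc.apply_eq_of_preconnectedSpace θ θ'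

theorem contMDiff_geo_time (t : ℝ) : ContMDiff (𝓡 3) (𝓡 2) ∞ (fun u => basepoint (Ψ t u)) :=
  h.finsler.contMDiff_basepoint.comp (h.flow.contMDiff_time t)

theorem mfderiv_geo_time (t : ℝ) (u : Sig) (V : TangentSpace (𝓡 3) u) :
    mfderiv (𝓡 3) (𝓡 2) (fun u => basepoint (Ψ t u)) u V =
      η.form 0 u V • vec (Ψ t u) +
        (Real.cos t * η.form 1 u V + Real.sin t * η.form 2 u V) • normal η (Ψ t u) := by
  have h1 := (HasMFDerivAt.comp (g := (basepoint : Sig → M)) u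
    (h.mdifferentiableAt_basepoint (Ψ t u)).hasMFDerivAt
    ((h.flow.contMDiff_time t u).mdifferentiableAt (by simp)).hasMFDerivAt).mfderiv
  refine (congrArg (fun L => L V) h1).trans ?_
  have h2 := h.basepointD_flow t u 0 V
  rw [zero_smul, zero_add, zero_add] at h2
  exact h2

/-- All geodesics issuing from a point meet again at time `π`. -/
theorem antipode_eq {u w : Sig} (huw : basepoint u = basepoint w) :
    basepoint (Ψ Real.pi u) = basepoint (Ψ Real.pi w) := by
  refine h.eq_of_mfderiv_dual_two (f := fun u => basepoint (Ψ Real.pi u)) (h.contMDiff_geo_time _)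
    (fun u => ?_) huw
  rw [h.mfderiv_geo_time]
  simp [η.form_dual]

end IsUnitSurface

end Surface

/-! ## Convexity of the indicatrix in terms of the coframing -/

section Surface

variable {M : Type*} [TopologicalSpace M]
  [ChartedSpace (EuclideanSpace ℝ (Fin 2)) M] [IsManifold (𝓡 2) ∞ M]
  {Sig : Set (TangentBundle (𝓡 2) M)}
  [ChartedSpace (EuclideanSpace ℝ (Fin 3)) Sig]
  {o : ∀ x : M, Orientation ℝ (TangentSpace (𝓡 2) x) (Fin 2)} {η : Coframing Sig}
  {Ψ : ℝ → Sig → Sig}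

/-- The point `u` of `Σ` as a vector of the model plane. -/
def vec2 (u : Sig) : E2 := vec u

/-- The covector `λ_u` on the model plane. -/
def covec2 (η : Coframing Sig) (u : Sig) : E2 →L[ℝ] ℝ := covec η u

theorem vec2_mem_fiber {u : Sig} {m : M} (hu : basepoint u = m) :
    vec2 u ∈ (fiber Sig m : Set E2) := by
  subst hu; exact vec_mem_fiber u

/-- The convex body bounded by the indicatrix, in the model plane. -/
def body (Sig : Set (TangentBundle (𝓡 2) M)) (m : M) : Set E2 :=
  convexHull ℝ (show Set E2 from fiber Sig m)

theorem convex_body (m : M) : Convex ℝ (body Sig m) := convex_convexHull ℝ _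

theorem vec2_mem_body {u : Sig} {m : M} (hu : basepoint u = m) : vec2 u ∈ body Sig m :=
  subset_convexHull ℝ _ (vec2_mem_fiber hu)

namespace IsFinslerStructure

variable (h : IsFinslerStructure Sig)
include h

theorem vec2_notMem_interior {u : Sig} {m : M} (hu : basepoint u = m) :
    vec2 u ∉ interior (body Sig m) := fun hi => by
  have hfr : (show Set E2 from fiber Sig m) = frontier (body Sig m) := h.boundary m
  have : vec2 u ∈ frontier (body Sig m) := hfr ▸ vec2_mem_fiber hu
  exact this.2 hi

theorem zero_mem_interior_body (m : M) : (0 : E2) ∈ interior (body Sig m) := h.zero_mem m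

theorem strictConvex_body (m : M) : StrictConvex ℝ (body Sig m) := h.strictlyConvex m

end IsFinslerStructure

/-- The exponential map in charts. -/
def geoChart (Ψ : ℝ → Sig → Sig) (u : Sig) (z : ℝ × E3) : E2 :=
  extChartAt (𝓡 2) (basepoint u) (basepoint (Ψ z.1 ((extChartAt (𝓡 3) u).symm z.2)))

/-- A bounding covector at a point of the frontier of a convex body. -/
theorem exists_supporting_covector {V : Type*} [NormedAddCommGroup V] [NormedSpace ℝ V]
    {K : Set V} (hK : Convex ℝ K) (h0 : (0 : V) ∈ interior K) {x : V} (hx : x ∉ interior K) :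
    ∃ l : V →L[ℝ] ℝ, 0 < l x ∧ ∀ v ∈ K, l v ≤ l x := by
  obtain ⟨l, hl⟩ := geometric_hahn_banach_open_point hK.interior isOpen_interior hx
  refine ⟨l, by simpa using hl 0 h0, fun v hv => ?_⟩
  have hc : v ∈ closure (interior K) := by
    rw [hK.closure_interior_eq_closure_of_nonempty_interior ⟨0, h0⟩]
    exact subset_closure hv
  exact closure_minimal (fun a ha => (hl a ha).le) (isClosed_le l.continuous continuous_const) hc

/-- If `l x = c > 0`, a slight dilation of `x` stays in `K` and exceeds the bound. -/
theorem lt_of_mem_interior {V : Type*} [NormedAddCommGroup V] [NormedSpace ℝ V]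
    {K : Set V} {l : V →L[ℝ] ℝ} {c : ℝ} (hc : 0 < c) (hl : ∀ v ∈ K, l v ≤ c) {x : V}
    (hx : x ∈ interior K) : l x < c := by
  refine lt_of_le_of_ne (hl x (interior_subset hx)) fun he => ?_
  have hcont : ContinuousAt (fun s : ℝ => s • x) 1 := by fun_prop
  have h1 : ∀ᶠ s in 𝓝 (1 : ℝ), s • x ∈ K :=
    hcont.eventually (by simpa using mem_interior_iff_mem_nhds.1 hx)
  obtain ⟨s, hs, hs1⟩ := ((h1.filter_mono nhdsWithin_le_nhds).and
    (self_mem_nhdsWithin : Ioi (1 : ℝ) ∈ 𝓝[>] 1)).exists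
  have := hl _ hs
  rw [map_smul, he, smul_eq_mul] at this
  have hs2 : (1 : ℝ) < s := hs1
  nlinarith

variable [T2Space M] [IsManifold (𝓡 3) ∞ Sig]

namespace IsUnitSurface

variable (h : IsUnitSurface o η Ψ)
include h

theorem contMDiffAt_geo_symm (u : Sig) {z : ℝ × E3} (hz : z.2 ∈ (extChartAt (𝓡 3) u).target) :
    ContMDiffAt 𝓘(ℝ, ℝ × E3) (𝓡 2) ∞
      (fun z : ℝ × E3 => basepoint (Ψ z.1 ((extChartAt (𝓡 3) u).symm z.2))) z :=
  (h.finsler.contMDiff_basepoint _).comp z (h.flow.contMDiffAt_comp contDiffAt_fst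
    ((contMDiffAt_extChartAt_symm_target hz).comp z contDiff_snd.contMDiff.contMDiffAt))

theorem geo_symm_zero (u : Sig) :
    basepoint (Ψ 0 ((extChartAt (𝓡 3) u).symm (extChartAt (𝓡 3) u u))) = basepoint u := by
  rw [h.flow.zero, extChartAt_to_inv]

theorem contDiffAt_geoChart (u : Sig) :
    ContDiffAt ℝ ∞ (geoChart Ψ u) ((0 : ℝ), extChartAt (𝓡 3) u u) := by
  refine contDiffAt_extChartAt_comp (E := E2) le_rfl
    (h.contMDiffAt_geo_symm u (mem_extChartAt_target u)) ?_
  change basepoint (Ψ 0 ((extChartAt (𝓡 3) u).symm (extChartAt (𝓡 3) u u))) ∈ _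
  rw [h.geo_symm_zero]
  exact mem_extChartAt_source _

theorem fderiv_geoChart (u : Sig) : ∀ᶠ z in 𝓝 ((0 : ℝ), extChartAt (𝓡 3) u u),
    ∀ (τ : ℝ) (v : E3), fderiv ℝ (geoChart Ψ u) z (τ, v) =
      mfderiv (𝓡 2) 𝓘(ℝ, E2) (extChartAt (𝓡 2) (basepoint u))
        (basepoint (Ψ z.1 ((extChartAt (𝓡 3) u).symm z.2)))
        ((τ + η.form 0 _ (pushD (E := E3) (extChartAt (𝓡 3) u).symm z.2 v)) •
            vec (Ψ z.1 ((extChartAt (𝓡 3) u).symm z.2)) +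
          (Real.cos z.1 * η.form 1 _ (pushD (E := E3) (extChartAt (𝓡 3) u).symm z.2 v) +
            Real.sin z.1 * η.form 2 _ (pushD (E := E3) (extChartAt (𝓡 3) u).symm z.2 v)) •
            normal η (Ψ z.1 ((extChartAt (𝓡 3) u).symm z.2))) := by
  have hsm := h.contMDiffAt_geo_symm u (z := ((0 : ℝ), extChartAt (𝓡 3) u u))
    (mem_extChartAt_target u)
  have hsrc : ∀ᶠ z in 𝓝 ((0 : ℝ), extChartAt (𝓡 3) u u),
      basepoint (Ψ z.1 ((extChartAt (𝓡 3) u).symm z.2)) ∈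
        (extChartAt (𝓡 2) (basepoint u)).source := by
    refine hsm.continuousAt.eventually ?_
    change _ ∈ 𝓝 (basepoint (Ψ 0 ((extChartAt (𝓡 3) u).symm (extChartAt (𝓡 3) u u))))
    rw [h.geo_symm_zero]
    exact extChartAt_source_mem_nhds _
  filter_upwards [hsrc, continuousAt_snd.eventually (extChartAt_target_mem_nhds (I := 𝓡 3) u)]
    with z h1 h2 τ v
  refine (fderiv_extChartAt_comp (E := E2)
    ((h.contMDiffAt_geo_symm u h2).mdifferentiableAt (by simp)) h1 (τ, v)).trans ?_
  have hsy := (contMDiffAt_extChartAt_symm_target (E := E3) (u := u) h2).mdifferentiableAt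
    (by simp)
  have e1 := h.pushD_geo (P := ℝ × E3) (τ := Prod.fst) (z := z)
    (ν := fun z => (extChartAt (𝓡 3) u).symm z.2) hasFDerivAt_fst
    (hsy.comp z (hasFDerivAt_snd (𝕜 := ℝ) (p := z)).hasMFDerivAt.mdifferentiableAt) (τ, v)
  have e2 := pushD_comp (E := E3) (Φ := (extChartAt (𝓡 3) u).symm) hsy
    (hasFDerivAt_snd (𝕜 := ℝ) (E := ℝ) (F := E3) (p := z)) (τ, v)
  rw [e2] at e1
  exact congrArg _ e1

theorem fderiv_geoChart_base (u : Sig) : ∀ᶠ t in 𝓝 (0 : ℝ), ∀ (v : E3),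
    fderiv ℝ (geoChart Ψ u) (t, extChartAt (𝓡 3) u u) ((0 : ℝ), v) =
      mfderiv (𝓡 2) 𝓘(ℝ, E2) (extChartAt (𝓡 2) (basepoint u)) (basepoint (Ψ t u))
        (η.form 0 u v • vec (Ψ t u) +
          (Real.cos t * η.form 1 u v + Real.sin t * η.form 2 u v) • normal η (Ψ t u)) := by
  have hc : ContinuousAt (fun t : ℝ => (t, extChartAt (𝓡 3) u u)) 0 := by fun_prop
  filter_upwards [hc.eventually (h.fderiv_geoChart u)] with t ht v
  refine (ht 0 v).trans ?_
  have key : ∀ (u' : Sig) (hu' : u' = u) (V : TangentSpace (𝓡 3) u') (_ : V = v),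
      mfderiv (𝓡 2) 𝓘(ℝ, E2) (extChartAt (𝓡 2) (basepoint u)) (basepoint (Ψ t u'))
        ((0 + η.form 0 u' V) • vec (Ψ t u') +
          (Real.cos t * η.form 1 u' V + Real.sin t * η.form 2 u' V) • normal η (Ψ t u')) =
      mfderiv (𝓡 2) 𝓘(ℝ, E2) (extChartAt (𝓡 2) (basepoint u)) (basepoint (Ψ t u))
        (η.form 0 u v • vec (Ψ t u) +
          (Real.cos t * η.form 1 u v + Real.sin t * η.form 2 u v) • normal η (Ψ t u)) := by
    rintro _ rfl _ rfl
    rw [zero_add]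
  exact key _ (extChartAt_to_inv u) _ (pushD_extChartAt_symm_self u v)

theorem fderiv_geoChart_time (u : Sig) : ∀ᶠ y in 𝓝 (extChartAt (𝓡 3) u u),
    basepoint ((extChartAt (𝓡 3) u).symm y) = basepoint u →
    fderiv ℝ (geoChart Ψ u) ((0 : ℝ), y) ((1 : ℝ), (0 : E3)) =
      vec2 ((extChartAt (𝓡 3) u).symm y) := by
  have hc : ContinuousAt (fun y : E3 => ((0 : ℝ), y)) (extChartAt (𝓡 3) u u) := by fun_prop
  filter_upwards [hc.eventually (h.fderiv_geoChart u)] with y hy hb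
  refine (hy 1 0).trans ?_
  simp only [map_zero, add_zero, mul_zero, zero_smul, one_smul]
  have key : ∀ w' w : Sig, w' = w → basepoint w = basepoint u →
      mfderiv (𝓡 2) 𝓘(ℝ, E2) (extChartAt (𝓡 2) (basepoint u)) (basepoint w') (vec w') =
        vec2 w := by
    rintro _ w rfl hw
    rw [← hw]
    exact mfderiv_extChartAt_self_apply _ _
  exact key _ _ (h.flow.zero _) hb

/-- The tangent of the indicatrix. -/
theorem hasDerivAt_vec {ν : ℝ → Sig} {s : ℝ} (hν : ContMDiffAt 𝓘(ℝ, ℝ) (𝓡 3) ∞ ν s)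
    (hb : ∀ᶠ s' in 𝓝 s, basepoint (ν s') = basepoint (ν s)) :
    HasDerivAt (fun s => vec2 (ν s))
      (η.form 2 (ν s) (pushD (E := E3) ν s (1 : ℝ)) • (normal η (ν s) : E2)) s := by
  set u := ν s with hu
  set κ := η.form 2 u (pushD (E := E3) ν s (1 : ℝ)) with hκ
  set φ := extChartAt (𝓡 3) u
  have hνd := hν.mdifferentiableAt (by simp)
  -- the coordinate expression of the curve
  have hy : HasDerivAt (fun s => φ (ν s)) (κ • (η.dual 2 u : E3)) s := by
    have h1 := hasFDerivAt_extChartAt_comp (E := E3) (u₀ := u) hνd (mem_extChartAt_source u)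
    have h2 := HasFDerivAt.hasDerivAt (𝕜 := ℝ) (F := E3) h1
    refine h2.congr_deriv ?_
    refine (mfderiv_extChartAt_self_apply u (pushD (E := E3) ν s (1 : ℝ))).trans ?_
    obtain ⟨a, b⟩ := h.pushD_vertical hνd hb (1 : ℝ)
    have e2 := η.sum_dual (pushD (E := E3) ν s (1 : ℝ))
    rw [a, b, zero_smul, zero_smul, zero_add, zero_add] at e2
    exact e2
  set F := geoChart Ψ u with hF
  have hFc := h.contDiffAt_geoChart u
  have hF2 : HasFDerivAt (fderiv ℝ F) (fderiv ℝ (fderiv ℝ F) ((0 : ℝ), φ u)) ((0 : ℝ), φ u) :=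
    ((hFc.fderiv_right (m := ∞) (by simp)).differentiableAt (by simp)).hasFDerivAt
  have hsym : IsSymmSndFDerivAt ℝ F ((0 : ℝ), φ u) := hFc.isSymmSndFDerivAt (by
    simpa using (by exact_mod_cast le_top : ((2 : ℕ∞) : ℕ∞ω) ≤ ((⊤ : ℕ∞) : ℕ∞ω)))
  have hpt : ∀ v : E3, HasDerivAt (fun t => fderiv ℝ F (t, φ u) ((0 : ℝ), v))
      (fderiv ℝ (fderiv ℝ F) ((0 : ℝ), φ u) ((1 : ℝ), (0 : E3)) ((0 : ℝ), v)) 0 := fun v => by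
    have hc : HasDerivAt (fun t : ℝ => (t, φ u)) ((1 : ℝ), (0 : E3)) 0 :=
      (hasDerivAt_id _).prodMk (hasDerivAt_const _ _)
    have h2 := (ContinuousLinearMap.apply ℝ E2 ((0 : ℝ), v)).hasFDerivAt.comp_hasDerivAt (0 : ℝ)
      (hF2.comp_hasDerivAt (0 : ℝ) hc)
    exact h2
  -- The initial velocity is the time derivative of the exponential map. By symmetry of second
  -- derivatives, its change along `X₃` is the time derivative at `0` of the Jacobi field `sin t ·
  -- n`.
  have hmixed : fderiv ℝ (fderiv ℝ F) ((0 : ℝ), φ u) ((1 : ℝ), (0 : E3))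
      ((0 : ℝ), (η.dual 2 u : E3)) = (normal η u : E2) := by
    have hC0 : fderiv ℝ F ((0 : ℝ), φ u) ((0 : ℝ), (η.dual 1 u : E3)) = (normal η u : E2) := by
      refine ((h.fderiv_geoChart_base u).self_of_nhds (η.dual 1 u)).trans ?_
      have key : ∀ w : Sig, w = u → mfderiv (𝓡 2) 𝓘(ℝ, E2) (extChartAt (𝓡 2) (basepoint u))
          (basepoint w) (η.form 0 u (η.dual 1 u) • vec w +
          (Real.cos 0 * η.form 1 u (η.dual 1 u) + Real.sin 0 * η.form 2 u (η.dual 1 u)) •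
            normal η w) = (normal η u : E2) := by
        rintro _ rfl
        simp only [η.form_dual]
        simp only [Fin.isValue, zero_ne_one, ↓reduceIte, zero_smul, Real.cos_zero, mul_one,
          Real.sin_zero, zero_mul, add_zero, one_smul, zero_add]
        exact mfderiv_extChartAt_self_apply _ _
      exact key _ (h.flow.zero u)
    have h1 := hpt (η.dual 2 u)
    -- The fields generated by `X₂` and `X₃` are `cos t · n` and `sin t · n`, so the second is `tan
    -- t` times the first. The product rule at `t = 0` then needs no smoothness of `normal` itself.
    have h2 := (Real.hasDerivAt_tan (x := 0) (by simp)).smul (hpt (η.dual 1 u))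
    simp only [Real.tan_zero, zero_smul, Real.cos_zero, one_pow, div_one, one_smul, zero_add,
      hC0] at h2
    refine (h1.unique (h2.congr_of_eventuallyEq ?_)).trans (one_smul ℝ (normal η u : E2))
    have hcos : ∀ᶠ t in 𝓝 (0 : ℝ), Real.cos t ≠ 0 :=
      Real.continuous_cos.continuousAt.eventually_ne (by simp)
    filter_upwards [h.fderiv_geoChart_base u, hcos] with t ht hct
    refine (ht _).trans ?_
    refine Eq.trans ?_ (congrArg (fun x : E2 => Real.tan t • x) (ht (η.dual 1 u))).symm
    refine Eq.trans ?_ (map_smul (mfderiv (𝓡 2) 𝓘(ℝ, E2) (extChartAt (𝓡 2) (basepoint u))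
      (basepoint (Ψ t u))) (Real.tan t) _)
    congr 1
    simp only [η.form_dual]
    simp [smul_smul, Real.tan_mul_cos hct]
  have hH : HasDerivAt (fun s => fderiv ℝ F ((0 : ℝ), φ (ν s)) ((1 : ℝ), (0 : E3)))
      (κ • (normal η u : E2)) s := by
    have hc : HasDerivAt (fun s : ℝ => ((0 : ℝ), φ (ν s))) ((0 : ℝ), κ • (η.dual 2 u : E3)) s :=
      (hasDerivAt_const _ _).prodMk hy
    have hF2' : HasFDerivAt (fderiv ℝ F) (fderiv ℝ (fderiv ℝ F) ((0 : ℝ), φ u))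
        ((fun s : ℝ => ((0 : ℝ), φ (ν s))) s) := hF2
    have h2 := (ContinuousLinearMap.apply ℝ E2 ((1 : ℝ), (0 : E3))).hasFDerivAt.comp_hasDerivAt s
      (hF2'.comp_hasDerivAt s hc)
    refine h2.congr_deriv ?_
    change fderiv ℝ (fderiv ℝ F) ((0 : ℝ), φ u) ((0 : ℝ), κ • (η.dual 2 u : E3))
      ((1 : ℝ), (0 : E3)) = _
    have hsm : ∀ (A : ℝ × E3 →L[ℝ] E2) (d : E3), A ((0 : ℝ), κ • d) = κ • A ((0 : ℝ), d) :=
      fun A d => by rw [← map_smul, Prod.smul_mk, smul_zero]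
    exact (hsym.eq _ _).trans ((hsm _ _).trans (congrArg (fun x : E2 => κ • x) hmixed))
  refine hH.congr_of_eventuallyEq ?_
  have hyc : ContinuousAt (fun s => φ (ν s)) s := hy.continuousAt
  have hsrc : ∀ᶠ s in 𝓝 s, ν s ∈ φ.source :=
    hν.continuousAt.eventually (extChartAt_source_mem_nhds _)
  filter_upwards [hyc.eventually (h.fderiv_geoChart_time u), hb, hsrc] with s' h1 h2 h3
  rw [φ.left_inv h3] at h1
  exact (h1 h2).symm

/-- The coordinate curve of the fibre has nonzero speed because the coordinate `c` grows along it at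
unit rate. -/
theorem exists_fiber_curve (u : Sig) : ∃ (ν : ℝ → Sig) (s : ℝ), ν s = u ∧
    ContMDiffAt 𝓘(ℝ, ℝ) (𝓡 3) ∞ ν s ∧ (∀ᶠ s' in 𝓝 s, basepoint (ν s') = basepoint (ν s)) ∧
    η.form 2 (ν s) (pushD (E := E3) ν s (1 : ℝ)) ≠ 0 := by
  obtain ⟨c, L, hL0, hc, hLs, hL, hw⟩ := h.exists_fiber_coordinate u
  have hcm : ContMDiffAt 𝓘(ℝ, ℝ) ((𝓡 2).prod 𝓘(ℝ, ℝ)) ∞ (fun s : ℝ => (basepoint u, s)) (c u) :=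
    contMDiffAt_const.prodMk contMDiffAt_id
  let ν : ℝ → Sig := fun s => L (basepoint u, s)
  have hν0 : ν (c u) = u := hL0
  have hν : ContMDiffAt 𝓘(ℝ, ℝ) (𝓡 3) ∞ ν (c u) := hLs.comp (c u) hcm
  have hb : ∀ᶠ s in 𝓝 (c u), basepoint (ν s) = basepoint (ν (c u)) := by
    rw [hν0]
    exact (hcm.continuousAt.eventually hL).mono fun s hs => hs.1
  have hcν : ∀ᶠ s in 𝓝 (c u), c (ν s) = s := (hcm.continuousAt.eventually hL).mono fun s hs => hs.2
  refine ⟨ν, c u, hν0, hν, hb, fun h0 => ?_⟩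
  obtain ⟨a, b⟩ := h.pushD_vertical (hν.mdifferentiableAt (by simp)) hb (1 : ℝ)
  have hz : pushD (E := E3) ν (c u) (1 : ℝ) = 0 := η.ext_form fun i => by
    rw [map_zero]
    fin_cases i
    · exact a
    · exact b
    · exact h0
  have hcd : MDifferentiableAt (𝓡 3) 𝓘(ℝ, ℝ) c (ν (c u)) := by
    rw [hν0]; exact hc.mdifferentiableAt (by simp)
  have h1 := pushD_outer (E' := ℝ) (E := E3) (g := c) (Φ := ν) hcd
    (hν.mdifferentiableAt (by simp)) (1 : ℝ)
  have h2 : pushD (E := ℝ) (fun s => c (ν s)) (c u) (1 : ℝ) = (1 : ℝ) := by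
    have : HasMFDerivAt 𝓘(ℝ, ℝ) 𝓘(ℝ, ℝ) (fun s => c (ν s)) (c u) (ContinuousLinearMap.id ℝ ℝ) :=
      (hasMFDerivAt_id (c u)).congr_of_eventuallyEq hcν
    exact congrArg (fun L => L (1 : ℝ)) this.mfderiv
  rw [hz] at h1
  have h3 : (1 : ℝ) = 0 := h2.symm.trans (h1.trans (map_zero _))
  exact one_ne_zero h3

theorem covec2_vec2 (u : Sig) : covec2 η u (vec2 u) = 1 := h.canon.covec_vec u

theorem apply_eq_mul_covec2 {u : Sig} {l : E2 →L[ℝ] ℝ} (hl : l (normal η u : E2) = 0) (v : E2) :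
    l v = l (vec2 u) * covec2 η u v :=
  h.canon.apply_eq_mul_covec (l := l) hl v

/-- `λ_u` is a bounding covector of the indicatrix at `u`. -/
theorem covec_le_one (u : Sig) {v : E2} (hv : v ∈ body Sig (basepoint u)) :
    covec2 η u v ≤ 1 := by
  obtain ⟨l, hl0, hl⟩ := exists_supporting_covector (convex_body _)
    (h.finsler.zero_mem_interior_body (basepoint u)) (h.finsler.vec2_notMem_interior (u := u) rfl)
  obtain ⟨ν, s, hνs, hν, hb, hκ⟩ := h.exists_fiber_curve u
  have hd := l.hasFDerivAt.comp_hasDerivAt s (h.hasDerivAt_vec hν hb)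
  -- The supporting covector `l` is maximal at `u`, so it kills the tangent `n` of the indicatrix.
  -- As `λ_u` also kills `n` and `λ_u(u) = 1`, `l` is the positive multiple `l(u) λ_u`.
  have hmax : IsLocalMax (fun s => l (vec2 (ν s))) s := by
    filter_upwards [hb] with s' hs'
    rw [hνs] at hs' ⊢
    exact hl _ (vec2_mem_body hs')
  have hz := hmax.hasDerivAt_eq_zero hd
  have hz' : η.form 2 (ν s) (pushD (E := E3) ν s (1 : ℝ)) * l (normal η (ν s) : E2) = 0 :=
    (map_smul l _ (normal η (ν s) : E2)).symm.trans hz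
  have hn : l (normal η (ν s) : E2) = 0 := (mul_eq_zero.1 hz').resolve_left hκ
  rw [hνs] at hn
  have e' := h.apply_eq_mul_covec2 hn v
  have := hl v hv
  rw [e'] at this
  by_contra! hc
  nlinarith

/-- If `u ≠ w`, their midpoint would be an interior point of the body lying on its supporting line.
-/
theorem eq_of_covec_vec_eq_one {u w : Sig} (hb : basepoint u = basepoint w)
    (hc : covec2 η u (vec2 w) = 1) : u = w := by
  by_contra hne
  have hv : vec2 u ≠ vec2 w := fun he => hne (eq_of_vec_eq hb he)
  have hmid := h.finsler.strictConvex_body (basepoint u) (vec2_mem_body rfl)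
    (vec2_mem_body hb.symm) hv (a := 1 / 2) (b := 1 / 2) (by norm_num)
    (by norm_num) (by norm_num)
  have := lt_of_mem_interior one_pos (fun v hv => h.covec_le_one u hv) hmid
  rw [map_add, map_smul, map_smul, hc, h.covec2_vec2] at this
  norm_num at this

theorem eq_of_covec_eq {u w : Sig} (hb : basepoint u = basepoint w)
    (hc : covec2 η u = covec2 η w) : u = w :=
  h.eq_of_covec_vec_eq_one hb (by rw [hc, h.covec2_vec2])

/-- The bound `λ_u ≤ 1` on the body extends to all vectors by homogeneity. It is the calibration
inequality behind the lower bound for the diameter. -/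
theorem covec_le_finslerNorm (u : Sig) (v : E2) :
    covec2 η u v ≤ finslerNorm Sig (basepoint u) v := by
  change _ ≤ gauge (body Sig (basepoint u)) v
  have habs : Absorbent ℝ (body Sig (basepoint u)) :=
    absorbent_nhds_zero (mem_interior_iff_mem_nhds.1
      (h.finsler.zero_mem_interior_body (basepoint u)))
  refine le_of_forall_gt_imp_ge_of_dense fun r hr => ?_
  obtain ⟨b, hb0, hbr, w, hw, rfl⟩ := exists_lt_of_gauge_lt habs hr
  have := h.covec_le_one u hw
  change covec2 η u (b • w) ≤ r
  rw [map_smul, smul_eq_mul]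
  nlinarith

end IsUnitSurface

end Surface

/-! ## Every pair of points is joined by a geodesic of length at most `π`; compactness -/

section Surface

variable {M : Type*} [TopologicalSpace M] [T2Space M]
  [ChartedSpace (EuclideanSpace ℝ (Fin 2)) M] [IsManifold (𝓡 2) ∞ M]
  {Sig : Set (TangentBundle (𝓡 2) M)}
  [ChartedSpace (EuclideanSpace ℝ (Fin 3)) Sig] [IsManifold (𝓡 3) ∞ Sig]
  {o : ∀ x : M, Orientation ℝ (TangentSpace (𝓡 2) x) (Fin 2)} {η : Coframing Sig}
  {Ψ : ℝ → Sig → Sig}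

namespace IsUnitSurface

variable (h : IsUnitSurface o η Ψ)
include h

theorem isCompact_fiber (m : M) : IsCompact {u : Sig | basepoint u = m} :=
  (h.finsler.exists_isFiberParam m).choose_spec.isCompact

theorem isPreconnected_fiber (m : M) : IsPreconnected {u : Sig | basepoint u = m} :=
  (h.finsler.exists_isFiberParam m).choose_spec.isPreconnected

/-- Through every point of `Σ` there passes a continuous local section, namely a fixed value of the
fibre coordinate. -/
theorem isOpenMap_basepoint : IsOpenMap (basepoint : Sig → M) := by
  rw [isOpenMap_iff_nhds_le]
  intro u
  obtain ⟨c, L, hL0, hc, hLs, hL, hw⟩ := h.exists_fiber_coordinate u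
  have hcm : ContinuousAt (fun x : M => (x, c u)) (basepoint u) := by fun_prop
  have hLc : ContinuousAt (fun x : M => L (x, c u)) (basepoint u) :=
    ContinuousAt.comp (g := L) hLs.continuousAt hcm
  intro V hV
  have hV' : basepoint ⁻¹' V ∈ 𝓝 (L (basepoint u, c u)) := hL0.symm ▸ hV
  filter_upwards [hLc.eventually hV', hcm.eventually hL] with x h1 h2
  have : basepoint (L (x, c u)) ∈ V := h1
  rwa [h2.1] at this

/-- Points reached from `m` at times near `t` form a neighbourhood. -/
theorem eventually_exists_geo {u : Sig} {t : ℝ} (ht : Real.sin t ≠ 0) {J : Set ℝ} (hJ : J ∈ 𝓝 t) :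
    ∀ᶠ y in 𝓝 (basepoint (Ψ t u)), ∃ w : Sig, basepoint w = basepoint u ∧
      ∃ s ∈ J, basepoint (Ψ s w) = y := by
  obtain ⟨K, hK0, hKs, hK, -⟩ := h.exists_geodesic_inverse u ht
  have hcm : ContinuousAt (fun y : M => (basepoint u, y)) (basepoint (Ψ t u)) := by fun_prop
  have hKc : ContinuousAt (fun y : M => (K (basepoint u, y)).1) (basepoint (Ψ t u)) :=
    continuousAt_fst.comp (ContinuousAt.comp (g := K) hKs.continuousAt hcm)
  have hI : J ∈ 𝓝 (K (basepoint u, basepoint (Ψ t u))).1 := by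
    rw [hK0]; exact hJ
  filter_upwards [hcm.eventually hK, hKc.eventually hI] with y h1 h2
  exact ⟨_, h1.1, _, h2, h1.2⟩

theorem isPreconnected_diff_pair [ConnectedSpace M] (a b : M) :
    IsPreconnected ((univ \ {a}) \ {b} : Set M) :=
  isPreconnected_diff_singleton (isOpen_univ.sdiff isClosed_singleton)
    (isPreconnected_diff_singleton isOpen_univ isPreconnected_univ
      (exists_nhds_isPreconnected_diff a)) (exists_nhds_isPreconnected_diff b)

/-- The set `C` reached from `m` in times `[0, π]` is closed. It is a neighbourhood of each of its
points other than `m` and the antipode `a`, and `M` without `m` and `a` is connected. -/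
theorem exists_geo_eq [ConnectedSpace M] (m y : M) : ∃ u : Sig, basepoint u = m ∧
    ∃ t ∈ Icc 0 Real.pi, basepoint (Ψ t u) = y := by
  let C : Set M := (fun p : ℝ × Sig => basepoint (Ψ p.1 p.2)) ''
    (Icc 0 Real.pi ×ˢ {u : Sig | basepoint u = m})
  suffices hC : y ∈ C by
    obtain ⟨⟨t, u⟩, ⟨ht, hu⟩, rfl⟩ := hC
    exact ⟨u, hu, t, ht, rfl⟩
  have hCc : IsCompact C := (isCompact_Icc.prod (h.isCompact_fiber m)).image h.continuous_geo
  obtain ⟨u₀, hu₀⟩ := h.finsler.surjective m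
  set a := basepoint (Ψ Real.pi u₀) with ha
  have hmC : m ∈ C := ⟨(0, u₀), ⟨⟨le_rfl, Real.pi_pos.le⟩, hu₀⟩, by
    simp only [h.flow.zero, hu₀]⟩
  have haC : a ∈ C := ⟨(Real.pi, u₀), ⟨⟨Real.pi_pos.le, le_rfl⟩, hu₀⟩, rfl⟩
  have hnhds : ∀ (u : Sig), basepoint u = m → ∀ t ∈ Ioo 0 Real.pi,
      C ∈ 𝓝 (basepoint (Ψ t u)) := fun u hu t ht => by
    filter_upwards [h.eventually_exists_geo (Real.sin_pos_of_mem_Ioo ht).ne'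
      (Ioo_mem_nhds ht.1 ht.2)] with y ⟨w, hw, s, hs, hy⟩
    exact ⟨(s, w), ⟨⟨hs.1.le, hs.2.le⟩, hw.trans hu⟩, hy⟩
  have hopen : ∀ x ∈ C, x ≠ m → x ≠ a → C ∈ 𝓝 x := by
    rintro _ ⟨⟨t, u⟩, ⟨ht, hu⟩, rfl⟩ hm hxa
    refine hnhds u hu t ⟨ht.1.lt_of_ne ?_, ht.2.lt_of_ne ?_⟩
    · rintro rfl
      exact hm (by simp only [h.flow.zero]; exact hu)
    · rintro rfl
      exact hxa (h.antipode_eq (u := u) (w := u₀) (hu.trans hu₀.symm))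
  by_cases hy : y = m ∨ y = a
  · rcases hy with rfl | rfl
    exacts [hmC, haC]
  push Not at hy
  by_contra hyC
  obtain ⟨z, hz, hz1, hz2⟩ := h.isPreconnected_diff_pair m a (interior C) Cᶜ isOpen_interior
    hCc.isClosed.isOpen_compl (by
      rintro x ⟨⟨-, hxm⟩, hxa⟩
      by_cases hx : x ∈ C
      · exact Or.inl (mem_interior_iff_mem_nhds.2 (hopen x hx hxm hxa))
      · exact Or.inr hx) (by
      set x := basepoint (Ψ (Real.pi / 2) u₀)
      have hx := hnhds u₀ hu₀ (Real.pi / 2) ⟨by positivity, by linarith [Real.pi_pos]⟩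
      by_contra hne
      rw [not_nonempty_iff_eq_empty] at hne
      -- Otherwise the interior of `C`, a neighbourhood of the point at time `π/2`, would be finite;
      -- but a surface has no isolated points.
      have hsub : interior C ⊆ {m, a} := fun z hz => by
        by_contra hc
        simp only [mem_insert_iff, mem_singleton_iff, not_or] at hc
        exact (hne ▸ ⟨⟨⟨trivial, hc.1⟩, hc.2⟩, hz⟩ : z ∈ (∅ : Set M))
      have hfin : ((interior C) \ {x}).Finite := ((toFinite {m, a}).subset hsub).subset diff_subset
      have hV : interior C \ (interior C \ {x}) ∈ 𝓝 x :=
        inter_mem (interior_mem_nhds.2 hx)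
          (hfin.isClosed.isOpen_compl.mem_nhds (fun hc => hc.2 rfl))
      obtain ⟨U, hUV, -, -, z, hz⟩ := exists_nhds_isPreconnected_diff x _ hV
      exact (hUV hz.1).2 ⟨(hUV hz.1).1, hz.2⟩)
    ⟨y, ⟨⟨trivial, hy.1⟩, hy.2⟩, hyC⟩
  exact hz2 (interior_subset hz1)

theorem compactSpace_base [ConnectedSpace M] : CompactSpace M := by
  obtain ⟨m⟩ := (inferInstance : Nonempty M)
  refine ⟨?_⟩
  have : (univ : Set M) = (fun p : ℝ × Sig => basepoint (Ψ p.1 p.2)) ''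
      (Icc 0 Real.pi ×ˢ {u : Sig | basepoint u = m}) := by
    refine (eq_univ_of_forall fun y => ?_).symm
    obtain ⟨u, hu, t, ht, hy⟩ := h.exists_geo_eq m y
    exact ⟨(t, u), ⟨ht, hu⟩, hy⟩
  rw [this]
  exact (isCompact_Icc.prod (h.isCompact_fiber m)).image h.continuous_geo

/-- The projection is proper. A compact neighbourhood `Q` of one fibre contains all nearby fibres,
since a connected fibre that meets the interior of `Q` and avoids the rest of `Q` cannot leave it.
-/
theorem compactSpace [ConnectedSpace M] : CompactSpace Sig := by
  have := h.compactSpace_base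
  have : LocallyCompactSpace Sig := ChartedSpace.locallyCompactSpace E3 Sig
  have key : ∀ m : M, ∃ Q : Set Sig, IsCompact Q ∧ ∃ U ∈ 𝓝 m, basepoint ⁻¹' U ⊆ Q := by
    intro m
    obtain ⟨Q, hQc, hQ⟩ := exists_compact_superset (h.isCompact_fiber m)
    set V := interior Q
    set D := Q \ V
    have hD : IsCompact D := hQc.diff isOpen_interior
    have hDm : m ∉ basepoint '' D := by
      rintro ⟨u, hu, hum⟩
      exact hu.2 (hQ hum)
    obtain ⟨u₀, hu₀⟩ := h.finsler.surjective m
    have hU1 : basepoint '' V ∈ 𝓝 m :=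
      (h.isOpenMap_basepoint V isOpen_interior).mem_nhds ⟨u₀, hQ hu₀, hu₀⟩
    have hU2 : (basepoint '' D)ᶜ ∈ 𝓝 m :=
      (hD.image continuous_basepoint).isClosed.isOpen_compl.mem_nhds hDm
    refine ⟨Q, hQc, _, inter_mem hU1 hU2, ?_⟩
    rintro u ⟨⟨v, hv, hvu⟩, hu2⟩
    by_contra huQ
    obtain ⟨z, hz, hz1, hz2⟩ := h.isPreconnected_fiber (basepoint u) V Qᶜ isOpen_interior
      hQc.isClosed.isOpen_compl (by
        intro z hz
        by_cases hzQ : z ∈ Q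
        · by_cases hzV : z ∈ V
          · exact Or.inl hzV
          · exact absurd ⟨z, ⟨hzQ, hzV⟩, hz⟩ hu2
        · exact Or.inr hzQ) ⟨v, hvu, hv⟩ ⟨u, rfl, huQ⟩
    exact hz2 (interior_subset hz1)
  choose Q hQ U hU hUQ using key
  obtain ⟨t, ht⟩ := CompactSpace.elim_nhds_subcover U hU
  refine ⟨(t.isCompact_biUnion fun m _ => hQ m).of_isClosed_subset isClosed_univ fun u _ => ?_⟩
  have hu : basepoint u ∈ ⋃ x ∈ t, U x := ht ▸ trivial
  simp only [mem_iUnion] at hu ⊢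
  obtain ⟨m, hm, hu⟩ := hu
  exact ⟨m, hm, hUQ m hu⟩

/-- There are no short geodesic loops. -/
theorem eventually_geo_ne (u : Sig) : ∀ᶠ p in 𝓝 ((0 : ℝ), u), p.1 ≠ 0 →
    basepoint (Ψ p.1 p.2) ≠ basepoint p.2 := by
  set φ := extChartAt (𝓡 3) u
  set F := geoChart Ψ u
  have hstr := (h.contDiffAt_geoChart u).hasStrictFDerivAt (by simp)
  have hv0 : fderiv ℝ F ((0 : ℝ), φ u) ((1 : ℝ), (0 : E3)) = vec2 u := by
    have := (h.fderiv_geoChart_time u).self_of_nhds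
    rw [extChartAt_to_inv] at this
    exact this rfl
  have hvne : vec2 u ≠ 0 := fun h0 => by
    have := h.covec2_vec2 u
    rw [h0, map_zero] at this
    exact zero_ne_one this
  -- By strict differentiability, the displacement in time `t` is `t • vec2 u` up to an error of at
  -- most half its norm, uniformly in the starting vector.
  have hpos : 0 < ‖vec2 u‖ / 2 := by positivity
  have hest := hstr.isLittleO.def hpos
  have hcont : ContinuousAt (fun p : ℝ × Sig => ((p.1, φ p.2), ((0 : ℝ), φ p.2))) ((0 : ℝ), u) := by
    have h1 : ContinuousAt (fun p : ℝ × Sig => φ p.2) ((0 : ℝ), u) :=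
      ContinuousAt.comp (g := φ) (continuousAt_extChartAt u) continuousAt_snd
    exact (continuousAt_fst.prodMk h1).prodMk (continuousAt_const.prodMk h1)
  have hsrc : ∀ᶠ p in 𝓝 ((0 : ℝ), u), p.2 ∈ φ.source :=
    continuousAt_snd.eventually (extChartAt_source_mem_nhds u)
  filter_upwards [hcont.eventually hest, hsrc] with p h1 h2 hp0 heq
  simp only [F, geoChart, Prod.mk_sub_mk, sub_self, sub_zero] at h1
  rw [φ.left_inv h2, h.flow.zero, heq, sub_self, zero_sub, norm_neg] at h1
  have h3 : fderiv ℝ F ((0 : ℝ), φ u) (p.1, (0 : E3)) = p.1 • vec2 u := by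
    rw [← hv0, ← map_smul, Prod.smul_mk, smul_zero, smul_eq_mul, mul_one]
  have h4 : ‖p.1 • vec2 u‖ ≤ ‖vec2 u‖ / 2 * ‖(p.1, (0 : E3))‖ := h3 ▸ h1
  rw [norm_smul, Prod.norm_mk, norm_zero, max_eq_left (norm_nonneg _)] at h4
  have h5 : 0 < ‖p.1‖ * ‖vec2 u‖ := by positivity
  linarith

end IsUnitSurface

end Surface

/-! ## There are no geodesic loops of length less than `π` -/

/-- Each tangent space is the model space `E3`; regarding the form as a function on `S → E3` avoids
a dependent rewrite of the basepoint. -/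
theorem form_pushD_congr {S : Type*} [TopologicalSpace S]
    [ChartedSpace (EuclideanSpace ℝ (Fin 3)) S] (η : Coframing S) (i : Fin 3)
    {P : Type*} [NormedAddCommGroup P] [NormedSpace ℝ P] {f g : P → S} {z : P}
    (hfg : f =ᶠ[𝓝 z] g) (w : P) :
    η.form i (f z) (pushD (E := E3) f z w) = η.form i (g z) (pushD (E := E3) g z w) := by
  let F : S → E3 → ℝ := fun p x => η.form i p x
  have h2 : mfderiv 𝓘(ℝ, P) (𝓡 3) f z = mfderiv 𝓘(ℝ, P) (𝓡 3) g z := hfg.mfderiv_eq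
  exact congr (congrArg F hfg.eq_of_nhds) (congrArg (fun L : P →L[ℝ] E3 => L w) h2)

/-- A function with a local minimum does not have a negative second derivative there. -/
theorem IsLocalMin.not_deriv_deriv_neg {f : ℝ → ℝ} {x : ℝ} (hf : IsLocalMin f x)
    (hc : ContinuousAt f x) : ¬ deriv (deriv f) x < 0 := by
  intro hneg
  have hmax := isLocalMax_of_deriv_deriv_neg hneg hf.deriv_eq_zero hc
  have hconst : f =ᶠ[𝓝 x] fun _ => f x := by
    filter_upwards [hf, hmax] with y h1 h2 using le_antisymm h2 h1
  have h1 : deriv f =ᶠ[𝓝 x] fun _ => 0 := by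
    filter_upwards [hconst.eventuallyEq_nhds] with y hy
    rw [hy.deriv_eq, deriv_const]
  rw [h1.deriv_eq, deriv_const] at hneg
  exact lt_irrefl _ hneg

section Surface

variable {M : Type*} [TopologicalSpace M] [T2Space M]
  [ChartedSpace (EuclideanSpace ℝ (Fin 2)) M] [IsManifold (𝓡 2) ∞ M]
  {Sig : Set (TangentBundle (𝓡 2) M)}
  [ChartedSpace (EuclideanSpace ℝ (Fin 3)) Sig] [IsManifold (𝓡 3) ∞ Sig]
  {o : ∀ x : M, Orientation ℝ (TangentSpace (𝓡 2) x) (Fin 2)} {η : Coframing Sig}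
  {Ψ : ℝ → Sig → Sig}

namespace IsUnitSurface

variable (h : IsUnitSurface o η Ψ)
include h

/-- Two lifts of the same map to `M` which agree at a point: the difference of the derivatives
of `ω₁` along them. -/
theorem fderiv_form_zero_sub {P : Type*} [NormedAddCommGroup P] [NormedSpace ℝ P] {Y : P → M}
    {z₀ : P} (hY : ContMDiffAt 𝓘(ℝ, P) (𝓡 2) ∞ Y z₀) {w u : P → Sig}
    (hw : ContMDiffAt 𝓘(ℝ, P) (𝓡 3) ∞ w z₀) (hu : ContMDiffAt 𝓘(ℝ, P) (𝓡 3) ∞ u z₀)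
    (hwu : w z₀ = u z₀) (hwY : ∀ᶠ z in 𝓝 z₀, basepoint (w z) = Y z)
    (huY : ∀ᶠ z in 𝓝 z₀, basepoint (u z) = Y z) (v : P) :
    fderiv ℝ (fun z => η.form 0 (w z) (pushD (E := E3) w z v)) z₀ v -
      fderiv ℝ (fun z => η.form 0 (u z) (pushD (E := E3) u z v)) z₀ v =
    (η.form 2 (w z₀) (pushD (E := E3) w z₀ v) - η.form 2 (u z₀) (pushD (E := E3) u z₀ v)) *
      η.form 1 (u z₀) (pushD (E := E3) u z₀ v) := by
  obtain ⟨c, L, hL0, hc, hLs, hL, hLc⟩ := h.exists_fiber_coordinate (u z₀)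
  have hYz : basepoint (u z₀) = Y z₀ := huY.self_of_nhds
  rw [hYz] at hL0 hLs hL
  set r₀ := c (u z₀)
  -- Every lift of `Y` near `u z₀` is `z ↦ Φ (z, r(z))` for a function `r`. The term involving
  -- second derivatives of `Y` is the same for both lifts and cancels in the difference.
  let Φ : P × ℝ → Sig := fun p => L (Y p.1, p.2)
  have hq : ContMDiffAt 𝓘(ℝ, P × ℝ) ((𝓡 2).prod 𝓘(ℝ, ℝ)) ∞ (fun p : P × ℝ => (Y p.1, p.2))
      (z₀, r₀) :=
    (ContMDiffAt.comp (g := Y) (z₀, r₀) hY contDiff_fst.contMDiff.contMDiffAt).prodMk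
      contDiff_snd.contMDiff.contMDiffAt
  have hΦ : ContMDiffAt 𝓘(ℝ, P × ℝ) (𝓡 3) ∞ Φ (z₀, r₀) := hLs.comp (z₀, r₀) hq
  have hΦd := eventually_mdifferentiableAt hΦ
  have hΦY : ∀ᶠ p in 𝓝 (z₀, r₀), basepoint (Φ p) = Y p.1 :=
    (hq.continuousAt.eventually hL).mono fun p hp => hp.1
  -- the fibre direction is vertical
  have hvert : ∀ᶠ p in 𝓝 (z₀, r₀), η.form 0 (Φ p) (pushD (E := E3) Φ p ((0 : P), (1 : ℝ))) = 0 ∧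
      η.form 1 (Φ p) (pushD (E := E3) Φ p ((0 : P), (1 : ℝ))) = 0 := by
    filter_upwards [hΦd, hΦY.eventually_nhds] with p h1 h2
    have hi : HasFDerivAt (fun r : ℝ => (p.1, r)) (ContinuousLinearMap.inr ℝ P ℝ) p.2 :=
      hasFDerivAt_prodMk_right p.1 p.2
    have hic : ContinuousAt (fun r : ℝ => (p.1, r)) p.2 := hi.continuousAt
    have e := pushD_comp (E := E3) (Φ := Φ) (f := fun r : ℝ => (p.1, r)) (z := p.2) h1 hi (1 : ℝ)
    have := h.pushD_vertical (ν := fun r : ℝ => Φ (p.1, r)) (z := p.2) (m := Y p.1)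
      (MDifferentiableAt.comp (g := Φ) p.2 h1 hi.hasMFDerivAt.mdifferentiableAt)
      (hic.eventually h2) (1 : ℝ)
    rw [e] at this
    exact this
  let A : P × ℝ → ℝ := fun p => η.form 0 (Φ p) (pushD (E := E3) Φ p (v, (0 : ℝ)))
  have hA : ContDiffAt ℝ ∞ A (z₀, r₀) := (η.smooth_form 0).contDiffAt_pullback hΦ _
  have hAd := (hA.differentiableAt (by simp)).hasFDerivAt
  -- As `ω₁` vanishes on the fibre direction, the fibre derivative of `A` is `dω₁` on that direction
  -- and `v`, which `dω₁ = ω₃ ∧ ω₂` evaluates.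
  have hA1 : fderiv ℝ A (z₀, r₀) ((0 : P), (1 : ℝ)) =
      η.form 2 (Φ (z₀, r₀)) (pushD (E := E3) Φ (z₀, r₀) ((0 : P), (1 : ℝ))) *
        η.form 1 (Φ (z₀, r₀)) (pushD (E := E3) Φ (z₀, r₀) (v, (0 : ℝ))) := by
    have e1 := (η.smooth_form 0).fderiv_pullback_sub hΦ ((0 : P), (1 : ℝ)) (v, (0 : ℝ))
    have hz : (fun p => η.form 0 (Φ p) (pushD (E := E3) Φ p ((0 : P), (1 : ℝ))))
        =ᶠ[𝓝 (z₀, r₀)] fun _ => 0 := hvert.mono fun p hp => hp.1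
    rw [hz.fderiv_eq, h.canon.d₁, wedge, hvert.self_of_nhds.2, mul_zero, sub_zero] at e1
    simpa using e1
  -- a lift in terms of its fibre coordinate
  have hlift : ∀ x : P → Sig, ContMDiffAt 𝓘(ℝ, P) (𝓡 3) ∞ x z₀ → x z₀ = u z₀ →
      (∀ᶠ z in 𝓝 z₀, basepoint (x z) = Y z) → ∃ k : ℝ,
      fderiv ℝ (fun z => η.form 0 (x z) (pushD (E := E3) x z v)) z₀ v =
        fderiv ℝ A (z₀, r₀) (v, (0 : ℝ)) + k * fderiv ℝ A (z₀, r₀) ((0 : P), (1 : ℝ)) ∧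
      ∀ i, η.form i (x z₀) (pushD (E := E3) x z₀ v) =
        η.form i (Φ (z₀, r₀)) (pushD (E := E3) Φ (z₀, r₀) (v, (0 : ℝ))) +
        k * η.form i (Φ (z₀, r₀)) (pushD (E := E3) Φ (z₀, r₀) ((0 : P), (1 : ℝ))) := by
    intro x hx hxu hxY
    have hcx : ContDiffAt ℝ ∞ (fun z => c (x z)) z₀ := by
      have hc' : ContMDiffAt (𝓡 3) 𝓘(ℝ, ℝ) ∞ c (x z₀) := hxu ▸ hc
      exact (ContMDiffAt.comp z₀ hc' hx).contDiffAt
    have hr : c (x z₀) = r₀ := by rw [hxu]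
    have hjc : ContinuousAt (fun z => (z, c (x z))) z₀ := continuousAt_id.prodMk hcx.continuousAt
    have hj : ∀ᶠ z in 𝓝 z₀, HasFDerivAt (fun z => (z, c (x z)))
        ((ContinuousLinearMap.id ℝ P).prod (fderiv ℝ (fun z => c (x z)) z)) z := by
      have h1 : ContDiffAt ℝ 1 (fun z => c (x z)) z₀ := hcx.of_le (by simp)
      filter_upwards [h1.eventually (by simp)] with z hz
      exact (hasFDerivAt_id z).prodMk (hz.differentiableAt (by simp)).hasFDerivAt
    have hxΦ : x =ᶠ[𝓝 z₀] fun z => Φ (z, c (x z)) := by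
      have hx' : ∀ᶠ w in 𝓝 (x z₀), L (basepoint w, c w) = w := hxu ▸ hLc
      filter_upwards [hx.continuousAt.eventually hx', hxY] with z h1 h2
      rw [h2] at h1
      exact h1.symm
    have hsplit : ∀ᶠ z in 𝓝 z₀, ∀ i, η.form i (x z) (pushD (E := E3) x z v) =
        η.form i (Φ (z, c (x z))) (pushD (E := E3) Φ (z, c (x z)) (v, (0 : ℝ))) +
        fderiv ℝ (fun z => c (x z)) z v *
          η.form i (Φ (z, c (x z))) (pushD (E := E3) Φ (z, c (x z)) ((0 : P), (1 : ℝ))) := by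
      have hΦd' : ∀ᶠ p in 𝓝 (z₀, c (x z₀)), MDifferentiableAt 𝓘(ℝ, P × ℝ) (𝓡 3) Φ p := hr ▸ hΦd
      filter_upwards [hxΦ.eventuallyEq_nhds, hj, hjc.eventually hΦd'] with z h1 h2 h3 i
      refine (form_pushD_congr η i h1 v).trans ?_
      have e := pushD_comp (E := E3) (Φ := Φ) (f := fun z => (z, c (x z))) (z := z) h3 h2 v
      refine (congrArg (η.form i (Φ (z, c (x z)))) e).trans ?_
      have e2 : ((ContinuousLinearMap.id ℝ P).prod (fderiv ℝ (fun z => c (x z)) z)) v =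
          (v, (0 : ℝ)) + fderiv ℝ (fun z => c (x z)) z v • ((0 : P), (1 : ℝ)) := by simp
      rw [e2, map_add, map_smul, map_add, map_smul, smul_eq_mul]
    refine ⟨fderiv ℝ (fun z => c (x z)) z₀ v, ?_, ?_⟩
    · have hvert' : ∀ᶠ p in 𝓝 (z₀, c (x z₀)),
          η.form 0 (Φ p) (pushD (E := E3) Φ p ((0 : P), (1 : ℝ))) = 0 ∧
          η.form 1 (Φ p) (pushD (E := E3) Φ p ((0 : P), (1 : ℝ))) = 0 := hr ▸ hvert
      have hxA : (fun z => η.form 0 (x z) (pushD (E := E3) x z v)) =ᶠ[𝓝 z₀]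
          fun z => A (z, c (x z)) := by
        filter_upwards [hsplit, hjc.eventually hvert'] with z h1 h2
        rw [h1 0, h2.1, mul_zero, add_zero]
      have hAd' : HasFDerivAt A (fderiv ℝ A (z₀, r₀)) ((fun z => (z, c (x z))) z₀) := by
        change HasFDerivAt A _ (z₀, c (x z₀))
        rw [hr]; exact hAd
      have hcomp : HasFDerivAt (fun z => A (z, c (x z))) ((fderiv ℝ A (z₀, r₀)).comp
          ((ContinuousLinearMap.id ℝ P).prod (fderiv ℝ (fun z => c (x z)) z₀))) z₀ :=
        HasFDerivAt.comp (g := A) (f := fun z => (z, c (x z))) z₀ hAd' hj.self_of_nhds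
      rw [hxA.fderiv_eq, hcomp.fderiv]
      have e2 : ((ContinuousLinearMap.id ℝ P).prod (fderiv ℝ (fun z => c (x z)) z₀)) v =
          (v, (0 : ℝ)) + fderiv ℝ (fun z => c (x z)) z₀ v • ((0 : P), (1 : ℝ)) := by simp
      rw [ContinuousLinearMap.comp_apply, e2, map_add, map_smul, smul_eq_mul]
    · intro i
      have := hsplit.self_of_nhds i
      rwa [hr] at this
  obtain ⟨k₁, hw1, hw2⟩ := hlift w hw hwu hwY
  obtain ⟨k₂, hu1, hu2⟩ := hlift u hu rfl huY
  rw [hw1, hu1, hw2, hu2, hu2, hA1, hvert.self_of_nhds.2]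
  ring

/-- Compactness of `Σ` and the absence of short loops give a shortest loop `(t₀, u₀)`. As `sin t₀ ≠
0`, it deforms to loops based at all nearby points, of length `T`; at the minimum of `T` the second
derivative along the normal would be negative. -/
theorem geo_ne [ConnectedSpace M] (u : Sig) {t : ℝ} (ht : t ∈ Ioo 0 Real.pi) :
    basepoint (Ψ t u) ≠ basepoint u := by
  intro hloop
  have := h.compactSpace
  -- a shortest loop
  have hshort : ∀ᶠ s in 𝓝 (0 : ℝ), ∀ u ∈ (univ : Set Sig), s ≠ 0 →
      basepoint (Ψ s u) ≠ basepoint u :=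
    isCompact_univ.eventually_forall_of_forall_eventually fun u _ => h.eventually_geo_ne u
  obtain ⟨δ, hδ, hball⟩ := Metric.eventually_nhds_iff_ball.1 hshort
  have hδt : ∀ (s : ℝ) (u : Sig), 0 < s → basepoint (Ψ s u) = basepoint u → δ ≤ s := by
    intro s u hs hl
    by_contra! hc
    exact hball s (by rw [Real.ball_eq_Ioo]; constructor <;> linarith) u trivial hs.ne' hl
  let B : Set (ℝ × Sig) := (Icc δ t ×ˢ univ) ∩
    {p | basepoint (Ψ p.1 p.2) = basepoint p.2}
  have hBc : IsCompact B := (isCompact_Icc.prod isCompact_univ).inter_right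
    (isClosed_eq h.continuous_geo (continuous_basepoint.comp continuous_snd))
  obtain ⟨⟨t₀, u₀⟩, ⟨⟨ht₀, -⟩, hl₀⟩, hmin⟩ := hBc.exists_isMinOn
    ⟨(t, u), ⟨⟨hδt t u ht.1 hloop, le_rfl⟩, trivial⟩, hloop⟩ continuous_fst.continuousOn
  change basepoint (Ψ t₀ u₀) = basepoint u₀ at hl₀
  have hle : ∀ (s : ℝ) (u : Sig), 0 < s → basepoint (Ψ s u) = basepoint u → t₀ ≤ s := by
    intro s u hs hl
    by_cases hst : s ≤ t
    · exact hmin (show (s, u) ∈ B from ⟨⟨⟨hδt s u hs hl, hst⟩, trivial⟩, hl⟩)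
    · exact ht₀.2.trans (not_le.1 hst).le
  have ht₀' : t₀ ∈ Ioo 0 Real.pi := ⟨hδ.trans_le ht₀.1, ht₀.2.trans_lt ht.2⟩
  have hsin := Real.sin_pos_of_mem_Ioo ht₀'
  -- the loops based at nearby points
  obtain ⟨K, hK0, hKs, hK, -⟩ := h.exists_geodesic_inverse u₀ hsin.ne'
  rw [hl₀] at hK0 hKs hK
  set m := basepoint u₀
  let φ := extChartAt (𝓡 2) m
  let Y : E2 → M := φ.symm
  set z₀ : E2 := φ m
  have hY0 : Y z₀ = m := extChartAt_to_inv m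
  have hY : ContMDiffAt 𝓘(ℝ, E2) (𝓡 2) ∞ Y z₀ :=
    contMDiffAt_extChartAt_symm_target (mem_extChartAt_target m)
  have hq : ContMDiffAt 𝓘(ℝ, E2) ((𝓡 2).prod (𝓡 2)) ∞ (fun z => (Y z, Y z)) z₀ := hY.prodMk hY
  have hKs' : ContMDiffAt ((𝓡 2).prod (𝓡 2)) (𝓘(ℝ, ℝ).prod (𝓡 3)) ∞ K (Y z₀, Y z₀) := by
    rw [hY0]; exact hKs
  have hK' : ∀ᶠ q in 𝓝 (Y z₀, Y z₀), basepoint (K q).2 = q.1 ∧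
      basepoint (Ψ (K q).1 (K q).2) = q.2 := by rw [hY0]; exact hK
  have hKq : ContMDiffAt 𝓘(ℝ, E2) (𝓘(ℝ, ℝ).prod (𝓡 3)) ∞ (fun z => K (Y z, Y z)) z₀ :=
    ContMDiffAt.comp (g := K) z₀ hKs' hq
  let T : E2 → ℝ := fun z => (K (Y z, Y z)).1
  let U : E2 → Sig := fun z => (K (Y z, Y z)).2
  let W : E2 → Sig := fun z => Ψ (T z) (U z)
  have hT0 : T z₀ = t₀ := by simp only [T, hY0, hK0]
  have hU0 : U z₀ = u₀ := by simp only [U, hY0, hK0]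
  have hT : ContDiffAt ℝ ∞ T z₀ := (contMDiffAt_fst.comp z₀ hKq).contDiffAt
  have hU : ContMDiffAt 𝓘(ℝ, E2) (𝓡 3) ∞ U z₀ := contMDiffAt_snd.comp z₀ hKq
  have hW : ContMDiffAt 𝓘(ℝ, E2) (𝓡 3) ∞ W z₀ := h.flow.contMDiffAt_comp hT hU
  have hUY : ∀ᶠ z in 𝓝 z₀, basepoint (U z) = Y z :=
    (hq.continuousAt.eventually hK').mono fun z hz => hz.1
  have hWY : ∀ᶠ z in 𝓝 z₀, basepoint (W z) = Y z :=
    (hq.continuousAt.eventually hK').mono fun z hz => hz.2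
  have hTmin : IsLocalMin T z₀ := by
    have hpos : ∀ᶠ z in 𝓝 z₀, 0 < T z :=
      hT.continuousAt.eventually_const_lt (hT0.symm ▸ ht₀'.1)
    filter_upwards [hUY, hWY, hpos] with z h1 h2 h3
    rw [hT0]
    exact hle (T z) (U z) h3 (h2.trans h1.symm)
  have hTd : ∀ᶠ z in 𝓝 z₀, DifferentiableAt ℝ T z := by
    have h1 : ContDiffAt ℝ 1 T z₀ := hT.of_le (by simp)
    exact (h1.eventually (by simp)).mono fun z hz => hz.differentiableAt (by simp)
  -- first variation
  have hfirst : ∀ᶠ z in 𝓝 z₀, ∀ v, fderiv ℝ T z v =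
      η.form 0 (W z) (pushD (E := E3) W z v) - η.form 0 (U z) (pushD (E := E3) U z v) := by
    filter_upwards [hTd, eventually_mdifferentiableAt hU] with z h1 h2 v
    have e := h.flow.pushD_comp h1.hasFDerivAt h2 v
    have e2 := congrArg (η.form 0 (W z)) e
    rw [map_add, map_smul, η.form_dual, (h.flow.form_mfderiv _ _ _).1] at e2
    rw [e2]
    simp
  have hbW : ∀ v, basepointD (W z₀) (pushD (E := E3) W z₀ v) = v := fun v => by
    have e1 := h.pushD_basepoint (hW.mdifferentiableAt (by simp)) v
    have e2 : mfderiv 𝓘(ℝ, E2) (𝓡 2) (fun z => basepoint (W z)) z₀ =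
      mfderiv 𝓘(ℝ, E2) (𝓡 2) Y z₀ := Filter.EventuallyEq.mfderiv_eq hWY
    exact e1.symm.trans ((congrArg (fun L : E2 →L[ℝ] E2 => L v) e2).trans
      (pushD_extChartAt_symm_self m v))
  have hbU : ∀ v, basepointD (U z₀) (pushD (E := E3) U z₀ v) = v := fun v => by
    have e1 := h.pushD_basepoint (hU.mdifferentiableAt (by simp)) v
    have e2 : mfderiv 𝓘(ℝ, E2) (𝓡 2) (fun z => basepoint (U z)) z₀ =
      mfderiv 𝓘(ℝ, E2) (𝓡 2) Y z₀ := Filter.EventuallyEq.mfderiv_eq hUY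
    exact e1.symm.trans ((congrArg (fun L : E2 →L[ℝ] E2 => L v) e2).trans
      (pushD_extChartAt_symm_self m v))
  -- The first variation is `λ` at arrival minus `λ` at departure. Where it vanishes the two
  -- covectors agree, and hence so do the velocities: a shortest loop is a closed geodesic.
  have hWU : W z₀ = U z₀ := by
    refine h.eq_of_covec_eq (hWY.self_of_nhds.trans hUY.self_of_nhds.symm) ?_
    ext1 v
    have e1 : covec2 η (W z₀) v = η.form 0 (W z₀) (pushD (E := E3) W z₀ v) :=
      (congrArg (covec2 η (W z₀)) (hbW v)).symm.trans (h.canon.covec_basepointD _ _)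
    have e2 : covec2 η (U z₀) v = η.form 0 (U z₀) (pushD (E := E3) U z₀ v) :=
      (congrArg (covec2 η (U z₀)) (hbU v)).symm.trans (h.canon.covec_basepointD _ _)
    have e3 := hfirst.self_of_nhds v
    rw [hTmin.fderiv_eq_zero] at e3
    rw [e1, e2]
    exact (sub_eq_zero.1 e3.symm)
  -- second variation in the normal direction
  let v : E2 := (normal η (U z₀) : E2)
  have hn : ∀ p : Sig, p = U z₀ → ∀ V : TangentSpace (𝓡 3) p, (basepointD p V : E2) = v →
      η.form 1 p V = 1 := by
    rintro _ rfl V hV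
    have e1 : basepointD (U z₀) (V - η.dual 1 (U z₀)) = 0 := by
      rw [map_sub, sub_eq_zero]; exact hV
    rw [h.canon.basepointD_apply] at e1
    have := (h.canon.eq_zero_of_smul_add_smul e1).2
    rw [map_sub, η.form_dual, if_pos rfl, sub_eq_zero] at this
    exact this
  have hW1 := hn _ hWU _ (hbW v)
  have hU1 := hn _ rfl _ (hbU v)
  have e := h.flow.pushD_comp (hT.differentiableAt (by simp)).hasFDerivAt
    (hU.mdifferentiableAt (by simp)) v
  have eW1 := congrArg (η.form 1 (W z₀)) e
  have eW2 := congrArg (η.form 2 (W z₀)) e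
  obtain ⟨-, r1, r2⟩ := h.flow.form_mfderiv (T z₀) (U z₀) (pushD (E := E3) U z₀ v)
  rw [map_add, map_smul, η.form_dual, r1, hT0, hU1] at eW1
  rw [map_add, map_smul, η.form_dual, r2, hT0, hU1] at eW2
  have eW1' := hW1.symm.trans eW1
  simp only [Fin.isValue, one_ne_zero, ↓reduceIte, smul_eq_mul, mul_zero, mul_one, zero_add,
    Fin.reduceEq] at eW1' eW2
  set U3 := η.form 2 (U z₀) (pushD (E := E3) U z₀ v)
  have hsecond := h.fderiv_form_zero_sub hY hW hU hWU hWY hUY v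
  rw [hU1, mul_one] at hsecond
  have hWc := (((η.smooth_form 0).contDiffAt_pullback hW v).differentiableAt
    (by simp)).hasFDerivAt
  have hUc := (((η.smooth_form 0).contDiffAt_pullback hU v).differentiableAt
    (by simp)).hasFDerivAt
  have hG : HasFDerivAt (fun z => fderiv ℝ T z v) _ z₀ :=
    (hWc.sub hUc).congr_of_eventuallyEq (hfirst.mono fun z hz => hz v)
  -- restrict to a line
  have hline : HasDerivAt (fun s : ℝ => z₀ + s • v) v 0 := by
    simpa using ((hasDerivAt_id (0 : ℝ)).smul_const v).const_add z₀
  have hline' : ∀ s : ℝ, HasDerivAt (fun s : ℝ => z₀ + s • v) v s := fun s => by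
    simpa using ((hasDerivAt_id s).smul_const v).const_add z₀
  have hl0 : z₀ + (0 : ℝ) • v = z₀ := by simp
  let f : ℝ → ℝ := fun s => T (z₀ + s • v)
  have hfmin : IsLocalMin f 0 := by
    have hT' : ∀ᶠ z in 𝓝 (z₀ + (0 : ℝ) • v), T z₀ ≤ T z := by rw [hl0]; exact hTmin
    filter_upwards [hline.continuousAt.eventually hT'] with s hs
    change T (z₀ + (0 : ℝ) • v) ≤ _
    rw [hl0]; exact hs
  have hfd : deriv f =ᶠ[𝓝 0] fun s => fderiv ℝ T (z₀ + s • v) v := by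
    have hT' : ∀ᶠ z in 𝓝 (z₀ + (0 : ℝ) • v), DifferentiableAt ℝ T z := by rw [hl0]; exact hTd
    filter_upwards [hline.continuousAt.eventually hT'] with s hs
    exact (hs.hasFDerivAt.comp_hasDerivAt s (hline' s)).deriv
  have hfc : ContinuousAt f 0 := by
    refine ContinuousAt.comp (g := T) ?_ hline.continuousAt
    rw [hl0]; exact hT.continuousAt
  refine IsLocalMin.not_deriv_deriv_neg hfmin hfc ?_
  have hG' : HasFDerivAt (fun z => fderiv ℝ T z v) (fderiv ℝ (fun z => fderiv ℝ T z v) z₀)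
      (z₀ + (0 : ℝ) • v) := by
    rw [hl0]; exact hG.differentiableAt.hasFDerivAt
  rw [hfd.deriv_eq]
  have hder := (hG'.comp_hasDerivAt (0 : ℝ) hline).deriv
  refine lt_of_eq_of_lt hder ?_
  rw [hG.fderiv, ContinuousLinearMap.sub_apply]
  refine lt_of_eq_of_lt hsecond ?_
  have eW2' : η.form 2 (W z₀) (pushD (E := E3) W z₀ v) = -Real.sin t₀ + Real.cos t₀ * U3 := eW2
  rw [eW2']
  have hcos : Real.cos t₀ ≤ 1 := Real.cos_le_one t₀
  -- From `cos t₀ + sin t₀ · U3 = 1` one gets `U3 ≥ 0`. The second variation is `-sin t₀ + (cos t₀ -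
  -- 1) · U3`, which is therefore negative.
  have hU3 : 0 ≤ U3 := by
    by_contra! hneg
    nlinarith
  nlinarith

end IsUnitSurface

end Surface

/-! ## Injectivity of the exponential map -/

section Surface

variable {M : Type*} [TopologicalSpace M] [T2Space M]
  [ChartedSpace (EuclideanSpace ℝ (Fin 2)) M] [IsManifold (𝓡 2) ∞ M]
  {Sig : Set (TangentBundle (𝓡 2) M)}
  [ChartedSpace (EuclideanSpace ℝ (Fin 3)) Sig] [IsManifold (𝓡 3) ∞ Sig]
  {o : ∀ x : M, Orientation ℝ (TangentSpace (𝓡 2) x) (Fin 2)} {η : Coframing Sig}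
  {Ψ : ℝ → Sig → Sig}

namespace IsUnitSurface

variable (h : IsUnitSurface o η Ψ)
include h

/-- The length of the geodesic from a fixed point to `y`, near a nonconjugate point, and its
differential. -/
theorem exists_distance (u : Sig) {t : ℝ} (ht : Real.sin t ≠ 0) :
    ∃ (T : M → ℝ) (U : M → Sig), T (basepoint (Ψ t u)) = t ∧ U (basepoint (Ψ t u)) = u ∧
      ContMDiffAt (𝓡 2) 𝓘(ℝ, ℝ) ∞ T (basepoint (Ψ t u)) ∧
      (∀ᶠ y in 𝓝 (basepoint (Ψ t u)), basepoint (U y) = basepoint u ∧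
        basepoint (Ψ (T y) (U y)) = y) ∧
      ∀ (c : ℝ → M) (s : ℝ), c s = basepoint (Ψ t u) →
        MDifferentiableAt 𝓘(ℝ, ℝ) (𝓡 2) c s →
        HasDerivAt (fun s => T (c s)) (covec2 η (Ψ t u) (pushD (E := E2) c s (1 : ℝ))) s := by
  obtain ⟨K, hK0, hKs, hK, -⟩ := h.exists_geodesic_inverse u ht
  set y₀ := basepoint (Ψ t u)
  have hcm : ContMDiffAt (𝓡 2) ((𝓡 2).prod (𝓡 2)) ∞ (fun y : M => (basepoint u, y)) y₀ :=
    contMDiffAt_const.prodMk contMDiffAt_id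
  have hKc : ContMDiffAt (𝓡 2) (𝓘(ℝ, ℝ).prod (𝓡 3)) ∞ (fun y => K (basepoint u, y)) y₀ :=
    ContMDiffAt.comp (g := K) y₀ hKs hcm
  let T : M → ℝ := fun y => (K (basepoint u, y)).1
  let U : M → Sig := fun y => (K (basepoint u, y)).2
  have hT0 : T y₀ = t := by simp only [T, hK0]
  have hU0 : U y₀ = u := by simp only [U, hK0]
  have hT : ContMDiffAt (𝓡 2) 𝓘(ℝ, ℝ) ∞ T y₀ := contMDiffAt_fst.comp y₀ hKc
  have hU : ContMDiffAt (𝓡 2) (𝓡 3) ∞ U y₀ := contMDiffAt_snd.comp y₀ hKc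
  have hev : ∀ᶠ y in 𝓝 y₀, basepoint (U y) = basepoint u ∧ basepoint (Ψ (T y) (U y)) = y :=
    hcm.continuousAt.eventually hK
  refine ⟨T, U, hT0, hU0, hT, hev, fun c s hcs hc => ?_⟩
  have hTc : MDifferentiableAt (𝓡 2) 𝓘(ℝ, ℝ) T (c s) := by
    rw [hcs]; exact hT.mdifferentiableAt (by simp)
  have hUc : MDifferentiableAt (𝓡 2) (𝓡 3) U (c s) := by
    rw [hcs]; exact hU.mdifferentiableAt (by simp)
  have hTd : DifferentiableAt ℝ (fun s => T (c s)) s :=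
    mdifferentiableAt_iff_differentiableAt.1 (hTc.comp s hc)
  have hUd : MDifferentiableAt 𝓘(ℝ, ℝ) (𝓡 3) (fun s => U (c s)) s := hUc.comp s hc
  have hev' : ∀ᶠ s' in 𝓝 s, basepoint (U (c s')) = basepoint u ∧
      basepoint (Ψ (T (c s')) (U (c s'))) = c s' := by
    have hev2 : ∀ᶠ y in 𝓝 (c s), basepoint (U y) = basepoint u ∧
        basepoint (Ψ (T y) (U y)) = y := by rw [hcs]; exact hev
    exact hc.continuousAt.eventually hev2
  have e1 := h.pushD_geo hTd.hasFDerivAt hUd (1 : ℝ)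
  obtain ⟨a, b⟩ := h.pushD_vertical hUd (hev'.mono fun s hs => hs.1) (1 : ℝ)
  rw [a, add_zero] at e1
  have e2 : mfderiv 𝓘(ℝ, ℝ) (𝓡 2) (fun s => basepoint (Ψ (T (c s)) (U (c s)))) s =
      mfderiv 𝓘(ℝ, ℝ) (𝓡 2) c s :=
    Filter.EventuallyEq.mfderiv_eq (hev'.mono fun s hs => hs.2)
  -- The first variation formula: the starting point is fixed, and `λ` is `1` on the geodesic
  -- direction and `0` on the normal.
  have e3 : covec2 η (Ψ (T (c s)) (U (c s))) (pushD (E := E2) c s (1 : ℝ)) =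
      deriv (fun s => T (c s)) s := by
    have e4 : (pushD (E := E2) c s (1 : ℝ) : E2) = pushD (E := E2)
        (fun s => basepoint (Ψ (T (c s)) (U (c s)))) s (1 : ℝ) :=
      (congrArg (fun L : ℝ →L[ℝ] E2 => L (1 : ℝ)) e2).symm
    refine (congrArg (covec2 η (Ψ (T (c s)) (U (c s)))) (e4.trans e1)).trans ?_
    refine (map_add (covec η (Ψ (T (c s)) (U (c s)))) _ _).trans ?_
    rw [map_smul, map_smul, h.canon.covec_vec, h.canon.covec_normal]
    simp
  rw [hcs, hT0, hU0] at e3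
  exact hTd.hasDerivAt.congr_deriv e3.symm

theorem flow_neg_flow (t : ℝ) (u : Sig) : Ψ (-t) (Ψ t u) = u := by
  rw [← h.flow.add, neg_add_cancel, h.flow.zero]

/-- If the difference of the lengths of two geodesics from `m` to `y` is locally maximal, then
they arrive with the same velocity. -/
theorem flow_eq_of_isMax {u₁ u₂ : Sig} (hb : basepoint u₁ = basepoint u₂) {t₁ t₂ : ℝ}
    (h₁ : t₁ ∈ Ioo 0 Real.pi) (h₂ : t₂ ∈ Ioo 0 Real.pi)
    (heq : basepoint (Ψ t₁ u₁) = basepoint (Ψ t₂ u₂))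
    (hmax : ∀ (s₁ s₂ : ℝ) (w₁ w₂ : Sig), s₁ ∈ Icc 0 Real.pi → s₂ ∈ Icc 0 Real.pi →
      basepoint w₁ = basepoint u₁ → basepoint w₂ = basepoint u₁ →
      basepoint (Ψ s₁ w₁) = basepoint (Ψ s₂ w₂) → s₁ - s₂ ≤ t₁ - t₂) :
    Ψ t₁ u₁ = Ψ t₂ u₂ := by
  obtain ⟨T₁, U₁, hT1, hU1, hTs1, hev1, hd1⟩ :=
    h.exists_distance u₁ (Real.sin_pos_of_mem_Ioo h₁).ne'
  obtain ⟨T₂, U₂, hT2, hU2, hTs2, hev2, hd2⟩ :=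
    h.exists_distance u₂ (Real.sin_pos_of_mem_Ioo h₂).ne'
  rw [← heq] at hT2 hTs2 hev2 hd2
  set y₀ := basepoint (Ψ t₁ u₁)
  have hloc : ∀ᶠ y in 𝓝 y₀, T₁ y - T₂ y ≤ t₁ - t₂ := by
    have hI1 : ∀ᶠ y in 𝓝 y₀, T₁ y ∈ Icc 0 Real.pi :=
      hTs1.continuousAt.eventually (hT1.symm ▸ Icc_mem_nhds h₁.1 h₁.2)
    have hI2 : ∀ᶠ y in 𝓝 y₀, T₂ y ∈ Icc 0 Real.pi :=
      hTs2.continuousAt.eventually (hT2.symm ▸ Icc_mem_nhds h₂.1 h₂.2)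
    filter_upwards [hI1, hI2, hev1, hev2] with y a1 a2 a3 a4
    exact hmax _ _ _ _ a1 a2 a3.1 (a4.1.trans hb.symm) (a3.2.trans a4.2.symm)
  refine h.eq_of_covec_eq heq ?_
  ext1 v
  let φ := extChartAt (𝓡 2) y₀
  let c : ℝ → M := fun s => φ.symm (φ y₀ + s • v)
  have hline : HasFDerivAt (fun s : ℝ => φ y₀ + s • v)
      ((ContinuousLinearMap.id ℝ ℝ).smulRight v) 0 := by
    have : HasFDerivAt (fun s : ℝ => s • v) ((ContinuousLinearMap.id ℝ ℝ).smulRight v) 0 :=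
      ((ContinuousLinearMap.id ℝ ℝ).smulRight v).hasFDerivAt
    exact this.const_add _
  have hl0 : φ y₀ + (0 : ℝ) • v = φ y₀ := by simp
  have hc0 : c 0 = y₀ := by
    change φ.symm (φ y₀ + (0 : ℝ) • v) = y₀
    rw [hl0]; exact extChartAt_to_inv y₀
  have hsymm : MDifferentiableAt 𝓘(ℝ, E2) (𝓡 2) φ.symm (φ y₀ + (0 : ℝ) • v) := by
    rw [hl0]
    exact (contMDiffAt_extChartAt_symm_target (E := E2)
      (mem_extChartAt_target y₀)).mdifferentiableAt (by simp)
  have hcd : MDifferentiableAt 𝓘(ℝ, ℝ) (𝓡 2) c 0 :=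
    MDifferentiableAt.comp (g := φ.symm) (0 : ℝ) hsymm hline.hasMFDerivAt.mdifferentiableAt
  have hcv : (pushD (E := E2) c 0 (1 : ℝ) : E2) = v := by
    have e1 := pushD_comp (E := E2) (Φ := φ.symm) (f := fun s : ℝ => φ y₀ + s • v) (z := 0)
      hsymm hline (1 : ℝ)
    refine Eq.trans e1 ?_
    have e2 : ((ContinuousLinearMap.id ℝ ℝ).smulRight v) (1 : ℝ) = v := by simp
    rw [e2]
    have key : ∀ z : E2, z = φ y₀ → (pushD (E := E2) φ.symm z v : E2) = v := by
      rintro _ rfl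
      exact pushD_extChartAt_symm_self y₀ v
    exact key _ hl0
  have hD := (hd1 c 0 hc0 hcd).sub (hd2 c 0 hc0 hcd)
  have hlm : IsLocalMax (fun s => T₁ (c s) - T₂ (c s)) 0 := by
    have : ∀ᶠ y in 𝓝 (c 0), T₁ y - T₂ y ≤ t₁ - t₂ := by rw [hc0]; exact hloc
    filter_upwards [hcd.continuousAt.eventually this] with s hs
    change _ ≤ T₁ (c 0) - T₂ (c 0)
    rw [hc0, hT1, hT2]
    exact hs
  have := hlm.hasDerivAt_eq_zero hD
  rw [hcv] at this
  exact sub_eq_zero.1 this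

/-- If the geodesics from a point do not return to it at time `π`, they do not meet before. -/
theorem injective_of_antipode_ne [ConnectedSpace M] {m : M}
    (ha : ∀ u : Sig, basepoint u = m → basepoint (Ψ Real.pi u) ≠ m) {u₁ u₂ : Sig} {t₁ t₂ : ℝ}
    (hu₁ : basepoint u₁ = m) (hu₂ : basepoint u₂ = m)
    (h₁ : t₁ ∈ Ioo 0 Real.pi) (h₂ : t₂ ∈ Ioo 0 Real.pi)
    (heq : basepoint (Ψ t₁ u₁) = basepoint (Ψ t₂ u₂)) : t₁ = t₂ ∧ u₁ = u₂ := by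
  have hle : ∀ (s₁ s₂ : ℝ) (w₁ w₂ : Sig), s₁ ∈ Icc 0 Real.pi → s₂ ∈ Icc 0 Real.pi →
      basepoint w₁ = m → basepoint w₂ = m →
      basepoint (Ψ s₁ w₁) = basepoint (Ψ s₂ w₂) → s₁ - s₂ ≤ 0 := by
    let A : Set (ℝ × Sig) := Icc 0 Real.pi ×ˢ {u | basepoint u = m}
    have hA : IsCompact A := isCompact_Icc.prod (h.isCompact_fiber m)
    let Q : Set ((ℝ × Sig) × (ℝ × Sig)) := (A ×ˢ A) ∩
      {p | basepoint (Ψ p.1.1 p.1.2) = basepoint (Ψ p.2.1 p.2.2)}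
    have hQ : IsCompact Q := (hA.prod hA).inter_right
      (isClosed_eq (h.continuous_geo.comp continuous_fst) (h.continuous_geo.comp continuous_snd))
    obtain ⟨⟨⟨s₁, w₁⟩, ⟨s₂, w₂⟩⟩, ⟨⟨⟨hs₁, hw₁⟩, ⟨hs₂, hw₂⟩⟩, hse⟩, hmax⟩ := hQ.exists_isMaxOn
      (f := fun p => p.1.1 - p.2.1)
      ⟨((t₁, u₁), (t₂, u₂)), ⟨⟨⟨⟨h₁.1.le, h₁.2.le⟩, hu₁⟩, ⟨⟨h₂.1.le, h₂.2.le⟩, hu₂⟩⟩, heq⟩⟩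
      (by fun_prop)
    change basepoint (Ψ s₁ w₁) = basepoint (Ψ s₂ w₂) at hse
    change basepoint w₁ = m at hw₁
    change basepoint w₂ = m at hw₂
    have hmax' : ∀ (r₁ r₂ : ℝ) (v₁ v₂ : Sig), r₁ ∈ Icc 0 Real.pi → r₂ ∈ Icc 0 Real.pi →
        basepoint v₁ = m → basepoint v₂ = m →
        basepoint (Ψ r₁ v₁) = basepoint (Ψ r₂ v₂) → r₁ - r₂ ≤ s₁ - s₂ :=
      fun r₁ r₂ v₁ v₂ hr₁ hr₂ hv₁ hv₂ he =>
        hmax (show ((r₁, v₁), (r₂, v₂)) ∈ Q from ⟨⟨⟨hr₁, hv₁⟩, ⟨hr₂, hv₂⟩⟩, he⟩)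
    suffices hs : s₁ ≤ s₂ from fun r₁ r₂ v₁ v₂ hr₁ hr₂ hv₁ hv₂ he =>
      (hmax' r₁ r₂ v₁ v₂ hr₁ hr₂ hv₁ hv₂ he).trans (sub_nonpos.2 hs)
    -- If the maximal difference `s₁ - s₂` is positive, every case is impossible. For `s₂ = 0` there
    -- is a loop at `m`, or a return at time `π`. For `s₁ = π` the second geodesic has already
    -- reached the antipode and loops there after a further `π - s₂`. Otherwise the arrival
    -- velocities agree, and flowing back gives a loop at `m` of length `s₁ - s₂`.
    by_contra! hlt
    have hs₁0 : 0 < s₁ := hs₂.1.trans_lt hlt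
    rcases hs₂.1.eq_or_lt with h0 | hs₂0
    · have h0' : (0 : ℝ) = s₂ := h0
      rw [← h0', h.flow.zero, hw₂] at hse
      rcases hs₁.2.eq_or_lt with hπ | hπ
      · have hπ' : s₁ = Real.pi := hπ
        exact ha w₁ hw₁ (hπ' ▸ hse)
      · exact h.geo_ne w₁ ⟨hs₁0, hπ⟩ (hse.trans hw₁.symm)
    · have hs₂0' : 0 < s₂ := hs₂0
      rcases hs₁.2.eq_or_lt with hπ | hπ
      · have hπ' : s₁ = Real.pi := hπ
        refine h.geo_ne (Ψ s₂ w₂) (t := Real.pi - s₂) ⟨by linarith, by linarith⟩ ?_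
        rw [← h.flow.add, sub_add_cancel, ← hse, hπ']
        exact h.antipode_eq (hw₂.trans hw₁.symm)
      · have hΨ := h.flow_eq_of_isMax (hw₁.trans hw₂.symm) ⟨hs₁0, hπ⟩
          ⟨hs₂0', hlt.trans hπ⟩ hse (fun r₁ r₂ v₁ v₂ hr₁ hr₂ hv₁ hv₂ he =>
            hmax' r₁ r₂ v₁ v₂ hr₁ hr₂ (hv₁.trans hw₁) (hv₂.trans hw₁) he)
        have e := h.flow_neg_flow s₂ w₂
        rw [← hΨ, ← h.flow.add] at e
        have hπ' : s₁ < Real.pi := hπ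
        refine h.geo_ne w₁ (t := -s₂ + s₁) ⟨by linarith, by linarith⟩ ?_
        rw [e, hw₁, hw₂]
  have ht : t₁ = t₂ := by
    have a := hle t₁ t₂ u₁ u₂ ⟨h₁.1.le, h₁.2.le⟩ ⟨h₂.1.le, h₂.2.le⟩ hu₁ hu₂ heq
    have b := hle t₂ t₁ u₂ u₁ ⟨h₂.1.le, h₂.2.le⟩ ⟨h₁.1.le, h₁.2.le⟩ hu₂ hu₁ heq.symm
    linarith
  refine ⟨ht, ?_⟩
  -- All differences of lengths are now at most `0`, so the given pair is itself a maximum.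
  have hΨ := h.flow_eq_of_isMax (hu₁.trans hu₂.symm) h₁ h₂ heq
    (fun r₁ r₂ v₁ v₂ hr₁ hr₂ hv₁ hv₂ he => by
      rw [ht, sub_self]
      exact hle r₁ r₂ v₁ v₂ hr₁ hr₂ (hv₁.trans hu₁) (hv₂.trans hu₁) he)
  have e := h.flow_neg_flow t₂ u₂
  rw [← hΨ, ← ht, h.flow_neg_flow] at e
  exact e

/-- The antipodal map is not the identity near any point. -/
theorem exists_antipode_ne (m : M) {V : Set M} (hV : V ∈ 𝓝 m) :
    ∃ x ∈ V, ∀ u : Sig, basepoint u = x → basepoint (Ψ Real.pi u) ≠ x := by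
  by_contra! hc
  obtain ⟨u, rfl⟩ := h.finsler.surjective m
  have hev : (fun w : Sig => basepoint (Ψ Real.pi w)) =ᶠ[𝓝 u] (basepoint : Sig → M) := by
    filter_upwards [continuous_basepoint.continuousAt.eventually hV] with w hw
    obtain ⟨v, hv1, hv2⟩ := hc _ hw
    rw [← hv2]
    exact (h.antipode_eq hv1).symm.trans (hv2.trans hv2.symm) |>.trans rfl
  -- If the antipodal map is the identity near the basepoint, comparing differentials on `X₁` gives
  -- `Ψ_π u = u`, and on `X₂` it gives `-n = n`.
  have hd : ∀ V : TangentSpace (𝓡 3) u, (η.form 0 u V • vec (Ψ Real.pi u) +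
      (Real.cos Real.pi * η.form 1 u V + Real.sin Real.pi * η.form 2 u V) •
        normal η (Ψ Real.pi u) : E2) = basepointD u V := fun V =>
    (h.mfderiv_geo_time Real.pi u V).symm.trans
      (congrArg (fun L : E3 →L[ℝ] E2 => L V) hev.mfderiv_eq)
  have h0 := hd (η.dual 0 u)
  have h1 := hd (η.dual 1 u)
  rw [h.canon.basepointD_apply] at h0 h1
  simp only [η.form_dual] at h0 h1
  simp only [Fin.isValue, ↓reduceIte, one_smul, Real.cos_pi, one_ne_zero, zero_ne_one, mul_zero, Real.sin_pi,
    Fin.reduceEq, add_zero, zero_smul, mul_one, zero_add, neg_smul] at h0 h1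
  have hΨ : Ψ Real.pi u = u := eq_of_vec_eq hev.eq_of_nhds h0
  have key : ∀ w : Sig, w = u → (-normal η w : E2) = (normal η u : E2) → False := by
    intro w hw he
    subst hw
    have hz : normal η w + normal η w = 0 := neg_eq_iff_add_eq_zero.1 he
    have := (h.canon.eq_zero_of_smul_add_smul (u := w) (x := 0) (y := 2)
      (by rw [zero_smul, zero_add, two_smul, hz])).2
    exact two_ne_zero this
  exact key _ hΨ h1

/-- Suppose `m` is its own antipode. Then a small punctured neighbourhood of `m` is covered by the
points reached before time `π/2` and those reached after it. Both sets are open and both occur near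
`m`, so by connectedness some point is reached at two different times. -/
theorem antipode_ne [ConnectedSpace M] (u₀ : Sig) : basepoint (Ψ Real.pi u₀) ≠ basepoint u₀ := by
  intro ha
  set m := basepoint u₀ with hm
  have ha' : ∀ u : Sig, basepoint u = m → basepoint (Ψ Real.pi u) = m := fun u hu =>
    (h.antipode_eq (hu.trans hm)).trans ha
  -- injectivity at `m`, by approximation
  have hinj : ∀ (u₁ u₂ : Sig) (t₁ t₂ : ℝ), basepoint u₁ = m → basepoint u₂ = m →
      t₁ ∈ Ioo 0 Real.pi → t₂ ∈ Ioo 0 Real.pi →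
      basepoint (Ψ t₁ u₁) = basepoint (Ψ t₂ u₂) → t₁ = t₂ := by
    intro u₁ u₂ t₁ t₂ hu₁ hu₂ h₁ h₂ heq
    -- Two geodesics from `m` to `y` of different lengths persist when `m` moves to a nearby `x`
    -- that is not its own antipode, where `injective_of_antipode_ne` forbids them.
    by_contra hne
    obtain ⟨K₁, hK01, hKs1, hK1, -⟩ :=
      h.exists_geodesic_inverse u₁ (Real.sin_pos_of_mem_Ioo h₁).ne'
    obtain ⟨K₂, hK02, hKs2, hK2, -⟩ :=
      h.exists_geodesic_inverse u₂ (Real.sin_pos_of_mem_Ioo h₂).ne'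
    rw [← heq, hu₂] at hK02 hKs2 hK2
    rw [hu₁] at hK01 hKs1 hK1
    set y := basepoint (Ψ t₁ u₁)
    have hcm : ContinuousAt (fun x : M => (x, y)) m := by fun_prop
    have hc1 : ContinuousAt (fun x : M => (K₁ (x, y)).1) m :=
      continuousAt_fst.comp (ContinuousAt.comp (g := K₁) hKs1.continuousAt hcm)
    have hc2 : ContinuousAt (fun x : M => (K₂ (x, y)).1) m :=
      continuousAt_fst.comp (ContinuousAt.comp (g := K₂) hKs2.continuousAt hcm)
    have hn1 : Ioo 0 Real.pi ∈ 𝓝 (K₁ (m, y)).1 := by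
      rw [hK01]; exact Ioo_mem_nhds h₁.1 h₁.2
    have hn2 : Ioo 0 Real.pi ∈ 𝓝 (K₂ (m, y)).1 := by
      rw [hK02]; exact Ioo_mem_nhds h₂.1 h₂.2
    have hne' : ∀ᶠ x in 𝓝 m, (K₁ (x, y)).1 ≠ (K₂ (x, y)).1 := by
      refine ((hc1.sub hc2).eventually_ne (y := 0) ?_).mono fun x hx => sub_ne_zero.1 hx
      change (K₁ (m, y)).1 - (K₂ (m, y)).1 ≠ 0
      rw [hK01, hK02]; exact sub_ne_zero.2 hne
    obtain ⟨x, ⟨⟨⟨⟨⟨a1, a2⟩, a3⟩, a4⟩, a5⟩, a6⟩, a7⟩ := h.exists_antipode_ne m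
      (((((hc1.eventually hn1).and (hc2.eventually hn2)).and hne').and
        (hcm.eventually hK1)).and (hcm.eventually hK2)|>.and (Eventually.of_forall fun _ => trivial))
    exact a3 (h.injective_of_antipode_ne a7 a4.1 a5.1 a1 a2 (a4.2.trans a5.2.symm)).1
  have hπ := Real.pi_pos
  -- the two halves
  let R : Set ℝ → Set M := fun J => {y | ∃ u : Sig, basepoint u = m ∧ ∃ t ∈ J,
    basepoint (Ψ t u) = y}
  have hRo : ∀ J : Set ℝ, IsOpen J → J ⊆ Ioo 0 Real.pi → IsOpen (R J) := by
    intro J hJ hJs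
    rw [isOpen_iff_mem_nhds]
    rintro _ ⟨u, hu, t, ht, rfl⟩
    filter_upwards [h.eventually_exists_geo (u := u) (Real.sin_pos_of_mem_Ioo (hJs ht)).ne'
      (hJ.mem_nhds ht)] with y ⟨w, hw, s, hs, hy⟩
    exact ⟨w, hw.trans hu, s, hs, hy⟩
  let C : Set M := (fun u => basepoint (Ψ (Real.pi / 2) u)) '' {u : Sig | basepoint u = m}
  have hC : IsClosed C := ((h.isCompact_fiber m).image (h.contMDiff_geo_time _).continuous).isClosed
  have hmC : m ∉ C := by
    rintro ⟨u, hu, hum⟩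
    exact h.geo_ne u (t := Real.pi / 2) ⟨by linarith, by linarith⟩ (hum.trans hu.symm)
  -- The neighbourhood avoids the points at time `π/2`, a compact set missing `m`, so that time
  -- `π/2` separates the two kinds of points.
  obtain ⟨U, hUC, hUm, hUp, -⟩ := exists_nhds_isPreconnected_diff m Cᶜ
    (hC.isOpen_compl.mem_nhds hmC)
  have hA : Ioo 0 (Real.pi / 2) ⊆ Ioo 0 Real.pi := Ioo_subset_Ioo_right (by linarith)
  have hB : Ioo (Real.pi / 2) Real.pi ⊆ Ioo 0 Real.pi := Ioo_subset_Ioo_left (by linarith)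
  have hct : Continuous (fun t : ℝ => basepoint (Ψ t u₀)) :=
    h.continuous_geo.comp (by fun_prop : Continuous fun t : ℝ => (t, u₀))
  obtain ⟨z, -, ⟨u₁, hu₁, t₁, ht₁, he₁⟩, ⟨u₂, hu₂, t₂, ht₂, he₂⟩⟩ :=
    hUp (R (Ioo 0 (Real.pi / 2))) (R (Ioo (Real.pi / 2) Real.pi)) (hRo _ isOpen_Ioo hA)
      (hRo _ isOpen_Ioo hB) (by
        rintro y ⟨hyU, hym⟩
        obtain ⟨u, hu, t, ht, hy⟩ := h.exists_geo_eq m y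
        have ht0 : t ≠ 0 := by
          rintro rfl
          rw [h.flow.zero, hu] at hy
          exact hym hy.symm
        have htπ : t ≠ Real.pi := by
          rintro rfl
          exact hym (hy.symm.trans (ha' u hu))
        have ht2 : t ≠ Real.pi / 2 := by
          rintro rfl
          exact hUC hyU ⟨u, hu, hy⟩
        rcases lt_or_gt_of_ne ht2 with hlt | hlt
        · exact Or.inl ⟨u, hu, t, ⟨ht.1.lt_of_ne' ht0, hlt⟩, hy⟩
        · exact Or.inr ⟨u, hu, t, ⟨hlt, ht.2.lt_of_ne htπ⟩, hy⟩) (by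
        have h1 : ∀ᶠ t in 𝓝[>] (0 : ℝ), basepoint (Ψ t u₀) ∈ U := by
          refine (hct.continuousAt.eventually ?_).filter_mono nhdsWithin_le_nhds
          change U ∈ 𝓝 (basepoint (Ψ 0 u₀))
          rw [h.flow.zero]; exact hUm
        obtain ⟨t, h2, h3⟩ := (h1.and (Ioo_mem_nhdsGT (by linarith : (0 : ℝ) < Real.pi / 2))).exists
        exact ⟨_, ⟨h2, h.geo_ne u₀ (hA h3)⟩, u₀, rfl, t, h3, rfl⟩) (by
        have h1 : ∀ᶠ t in 𝓝[<] Real.pi, basepoint (Ψ t u₀) ∈ U := by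
          refine (hct.continuousAt.eventually ?_).filter_mono nhdsWithin_le_nhds
          change U ∈ 𝓝 (basepoint (Ψ Real.pi u₀))
          rw [ha]; exact hUm
        obtain ⟨t, h2, h3⟩ := (h1.and (Ioo_mem_nhdsLT (by linarith : Real.pi / 2 < Real.pi))).exists
        exact ⟨_, ⟨h2, h.geo_ne u₀ (hB h3)⟩, u₀, rfl, t, h3, rfl⟩)
  have := hinj u₁ u₂ t₁ t₂ hu₁ hu₂ (hA ht₁) (hB ht₂) (he₁.trans he₂.symm)
  linarith [ht₁.2, ht₂.1]

/-- Distinct geodesics issuing from a point do not meet before time `π`. -/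
theorem geo_injective [ConnectedSpace M] {u₁ u₂ : Sig} {t₁ t₂ : ℝ}
    (hb : basepoint u₁ = basepoint u₂) (h₁ : t₁ ∈ Ioo 0 Real.pi) (h₂ : t₂ ∈ Ioo 0 Real.pi)
    (heq : basepoint (Ψ t₁ u₁) = basepoint (Ψ t₂ u₂)) : t₁ = t₂ ∧ u₁ = u₂ :=
  h.injective_of_antipode_ne (m := basepoint u₁) (fun u hu => hu ▸ h.antipode_ne u) rfl hb.symm
    h₁ h₂ heq

/-- Otherwise the piece of the geodesic between times `t` and `π` would be a loop shorter than `π`.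
-/
theorem geo_ne_antipode [ConnectedSpace M] (u : Sig) {t : ℝ} (ht : t ∈ Ioo 0 Real.pi) :
    basepoint (Ψ t u) ≠ basepoint (Ψ Real.pi u) := by
  have := h.geo_ne (Ψ t u) (t := Real.pi - t) ⟨by linarith [ht.2], by linarith [ht.1]⟩
  rw [← h.flow.add, sub_add_cancel] at this
  exact this.symm

end IsUnitSurface

end Surface

/-! ## The homeomorphism from the sphere -/

/-- The polar angle of a point of the sphere. -/
def colat (x : Sphere2) : ℝ := Real.arccos ((x : E3) 2)

/-- The longitude of a point of the sphere. -/
def azimuth (x : Sphere2) : ℝ := Complex.arg ⟨(x : E3) 0, (x : E3) 1⟩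

theorem colat_mem (x : Sphere2) : colat x ∈ Icc 0 Real.pi :=
  ⟨Real.arccos_nonneg _, Real.arccos_le_pi _⟩

theorem continuous_colat : Continuous colat :=
  Real.continuous_arccos.comp
    ((EuclideanSpace.proj (𝕜 := ℝ) (2 : Fin 3)).continuous.comp continuous_subtype_val)

theorem colat_polarPoint {t : ℝ} (ht : t ∈ Icc 0 Real.pi) (θ : ℝ) : colat (polarPoint t θ) = t :=
  Real.arccos_cos ht.1 ht.2

theorem Sphere2.sq_add_sq (x : Sphere2) : (x : E3) 0 ^ 2 + (x : E3) 1 ^ 2 + (x : E3) 2 ^ 2 = 1 := by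
  have := mem_sphere_zero_iff_norm.1 x.2
  rw [EuclideanSpace.norm_eq, Real.sqrt_eq_one] at this
  simpa only [Fin.sum_univ_three, Real.norm_eq_abs, sq_abs] using this

theorem polarPoint_colat_azimuth (x : Sphere2) : polarPoint (colat x) (azimuth x) = x := by
  have hx := Sphere2.sq_add_sq x
  have hn : ‖(⟨(x : E3) 0, (x : E3) 1⟩ : ℂ)‖ = Real.sin (colat x) := by
    rw [colat, Real.sin_arccos, Complex.norm_def, Complex.normSq_mk]
    congr 1
    linarith
  have h1 := Complex.norm_mul_cos_arg (⟨(x : E3) 0, (x : E3) 1⟩ : ℂ)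
  have h2 := Complex.norm_mul_sin_arg (⟨(x : E3) 0, (x : E3) 1⟩ : ℂ)
  rw [hn] at h1 h2
  apply Subtype.ext
  ext i
  fin_cases i
  · exact h1
  · exact h2
  · exact Real.cos_arccos (by nlinarith [sq_nonneg ((x : E3) 0), sq_nonneg ((x : E3) 1)])
      (by nlinarith [sq_nonneg ((x : E3) 0), sq_nonneg ((x : E3) 1)])

theorem cos_sin_azimuth_polarPoint {t : ℝ} (ht : 0 < Real.sin t) (θ : ℝ) :
    Real.cos (azimuth (polarPoint t θ)) = Real.cos θ ∧
      Real.sin (azimuth (polarPoint t θ)) = Real.sin θ := by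
  have hz : (⟨(polarPoint t θ : E3) 0, (polarPoint t θ : E3) 1⟩ : ℂ) =
      ⟨Real.sin t * Real.cos θ, Real.sin t * Real.sin θ⟩ := rfl
  have hn : ‖(⟨Real.sin t * Real.cos θ, Real.sin t * Real.sin θ⟩ : ℂ)‖ = Real.sin t := by
    rw [Complex.norm_def, Complex.normSq_mk]
    rw [show Real.sin t * Real.cos θ * (Real.sin t * Real.cos θ) +
      Real.sin t * Real.sin θ * (Real.sin t * Real.sin θ) = Real.sin t ^ 2 by
        linear_combination Real.sin t ^ 2 * Real.sin_sq_add_cos_sq θ]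
    exact Real.sqrt_sq ht.le
  have h1 := Complex.norm_mul_cos_arg (⟨Real.sin t * Real.cos θ, Real.sin t * Real.sin θ⟩ : ℂ)
  have h2 := Complex.norm_mul_sin_arg (⟨Real.sin t * Real.cos θ, Real.sin t * Real.sin θ⟩ : ℂ)
  rw [hn] at h1 h2
  rw [azimuth, hz]
  exact ⟨mul_left_cancel₀ ht.ne' h1, mul_left_cancel₀ ht.ne' h2⟩

/-- Continuity of a map on the sphere, poles and the cut of `Complex.arg` included, can thus be
checked in polar coordinates. -/
theorem isQuotientMap_polarPoint : IsQuotientMap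
    (fun p : Icc 0 Real.pi × Icc (-Real.pi) Real.pi => polarPoint p.1 p.2) := by
  have hc : Continuous (fun p : Icc 0 Real.pi × Icc (-Real.pi) Real.pi =>
      polarPoint p.1 p.2) := by
    refine Continuous.subtype_mk ((PiLp.continuous_toLp 2 (fun _ : Fin 3 => ℝ)).comp
      (continuous_pi fun i => ?_)) _
    fin_cases i
    · exact (Real.continuous_sin.comp (continuous_subtype_val.comp continuous_fst)).mul
        (Real.continuous_cos.comp (continuous_subtype_val.comp continuous_snd))
    · exact (Real.continuous_sin.comp (continuous_subtype_val.comp continuous_fst)).mul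
        (Real.continuous_sin.comp (continuous_subtype_val.comp continuous_snd))
    · exact Real.continuous_cos.comp (continuous_subtype_val.comp continuous_fst)
  refine IsQuotientMap.of_surjective_continuous (fun x => ?_) hc
  have := Complex.arg_mem_Ioc (⟨(x : E3) 0, (x : E3) 1⟩ : ℂ)
  exact ⟨(⟨colat x, colat_mem x⟩, ⟨azimuth x, this.1.le, this.2⟩), polarPoint_colat_azimuth x⟩

section Surface

variable {M : Type*} [TopologicalSpace M] [T2Space M] [ConnectedSpace M]
  [ChartedSpace (EuclideanSpace ℝ (Fin 2)) M] [IsManifold (𝓡 2) ∞ M]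
  {Sig : Set (TangentBundle (𝓡 2) M)}
  [ChartedSpace (EuclideanSpace ℝ (Fin 3)) Sig] [IsManifold (𝓡 3) ∞ Sig]
  {o : ∀ x : M, Orientation ℝ (TangentSpace (𝓡 2) x) (Fin 2)} {η : Coframing Sig}
  {Ψ : ℝ → Sig → Sig}

namespace IsUnitSurface

variable (h : IsUnitSurface o η Ψ)
include h

/-- Polar coordinates around a point are injective, up to the poles. -/
theorem eq_of_geo_eq {u₁ u₂ : Sig} {t₁ t₂ : ℝ} (hb : basepoint u₁ = basepoint u₂)
    (h₁ : t₁ ∈ Icc 0 Real.pi) (h₂ : t₂ ∈ Icc 0 Real.pi)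
    (heq : basepoint (Ψ t₁ u₁) = basepoint (Ψ t₂ u₂)) :
    t₁ = t₂ ∧ (Real.sin t₁ = 0 ∨ u₁ = u₂) := by
  have hπ := Real.pi_pos
  have key : ∀ (u₁ u₂ : Sig) (t₁ t₂ : ℝ), basepoint u₁ = basepoint u₂ → t₁ ∈ Icc 0 Real.pi →
      t₂ ∈ Icc 0 Real.pi → basepoint (Ψ t₁ u₁) = basepoint (Ψ t₂ u₂) → t₁ = 0 → t₂ = 0 := by
    intro u₁ u₂ t₁ t₂ hb h₁ h₂ heq h0
    rw [h0, h.flow.zero, hb] at heq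
    by_contra hne
    rcases h₂.2.eq_or_lt with hp | hp
    · rw [hp] at heq
      exact h.antipode_ne u₂ heq.symm
    · exact h.geo_ne u₂ ⟨h₂.1.lt_of_ne' hne, hp⟩ heq.symm
  have key2 : ∀ (u₁ u₂ : Sig) (t₁ t₂ : ℝ), basepoint u₁ = basepoint u₂ → t₁ ∈ Icc 0 Real.pi →
      t₂ ∈ Icc 0 Real.pi → basepoint (Ψ t₁ u₁) = basepoint (Ψ t₂ u₂) → t₁ = Real.pi →
      t₂ = Real.pi := by
    intro u₁ u₂ t₁ t₂ hb h₁ h₂ heq h0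
    rw [h0, h.antipode_eq hb] at heq
    by_contra hne
    rcases h₂.1.eq_or_lt with hp | hp
    · rw [← hp, h.flow.zero] at heq
      exact h.antipode_ne u₂ heq
    · exact h.geo_ne_antipode u₂ ⟨hp, h₂.2.lt_of_ne hne⟩ heq.symm
  by_cases h10 : t₁ = 0
  · exact ⟨h10.trans (key _ _ _ _ hb h₁ h₂ heq h10).symm, Or.inl (by rw [h10, Real.sin_zero])⟩
  by_cases h1π : t₁ = Real.pi
  · exact ⟨h1π.trans (key2 _ _ _ _ hb h₁ h₂ heq h1π).symm, Or.inl (by rw [h1π, Real.sin_pi])⟩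
  have h20 : t₂ ≠ 0 := fun h20 => h10 (key _ _ _ _ hb.symm h₂ h₁ heq.symm h20)
  have h2π : t₂ ≠ Real.pi := fun h2π => h1π (key2 _ _ _ _ hb.symm h₂ h₁ heq.symm h2π)
  obtain ⟨a, b⟩ := h.geo_injective hb ⟨h₁.1.lt_of_ne' h10, h₁.2.lt_of_ne h1π⟩
    ⟨h₂.1.lt_of_ne' h20, h₂.2.lt_of_ne h2π⟩ heq
  exact ⟨a, Or.inr b⟩

/-- The formula does not depend on the angle at the poles, because all geodesics from `m` agree in
position at the times `0` and `π`. -/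
theorem exists_homeomorph {m : M} {γ : ℝ → Sig} (hγ : IsFiberParam m γ) :
    ∃ E : Sphere2 ≃ₜ M, ∀ t ∈ Icc 0 Real.pi, ∀ θ,
      E (polarPoint t θ) = basepoint (Ψ t (γ θ)) := by
  let f : Sphere2 → M := fun x => basepoint (Ψ (colat x) (γ (azimuth x)))
  have hb : ∀ θ θ', basepoint (γ θ) = basepoint (γ θ') := fun θ θ' => by
    rw [hγ.base, hγ.base]
  have hf : ∀ t ∈ Icc 0 Real.pi, ∀ θ, f (polarPoint t θ) = basepoint (Ψ t (γ θ)) := by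
    intro t ht θ
    change basepoint (Ψ (colat _) _) = _
    rw [colat_polarPoint ht]
    rcases ht.1.eq_or_lt with h0 | h0
    · rw [← h0, h.flow.zero, h.flow.zero]
      exact hb _ _
    rcases ht.2.eq_or_lt with h1 | h1
    · rw [h1]
      exact h.antipode_eq (hb _ _)
    · rw [(hγ.eq_iff _ _).2 (cos_sin_azimuth_polarPoint (Real.sin_pos_of_mem_Ioo ⟨h0, h1⟩) θ)]
  have hfc : Continuous f := by
    rw [isQuotientMap_polarPoint.continuous_iff]
    have : f ∘ (fun p : Icc 0 Real.pi × Icc (-Real.pi) Real.pi => polarPoint p.1 p.2) =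
        fun p => basepoint (Ψ p.1 (γ p.2)) := funext fun p => hf _ p.1.2 _
    rw [this]
    exact h.continuous_geo.comp ((continuous_subtype_val.comp continuous_fst).prodMk
      (hγ.continuous.comp (continuous_subtype_val.comp continuous_snd)))
  have hinj : Injective f := by
    intro x y hxy
    obtain ⟨a, b⟩ := h.eq_of_geo_eq (hb _ _) (colat_mem x) (colat_mem y) hxy
    rw [← polarPoint_colat_azimuth x, ← polarPoint_colat_azimuth y, ← a]
    apply Subtype.ext
    rcases b with b | b
    · simp only [polarPoint, b, zero_mul]
    · obtain ⟨c, s⟩ := (hγ.eq_iff _ _).1 b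
      simp only [polarPoint, c, s]
  have hsurj : Surjective f := by
    intro y
    obtain ⟨u, hu, t, ht, hy⟩ := h.exists_geo_eq m y
    obtain ⟨θ, rfl⟩ := hγ.surj u hu
    exact ⟨polarPoint t θ, (hf t ht θ).trans hy⟩
  refine ⟨Continuous.homeoOfEquivCompactToT2 (f := Equiv.ofBijective f ⟨hinj, hsurj⟩) hfc, hf⟩

end IsUnitSurface

end Surface

/-! ## Smoothness and orientation away from the poles -/

/-- Polar coordinates on the sphere. -/
def polarMap (p : ℝ × ℝ) : Sphere2 := polarPoint p.1 p.2

theorem contDiff_coe_polarMap : ContDiff ℝ ∞ (fun p : ℝ × ℝ => (polarMap p : E3)) := by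
  refine contDiff_euclidean.2 fun i => ?_
  fin_cases i
  · exact (Real.contDiff_sin.comp contDiff_fst).mul (Real.contDiff_cos.comp contDiff_snd)
  · exact (Real.contDiff_sin.comp contDiff_fst).mul (Real.contDiff_sin.comp contDiff_snd)
  · exact Real.contDiff_cos.comp contDiff_fst

theorem contMDiff_polarMap : ContMDiff 𝓘(ℝ, ℝ × ℝ) (𝓡 2) ∞ polarMap :=
  haveI : Fact (Module.finrank ℝ E3 = 2 + 1) := ⟨finrank_euclideanSpace_fin⟩
  contDiff_coe_polarMap.contMDiff.codRestrict_sphere (n := 2) fun p => (polarMap p).2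

theorem sphereInclD_pushD_polarMap (z w : ℝ × ℝ) :
    (sphereInclD (polarMap z) (pushD (E := E2) polarMap z w) : E3) =
      !₂[Real.cos z.1 * Real.cos z.2 * w.1 - Real.sin z.1 * Real.sin z.2 * w.2,
        Real.cos z.1 * Real.sin z.2 * w.1 + Real.sin z.1 * Real.cos z.2 * w.2,
        -Real.sin z.1 * w.1] := by
  haveI : Fact (Module.finrank ℝ E3 = 2 + 1) := ⟨finrank_euclideanSpace_fin⟩
  have h1 := pushD_outer (E := E2) (E' := E3) (Φ := polarMap) (z := z)
    (g := (Subtype.val : Sphere2 → E3))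
    ((contMDiff_coe_sphere (m := ∞) (n := 2) (polarMap z)).mdifferentiableAt (by simp))
    ((contMDiff_polarMap z).mdifferentiableAt (by simp)) w
  refine h1.symm.trans ?_
  have hd : HasFDerivAt (fun p : ℝ × ℝ => (polarMap p : E3))
      (fderiv ℝ (fun p : ℝ × ℝ => (polarMap p : E3)) z) z :=
    (contDiff_coe_polarMap.differentiable (by simp) z).hasFDerivAt
  have h2 : pushD (E := E3) (fun p : ℝ × ℝ => (polarMap p : E3)) z w =
      fderiv ℝ (fun p : ℝ × ℝ => (polarMap p : E3)) z w :=
    congrArg (fun L => L w) (pushD_eq_of_hasMFDerivAt hd.hasMFDerivAt)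
  refine h2.trans (PiLp.ext fun i => ?_)
  have hi : ∀ (i : Fin 3) (L : ℝ × ℝ →L[ℝ] ℝ),
      HasFDerivAt (fun p : ℝ × ℝ => (polarMap p : E3) i) L z →
      (fderiv ℝ (fun p : ℝ × ℝ => (polarMap p : E3)) z w) i = L w := fun i L hL =>
    congrArg (fun L => L w) (HasFDerivAt.unique ((EuclideanSpace.proj
      (𝕜 := ℝ) i : E3 →L[ℝ] ℝ).hasFDerivAt.comp z hd : HasFDerivAt (fun p : ℝ × ℝ => (polarMap p : E3) i) _ z) hL)
  have f1 : HasFDerivAt (fun p : ℝ × ℝ => p.1) (ContinuousLinearMap.fst ℝ ℝ ℝ) z := hasFDerivAt_fst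
  have f2 : HasFDerivAt (fun p : ℝ × ℝ => p.2) (ContinuousLinearMap.snd ℝ ℝ ℝ) z := hasFDerivAt_snd
  fin_cases i
  · refine (hi 0 _ (f1.sin.mul f2.cos)).trans ?_
    simp
    ring
  · refine (hi 1 _ (f1.sin.mul f2.sin)).trans ?_
    simp
    ring
  · refine (hi 2 _ f1.cos).trans ?_
    simp

theorem pushD_polarMap_injective {z : ℝ × ℝ} (hz : Real.sin z.1 ≠ 0) (w : ℝ × ℝ)
    (hw : pushD (E := E2) polarMap z w = 0) : w = 0 := by
  have h := sphereInclD_pushD_polarMap z w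
  rw [hw, map_zero] at h
  have h0 := congrArg (fun v : E3 => v 0) h
  have h1 := congrArg (fun v : E3 => v 1) h
  have h2 := congrArg (fun v : E3 => v 2) h
  simp at h0 h1 h2
  have a : w.1 = 0 := h2.resolve_left hz
  rw [a] at h0 h1
  have b : Real.sin z.1 * w.2 = 0 := by
    linear_combination Real.sin z.2 * h0 - Real.cos z.2 * h1 -
      Real.sin z.1 * w.2 * Real.sin_sq_add_cos_sq z.2
  exact Prod.ext a ((mul_eq_zero.1 b).resolve_left hz)

theorem pushD_polarMap_surjective {z : ℝ × ℝ} (hz : Real.sin z.1 ≠ 0)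
    (v : TangentSpace (𝓡 2) (polarMap z)) : ∃ w : ℝ × ℝ, pushD (E := E2) polarMap z w = v := by
  let L : ℝ × ℝ →ₗ[ℝ] E2 := (pushD (E := E2) polarMap z).toLinearMap
  have hi : Injective L := (injective_iff_map_eq_zero L).2 (pushD_polarMap_injective hz)
  exact (LinearMap.injective_iff_surjective_of_finrank_eq_finrank (by simp)).1 hi v

/-- With the outward normal first, the determinant is `sin t` times the determinant in the
coordinates `(t, θ)`. -/
theorem isPositiveOnSphere_polarMap_iff {z : ℝ × ℝ} (hz : 0 < Real.sin z.1) (v w : ℝ × ℝ) :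
    IsPositiveOnSphere (polarMap z) (pushD (E := E2) polarMap z v)
      (pushD (E := E2) polarMap z w) ↔ 0 < v.1 * w.2 - v.2 * w.1 := by
  have hdet : Matrix.det (fun i j : Fin 3 => (![(polarMap z : E3),
      sphereInclD (polarMap z) (pushD (E := E2) polarMap z v),
      sphereInclD (polarMap z) (pushD (E := E2) polarMap z w)] i) j) =
      Real.sin z.1 * (v.1 * w.2 - v.2 * w.1) := by
    rw [sphereInclD_pushD_polarMap, sphereInclD_pushD_polarMap]
    refine (Matrix.det_fin_three _).trans ?_
    simp [polarMap, polarPoint]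
    have e1 := Real.sin_sq_add_cos_sq z.1
    have e2 := Real.sin_sq_add_cos_sq z.2
    linear_combination Real.sin z.1 * (v.1 * w.2 - v.2 * w.1) *
      ((Real.sin z.1 ^ 2 + Real.cos z.1 ^ 2) * e2 + e1)
  rw [IsPositiveOnSphere, hdet, mul_pos_iff_of_pos_left hz]

section Surface

variable {M : Type*} [TopologicalSpace M] [T2Space M]
  [ChartedSpace (EuclideanSpace ℝ (Fin 2)) M] [IsManifold (𝓡 2) ∞ M]
  {Sig : Set (TangentBundle (𝓡 2) M)}
  [ChartedSpace (EuclideanSpace ℝ (Fin 3)) Sig]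
  {o : ∀ x : M, Orientation ℝ (TangentSpace (𝓡 2) x) (Fin 2)} {η : Coframing Sig}
  {Ψ : ℝ → Sig → Sig}

theorem IsAngleMeasure.isFiberParam {p : M} {ι : Circle → Sig} (hι : IsAngleMeasure η p ι) :
    IsFiberParam p (fun θ => ι (Circle.exp θ)) where
  continuous := hι.smooth.continuous.comp Circle.exp.continuous
  base θ := hι.bijOn.mapsTo (mem_univ _)
  surj u hu := by
    obtain ⟨z, -, rfl⟩ := hι.bijOn.surjOn hu
    exact ⟨Complex.arg z, by rw [Circle.exp_arg]⟩
  eq_iff θ θ' := by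
    rw [(hι.bijOn.injOn.eq_iff (mem_univ _) (mem_univ _)), ← Circle.coe_inj, Circle.coe_exp,
      Circle.coe_exp, Complex.ext_iff, Complex.exp_ofReal_mul_I_re, Complex.exp_ofReal_mul_I_re,
      Complex.exp_ofReal_mul_I_im, Complex.exp_ofReal_mul_I_im]

theorem IsAngleMeasure.contMDiff_comp_exp {p : M} {ι : Circle → Sig} (hι : IsAngleMeasure η p ι) :
    ContMDiff 𝓘(ℝ, ℝ) (𝓡 3) ∞ (fun θ => ι (Circle.exp θ)) :=
  hι.smooth.comp contMDiff_circleExp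

variable [IsManifold (𝓡 3) ∞ Sig]

/-- The form `ω₁ ∧ ω₂` has the value `ad - bc` on these vectors, and it is a positive multiple of
any positive form. -/
theorem IsCanonicalCoframing.isPositivePair_smul_add_smul (h : IsCanonicalCoframing o η) (u : Sig)
    {a b c d : ℝ} (hd : 0 < a * d - b * c) :
    IsPositivePair (o (basepoint u)) (a • vec u + b • normal η u)
      (c • vec u + d • normal η u) := by
  intro τ hτ
  obtain ⟨k, hk, hτ⟩ := h.area u τ hτ
  have e := hτ (a • η.dual 0 u + b • η.dual 1 u) (c • η.dual 0 u + d • η.dual 1 u)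
  rw [h.basepointD_apply, h.basepointD_apply] at e
  simp [wedge, η.form_dual] at e
  exact pos_of_mul_pos_right (e ▸ by linarith) hk.le

namespace IsUnitSurface

variable (h : IsUnitSurface o η Ψ)
include h

/-- In polar coordinates the differential is diagonal from `(∂_t, ∂_θ)` to `(u, n)` with entries `1`
and `r sin t`, both positive between the poles. -/
theorem isSmoothOrientationPreservingAt {m : M} {γ : ℝ → Sig}
    (hγ : ContMDiff 𝓘(ℝ, ℝ) (𝓡 3) ∞ γ) (hm : ∀ θ, basepoint (γ θ) = m)
    (hpos : ∀ θ : ℝ, 0 < η.form 2 (γ θ) (mfderiv 𝓘(ℝ, ℝ) (𝓡 3) γ θ (1 : ℝ))) {E : Sphere2 → M}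
    (hE : ∀ t ∈ Icc 0 Real.pi, ∀ θ, E (polarPoint t θ) = basepoint (Ψ t (γ θ)))
    {x : Sphere2} (hx : 0 < Real.sin (colat x)) : IsSmoothOrientationPreservingAt o E x := by
  have key : ∀ z : ℝ × ℝ, z.1 ∈ Ioo 0 Real.pi →
      IsSmoothOrientationPreservingAt o E (polarMap z) := by
    intro z hz
    have hs : 0 < Real.sin z.1 := Real.sin_pos_of_mem_Ioo hz
    let F : ℝ × ℝ → M := fun p => basepoint (Ψ p.1 (γ p.2))
    have hFs : ContMDiff 𝓘(ℝ, ℝ × ℝ) (𝓡 2) ∞ F :=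
      h.contMDiff_geo.comp (contDiff_fst.contMDiff.prodMk (hγ.comp contDiff_snd.contMDiff))
    have hEF : ∀ᶠ p in 𝓝 z, E (polarMap p) = F p := by
      filter_upwards [continuousAt_fst.eventually (isOpen_Ioo.mem_nhds hz)] with p hp
      exact hE _ (Ioo_subset_Icc_self hp) _
    -- `K` is a smooth local inverse of polar coordinates, and near the point `E` equals `F ∘ K`.
    obtain ⟨K, hK0, hK, hK1, -⟩ := exists_smooth_localInverse (contMDiff_polarMap z) (by simp)
      (pushD_polarMap_injective hs.ne')
    have hEs : ContMDiffAt (𝓡 2) (𝓡 2) ∞ E (polarMap z) := by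
      have h1 : ContMDiffAt (𝓡 2) (𝓡 2) ∞ (fun y => F (K y)) (polarMap z) :=
        ContMDiffAt.comp (g := F) _ (hFs _) hK
      refine h1.congr_of_eventuallyEq ?_
      have h2 : Tendsto K (𝓝 (polarMap z)) (𝓝 z) := by
        have := hK.continuousAt.tendsto
        rwa [hK0] at this
      filter_upwards [h2.eventually hEF, hK1] with y hy hy'
      rw [← hy, hy']
    refine ⟨hEs, fun v w hvw => ?_⟩
    obtain ⟨a, rfl⟩ := pushD_polarMap_surjective hs.ne' v
    obtain ⟨b, rfl⟩ := pushD_polarMap_surjective hs.ne' w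
    rw [isPositiveOnSphere_polarMap_iff hs] at hvw
    let r := η.form 2 (γ z.2) (mfderiv 𝓘(ℝ, ℝ) (𝓡 3) γ z.2 (1 : ℝ))
    have hr : 0 < r := hpos z.2
    have hν : MDifferentiableAt 𝓘(ℝ, ℝ × ℝ) (𝓡 3) (fun p : ℝ × ℝ => γ p.2) z :=
      ((hγ.comp contDiff_snd.contMDiff) z).mdifferentiableAt (by simp)
    have hdF : ∀ a : ℝ × ℝ, pushD (E := E2) F z a =
        a.1 • vec (Ψ z.1 (γ z.2)) + (Real.sin z.1 * r * a.2) • normal η (Ψ z.1 (γ z.2)) := by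
      intro a
      obtain ⟨v0, v1⟩ := h.pushD_vertical hν (Eventually.of_forall fun p => hm p.2) a
      have v2 : η.form 2 (γ z.2) (pushD (E := E3) (fun p : ℝ × ℝ => γ p.2) z a) = r * a.2 := by
        have e1 := FinslerSurface.pushD_comp (E := E3) (Φ := γ) (f := fun p : ℝ × ℝ => p.2)
          ((hγ z.2).mdifferentiableAt (by simp)) (hasFDerivAt_snd (𝕜 := ℝ) (p := z)) a
        refine (congrArg (η.form 2 (γ z.2)) e1).trans ?_
        have e2 : pushD (E := E3) γ z.2 a.2 = a.2 • pushD (E := E3) γ z.2 (1 : ℝ) := by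
          rw [← map_smul, smul_eq_mul, mul_one]
        refine (congrArg (η.form 2 (γ z.2)) e2).trans ?_
        rw [map_smul, smul_eq_mul, mul_comm]
        rfl
      refine (h.pushD_geo (τ := Prod.fst) hasFDerivAt_fst hν a).trans ?_
      rw [v0, v1, v2]
      simp [mul_assoc]
    have hdE : ∀ a : ℝ × ℝ, (mfderiv (𝓡 2) (𝓡 2) E (polarMap z) (pushD (E := E2) polarMap z a) : E2) =
        a.1 • (vec (Ψ z.1 (γ z.2)) : E2) +
          (Real.sin z.1 * r * a.2) • (normal η (Ψ z.1 (γ z.2)) : E2) := by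
      intro a
      refine (pushD_outer (E := E2) (E' := E2) (Φ := polarMap) (hEs.mdifferentiableAt (by simp))
        ((contMDiff_polarMap z).mdifferentiableAt (by simp)) a).symm.trans ?_
      refine Eq.trans ?_ (hdF a)
      exact congrArg (fun L : ℝ × ℝ →L[ℝ] E2 => L a) (EventuallyEq.mfderiv_eq hEF)
    have fin : ∀ (y : M) (_ : y = basepoint (Ψ z.1 (γ z.2))) (v w : E2)
        (_ : v = a.1 • (vec (Ψ z.1 (γ z.2)) : E2) +
          (Real.sin z.1 * r * a.2) • (normal η (Ψ z.1 (γ z.2)) : E2))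
        (_ : w = b.1 • (vec (Ψ z.1 (γ z.2)) : E2) +
          (Real.sin z.1 * r * b.2) • (normal η (Ψ z.1 (γ z.2)) : E2)),
        IsPositivePair (o y) (v : TangentSpace (𝓡 2) y) (w : TangentSpace (𝓡 2) y) := by
      rintro _ rfl _ _ rfl rfl
      refine h.canon.isPositivePair_smul_add_smul _ ?_
      rw [show a.1 * (Real.sin z.1 * r * b.2) - Real.sin z.1 * r * a.2 * b.1 =
        Real.sin z.1 * r * (a.1 * b.2 - a.2 * b.1) by ring]
      positivity
    exact fin _ hEF.self_of_nhds _ _ (hdE a) (hdE b)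
  have hx' : colat x ∈ Ioo 0 Real.pi := by
    refine ⟨(colat_mem x).1.lt_of_ne fun h0 => ?_, (colat_mem x).2.lt_of_ne fun h0 => ?_⟩
    · rw [← h0, Real.sin_zero] at hx
      exact hx.false
    · rw [h0, Real.sin_pi] at hx
      exact hx.false
  have := key (colat x, azimuth x) hx'
  rwa [polarMap, polarPoint_colat_azimuth] at this

end IsUnitSurface

end Surface

theorem sin_colat_pos {x : Sphere2} (h1 : (x : E3) ≠ !₂[0, 0, 1]) (h2 : (x : E3) ≠ !₂[0, 0, -1]) :
    0 < Real.sin (colat x) := by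
  have hx := polarPoint_colat_azimuth x
  refine (Real.sin_nonneg_of_mem_Icc (colat_mem x)).lt_of_ne fun h0 => ?_
  have hc : Real.cos (colat x) = 1 ∨ Real.cos (colat x) = -1 := by
    rw [← sq_eq_one_iff]
    nlinarith [Real.sin_sq_add_cos_sq (colat x)]
  rcases hc with hc | hc
  · apply h1
    rw [← hx]
    simp [polarPoint, ← h0, hc]
  · apply h2
    rw [← hx]
    simp [polarPoint, ← h0, hc]

/-! ## The diameter -/

/-- Take for `b` the first time at level `β` and for `a` the last time before `b` at level `α`.
Between them a curve stays away from the poles, where the polar radius is not smooth. -/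
theorem exists_Icc_crossing {f : ℝ → ℝ} (hf : ContinuousOn f (Icc 0 1)) {α β : ℝ} (hαβ : α < β)
    (h0 : f 0 < α) (h1 : β < f 1) : ∃ a b, 0 < a ∧ a < b ∧ b < 1 ∧ f a = α ∧ f b = β ∧
      ∀ s ∈ Icc a b, f s ∈ Icc α β := by
  have hclosed : ∀ {r b : ℝ}, b ≤ 1 → IsCompact (Icc 0 b ∩ f ⁻¹' {r}) := fun {r b} hb =>
    isCompact_Icc.of_isClosed_subset ((hf.mono (Icc_subset_Icc_right hb)).preimage_isClosed_of_isClosed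
      isClosed_Icc isClosed_singleton) inter_subset_left
  have ivt : ∀ {x y r : ℝ}, 0 ≤ x → x ≤ y → y ≤ 1 → f x ≤ r → r ≤ f y → ∃ s ∈ Icc x y, f s = r :=
    fun hx hxy hy h1 h2 => intermediate_value_Icc hxy (hf.mono (Icc_subset_Icc hx hy)) ⟨h1, h2⟩
  obtain ⟨s1, hs1, hs1'⟩ := ivt le_rfl zero_le_one le_rfl (h0.trans hαβ).le h1.le
  obtain ⟨b, ⟨hb, hfb⟩, hbl⟩ := (hclosed (r := β) le_rfl).exists_isLeast ⟨s1, hs1, hs1'⟩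
  obtain ⟨s2, hs2, hs2'⟩ := ivt le_rfl hb.1 hb.2 h0.le (hfb.symm ▸ hαβ.le : α ≤ f b)
  obtain ⟨a, ⟨ha, hfa⟩, hal⟩ := (hclosed (r := α) hb.2).exists_isGreatest ⟨s2, hs2, hs2'⟩
  have hfa' : f a = α := hfa
  have hfb' : f b = β := hfb
  refine ⟨a, b, ha.1.lt_of_ne ?_, ha.2.lt_of_ne ?_, hb.2.lt_of_ne ?_, hfa', hfb', fun s hs => ?_⟩
  · rintro rfl
    exact h0.ne hfa'
  · rintro rfl
    exact hαβ.ne (hfa'.symm.trans hfb')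
  · rintro rfl
    exact h1.ne' hfb'
  · constructor
    · by_contra! hlt
      obtain ⟨s', hs', he⟩ := ivt (ha.1.trans hs.1) hs.2 hb.2 hlt.le (hfb'.symm ▸ hαβ.le : α ≤ f b)
      have h1 : s' ≤ a := hal ⟨⟨ha.1.trans (hs.1.trans hs'.1), hs'.2⟩, he⟩
      have h2 : s = a := le_antisymm (hs'.1.trans h1) hs.1
      rw [h2, hfa'] at hlt
      exact hlt.false
    · by_contra! hlt
      obtain ⟨s', hs', he⟩ := ivt le_rfl (ha.1.trans hs.1) (hs.2.trans hb.2) (h0.trans hαβ).le hlt.le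
      have h1 : b ≤ s' := hbl ⟨⟨hs'.1, hs'.2.trans (hs.2.trans hb.2)⟩, he⟩
      have h2 : s = b := le_antisymm hs.2 (h1.trans hs'.2)
      rw [h2, hfb'] at hlt
      exact hlt.false

/-- Only the positive part of the derivative is bounded, by `ENNReal.ofReal (g s)`; dropping the
negative part only enlarges the integral, so `g` need be neither measurable nor finite in integral.
-/
theorem ofReal_sub_le_lintegral {f g : ℝ → ℝ} {a b : ℝ} (hab : a ≤ b) {U : Set ℝ} (hU : IsOpen U)
    (hf : ContDiffOn ℝ 1 f U) (hUab : Icc a b ⊆ U) (hg : ∀ s ∈ U, deriv f s ≤ g s) :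
    ENNReal.ofReal (f b - f a) ≤ ∫⁻ s in Icc a b, ENNReal.ofReal (g s) := by
  have hc : ContinuousOn (deriv f) (Icc a b) :=
    (hf.continuousOn_deriv_of_isOpen hU le_rfl).mono hUab
  have hint := hc.intervalIntegrable_of_Icc (μ := MeasureTheory.volume) hab
  have hd : ∀ s ∈ uIcc a b, HasDerivAt f (deriv f s) s := fun s hs => by
    rw [uIcc_of_le hab] at hs
    exact ((hf.contDiffAt (hU.mem_nhds (hUab hs))).differentiableAt (by simp)).hasDerivAt
  rw [← intervalIntegral.integral_eq_sub_of_hasDerivAt hd hint, intervalIntegral.integral_of_le hab,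
    ← MeasureTheory.integral_Icc_eq_integral_Ioc]
  have hi : MeasureTheory.Integrable (deriv f) (MeasureTheory.volume.restrict (Icc a b)) :=
    hc.integrableOn_Icc
  rw [MeasureTheory.integral_eq_lintegral_pos_part_sub_lintegral_neg_part hi]
  refine (ENNReal.ofReal_le_ofReal (sub_le_self _ ENNReal.toReal_nonneg)).trans
    (ENNReal.ofReal_toReal_le.trans ?_)
  exact MeasureTheory.setLIntegral_mono' measurableSet_Icc fun s hs =>
    ENNReal.ofReal_le_ofReal (hg s (hUab hs))

section Surface

variable {M : Type*} [TopologicalSpace M]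
  [ChartedSpace (EuclideanSpace ℝ (Fin 2)) M] [IsManifold (𝓡 2) ∞ M]
  {Sig : Set (TangentBundle (𝓡 2) M)}

/-- The infimum defining the distance runs over paths on `unitInterval`; the curve is restricted
there and its length rewritten on `[0, 1]`. -/
theorem finslerDist_le_lintegral {f : ℝ → M} (hf : ContMDiff 𝓘(ℝ, ℝ) (𝓡 2) 1 f) :
    finslerDist Sig (f 0) (f 1) ≤ ∫⁻ s in Icc 0 1, ENNReal.ofReal (finslerNorm Sig (f s)
      (mfderiv 𝓘(ℝ, ℝ) (𝓡 2) f s (1 : ℝ))) := by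
  letI : ∀ z : M, ENorm (TangentSpace (𝓡 2) z) :=
    fun z => ⟨fun v => ENNReal.ofReal (finslerNorm Sig z v)⟩
  let F : unitInterval → M := fun t => f t
  have hF : ContMDiff (𝓡∂ 1) (𝓡 2) 1 F := by
    rw [← contMDiffOn_comp_projIcc_iff]
    refine hf.contMDiffOn.congr fun t ht => ?_
    simp only [Function.comp_apply, F, projIcc_of_mem, ht]
  let p : Path (f 0) (f 1) := ⟨⟨F, hF.continuous⟩, by simp [F], by simp [F]⟩
  have h1 : Manifold.riemannianEDist (𝓡 2) (f 0) (f 1) ≤ Manifold.pathELength (𝓡 2) f 0 1 := by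
    rw [Manifold.riemannianEDist]
    refine (biInf_le _ (i := p) hF).trans_eq ?_
    refine (Manifold.lintegral_norm_mfderiv_Icc_eq_pathELength_projIcc (I := 𝓡 2)
      (γ := (p : unitInterval → M))).trans ?_
    refine Manifold.pathELength_congr fun t ht => ?_
    simp only [Function.comp_apply, ht, projIcc_of_mem]
    rfl
  refine h1.trans_eq ?_
  rw [Manifold.pathELength_eq_lintegral_mfderiv_Icc]
  rfl

theorem exists_of_finslerDist_lt {x y : M} {r : ℝ≥0∞} (hr : finslerDist Sig x y < r) :
    ∃ c : ℝ → M, c 0 = x ∧ c 1 = y ∧ ContMDiffOn 𝓘(ℝ, ℝ) (𝓡 2) 1 c (Icc 0 1) ∧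
      ∫⁻ s in Icc 0 1, ENNReal.ofReal (finslerNorm Sig (c s)
        (mfderiv 𝓘(ℝ, ℝ) (𝓡 2) c s (1 : ℝ))) < r := by
  letI : ∀ z : M, ENorm (TangentSpace (𝓡 2) z) :=
    fun z => ⟨fun v => ENNReal.ofReal (finslerNorm Sig z v)⟩
  obtain ⟨c, h0, h1, hc, hl⟩ := Manifold.exists_lt_of_riemannianEDist_lt hr
  rw [Manifold.pathELength_eq_lintegral_mfderiv_Icc] at hl
  exact ⟨c, h0, h1, hc, hl⟩

theorem finslerNorm_smul_vec_le [ChartedSpace (EuclideanSpace ℝ (Fin 3)) Sig] {u : Sig} {t : ℝ} (ht : 0 ≤ t) :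
    finslerNorm Sig (basepoint u) (t • vec u) ≤ t := by
  have h1 : gauge (body Sig (basepoint u)) (t • vec2 u) ≤ t := by
    rw [gauge_smul_of_nonneg ht]
    exact mul_le_of_le_one_right ht (gauge_le_one_of_mem (vec2_mem_body rfl))
  exact h1

end Surface

section Surface

variable {M : Type*} [TopologicalSpace M] [T2Space M] [ConnectedSpace M]
  [ChartedSpace (EuclideanSpace ℝ (Fin 2)) M] [IsManifold (𝓡 2) ∞ M]
  {Sig : Set (TangentBundle (𝓡 2) M)}
  [ChartedSpace (EuclideanSpace ℝ (Fin 3)) Sig] [IsManifold (𝓡 3) ∞ Sig]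
  {o : ∀ x : M, Orientation ℝ (TangentSpace (𝓡 2) x) (Fin 2)} {η : Coframing Sig}
  {Ψ : ℝ → Sig → Sig}

namespace IsUnitSurface

variable (h : IsUnitSurface o η Ψ)
include h

/-- The geodesic of length `t ≤ π` from `x` to `y`, run over `[0, 1]` at constant speed `t`, is a
competitor. -/
theorem finslerDist_le_pi (x y : M) : finslerDist Sig x y ≤ ENNReal.ofReal Real.pi := by
  obtain ⟨u, rfl, t, ht, rfl⟩ := h.exists_geo_eq x y
  let f : ℝ → M := fun s => basepoint (Ψ (t * s) u)
  have hlin : ∀ s, HasDerivAt (fun s : ℝ => t * s) t s := fun s => by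
    simpa using (hasDerivAt_id s).const_mul t
  have hf : ContMDiff 𝓘(ℝ, ℝ) (𝓡 2) 1 f :=
    (h.contMDiff_geo.of_le (by simp)).comp
      (((contDiff_const.mul contDiff_id).contMDiff).prodMk contMDiff_const)
  have hd : ∀ s, (mfderiv 𝓘(ℝ, ℝ) (𝓡 2) f s (1 : ℝ) : E2) = t • vec2 (Ψ (t * s) u) := by
    intro s
    have h1 := h.pushD_geo (τ := fun s : ℝ => t * s) (ν := fun _ => u) (hlin s).hasFDerivAt
      mdifferentiableAt_const (1 : ℝ)
    have h2 : pushD (E := E3) (fun _ : ℝ => u) s (1 : ℝ) = 0 :=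
      congrArg (fun L : ℝ →L[ℝ] E3 => L (1 : ℝ))
        (pushD_eq_of_hasMFDerivAt (E := E3) (hasMFDerivAt_const u s))
    refine Eq.trans h1 ?_
    rw [h2]
    simp
    rfl
  have hle := finslerDist_le_lintegral (Sig := Sig) hf
  have e0 : f 0 = basepoint u := by simp only [f, mul_zero, h.flow.zero]
  have e1 : f 1 = basepoint (Ψ t u) := by simp only [f, mul_one]
  rw [e0, e1] at hle
  refine hle.trans ((MeasureTheory.setLIntegral_mono' measurableSet_Icc (fun s _ =>
    ENNReal.ofReal_le_ofReal (q := Real.pi) ?_)).trans_eq ?_)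
  · refine le_trans (le_of_eq ?_) ((finslerNorm_smul_vec_le (u := Ψ (t * s) u) ht.1).trans ht.2)
    exact congrArg (fun v : E2 => finslerNorm Sig (basepoint (Ψ (t * s) u)) v) (hd s)
  · simp

/-- The polar radius `ρ` about `m` has differential `λ ≤ F` between the poles, so it grows along a
curve at most as fast as length. It rises from `0` at `m` to `π` at the antipode. -/
theorem exists_pi_le_finslerDist :
    ∃ x y : M, ENNReal.ofReal Real.pi ≤ finslerDist Sig x y := by
  obtain ⟨m⟩ : Nonempty M := inferInstance
  obtain ⟨γ, hγ⟩ := h.finsler.exists_isFiberParam m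
  obtain ⟨E, hE⟩ := h.exists_homeomorph hγ
  let ρ : M → ℝ := fun y => colat (E.symm y)
  have hρ : Continuous ρ := continuous_colat.comp E.symm.continuous
  have hρgeo : ∀ (u : Sig) (t : ℝ), basepoint u = m → t ∈ Icc 0 Real.pi →
      ρ (basepoint (Ψ t u)) = t := by
    intro u t hu ht
    obtain ⟨θ, rfl⟩ := hγ.surj u hu
    simp only [ρ]
    rw [← hE t ht θ, E.symm_apply_apply, colat_polarPoint ht]
  have hex : ∀ y, ∃ u, basepoint u = m ∧ basepoint (Ψ (ρ y) u) = y := by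
    intro y
    refine ⟨γ (azimuth (E.symm y)), hγ.base _, ?_⟩
    rw [← hE _ (colat_mem _), polarPoint_colat_azimuth, E.apply_symm_apply]
  have hπ := Real.pi_pos
  have hloc : ∀ (c : ℝ → M) (s : ℝ), ContMDiffAt 𝓘(ℝ, ℝ) (𝓡 2) 1 c s →
      ρ (c s) ∈ Ioo 0 Real.pi → ContDiffAt ℝ 1 (fun s => ρ (c s)) s ∧
      deriv (fun s => ρ (c s)) s ≤
        finslerNorm Sig (c s) (mfderiv 𝓘(ℝ, ℝ) (𝓡 2) c s (1 : ℝ)) := by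
    intro c s hc hs
    obtain ⟨u, hu, hus⟩ := hex (c s)
    obtain ⟨T, U, hT0, -, hT, hev, hder⟩ :=
      h.exists_distance u (t := ρ (c s)) (Real.sin_pos_of_mem_Ioo hs).ne'
    have hTs : ContMDiffAt (𝓡 2) 𝓘(ℝ, ℝ) ∞ T (c s) := by rwa [hus] at hT
    -- The smooth local length `T` agrees with `ρ` because its values stay in `(0, π)`, where polar
    -- coordinates are injective.
    have hρT : ∀ᶠ y in 𝓝 (c s), ρ y = T y := by
      rw [hus] at hev hT0
      have hTI : ∀ᶠ y in 𝓝 (c s), T y ∈ Ioo 0 Real.pi :=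
        hTs.continuousAt.eventually (isOpen_Ioo.mem_nhds (by rwa [hT0]))
      filter_upwards [hev, hTI] with y hy hyI
      have := hρgeo (U y) (T y) (hy.1.trans hu) (Ioo_subset_Icc_self hyI)
      rwa [hy.2] at this
    have heq : (fun s => ρ (c s)) =ᶠ[𝓝 s] fun s => T (c s) := hc.continuousAt.eventually hρT
    refine ⟨?_, ?_⟩
    · refine ContDiffAt.congr_of_eventuallyEq ?_ heq
      exact (ContMDiffAt.comp (g := T) s (hTs.of_le (by simp)) hc).contDiffAt
    · rw [((hder c s hus.symm (hc.mdifferentiableAt (by simp))).congr_of_eventuallyEq heq).deriv]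
      have key : ∀ (y : M), y = basepoint (Ψ (ρ (c s)) u) → ∀ v : E2,
          covec2 η (Ψ (ρ (c s)) u) v ≤ finslerNorm Sig y v := by
        rintro _ rfl v
        exact h.covec_le_finslerNorm _ v
      exact key _ hus.symm _
  obtain ⟨u, hu⟩ := h.finsler.surjective m
  refine ⟨m, basepoint (Ψ Real.pi u), ?_⟩
  by_contra! hlt
  obtain ⟨c, hc0, hc1, hc, hlen⟩ := exists_of_finslerDist_lt hlt
  set L := ∫⁻ s in Icc 0 1, ENNReal.ofReal (finslerNorm Sig (c s)
        (mfderiv 𝓘(ℝ, ℝ) (𝓡 2) c s (1 : ℝ))) with hL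
  have hLr : L = ENNReal.ofReal L.toReal :=
    (ENNReal.ofReal_toReal (hlen.trans ENNReal.ofReal_lt_top).ne).symm
  have hLπ : L.toReal < Real.pi := by
    rw [hLr, ENNReal.ofReal_lt_ofReal_iff hπ] at hlen
    exact hlen
  have hL0 : 0 ≤ L.toReal := ENNReal.toReal_nonneg
  have hf : ContinuousOn (fun s => ρ (c s)) (Icc 0 1) := hρ.comp_continuousOn hc.continuousOn
  have hf0 : ρ (c 0) = 0 := by
    have := hρgeo u 0 hu ⟨le_rfl, hπ.le⟩
    rwa [h.flow.zero, hu, ← hc0] at this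
  have hf1 : ρ (c 1) = Real.pi := by
    rw [hc1]
    exact hρgeo u Real.pi hu ⟨hπ.le, le_rfl⟩
  -- If `L < π`, trimming `(π - L)/4` at each end avoids the poles and still leaves a rise of `(π +
  -- L)/2`, which exceeds `L`.
  obtain ⟨a, b, ha, hab, hb, hfa, hfb, hI⟩ := exists_Icc_crossing hf
    (α := (Real.pi - L.toReal) / 4) (β := Real.pi - (Real.pi - L.toReal) / 4)
    (by linarith) (by rw [hf0]; linarith) (by rw [hf1]; linarith)
  have hcs : ∀ s ∈ Ioo (0 : ℝ) 1, ContMDiffAt 𝓘(ℝ, ℝ) (𝓡 2) 1 c s := fun s hs =>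
    hc.contMDiffAt (Icc_mem_nhds hs.1 hs.2)
  let U : Set ℝ := Ioo 0 1 ∩ (fun s => ρ (c s)) ⁻¹' Ioo 0 Real.pi
  have hU : IsOpen U := (hf.mono Ioo_subset_Icc_self).isOpen_inter_preimage isOpen_Ioo isOpen_Ioo
  have hfin := ofReal_sub_le_lintegral hab.le hU
    (fun s hs => (hloc c s (hcs s hs.1) hs.2).1.contDiffWithinAt)
    (fun s hs => ⟨⟨ha.trans_le hs.1, hs.2.trans_lt hb⟩, by
      have := hI s hs
      exact ⟨by linarith [this.1], by linarith [this.2]⟩⟩)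
    (fun s hs => (hloc c s (hcs s hs.1) hs.2).2)
  have hle : ENNReal.ofReal (ρ (c b) - ρ (c a)) ≤ L :=
    hfin.trans (MeasureTheory.lintegral_mono_set (Icc_subset_Icc ha.le hb.le))
  have hle' := ENNReal.toReal_mono (hlen.trans ENNReal.ofReal_lt_top).ne hle
  rw [hfa, hfb, ENNReal.toReal_ofReal (by linarith)] at hle'
  linarith

theorem finslerDiam_eq : finslerDiam Sig = ENNReal.ofReal Real.pi := by
  refine le_antisymm (iSup₂_le h.finslerDist_le_pi) ?_
  obtain ⟨x, y, hxy⟩ := h.exists_pi_le_finslerDist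
  exact hxy.trans (le_iSup₂ (f := fun x y : M => finslerDist Sig x y) x y)

end IsUnitSurface

end Surface

/-! ### Assembly of the main theorem. -/

theorem isUnitFlow_flow {S : Type*} [TopologicalSpace S]
    [ChartedSpace (EuclideanSpace ℝ (Fin 3)) S] {η : Coframing S}
    (hη : ∃ I J : S → ℝ, η.StructureEquations I J (fun _ => 1))
    (hc : IsCompleteField (η.dual 0)) : IsUnitFlow η (flow hc) where
  zero u := (Classical.choose_spec (hc u)).1
  curve u := (Classical.choose_spec (hc u)).2
  eqs := hη

end FinslerSurface

end

theorem mainTheorem6 {M : Type*} [TopologicalSpace M] [T2Space M] [ConnectedSpace M]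
    [ChartedSpace (EuclideanSpace ℝ (Fin 2)) M] [IsManifold (𝓡 2) ∞ M]
    (o : ∀ x : M, Orientation ℝ (TangentSpace (𝓡 2) x) (Fin 2))
    (ho : FinslerSurface.IsOrientation o)
    (Sig : Set (TangentBundle (𝓡 2) M))
    [ChartedSpace (EuclideanSpace ℝ (Fin 3)) Sig] [IsManifold (𝓡 3) ∞ Sig]
    (hSig : FinslerSurface.IsFinslerStructure Sig)
    (η : FinslerSurface.Coframing Sig)
    (hη : FinslerSurface.IsCanonicalCoframing o η)
    (hK : ∃ I J : Sig → ℝ, η.StructureEquations I J (fun _ => 1))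
    (hcomplete : FinslerSurface.IsCompleteField (η.dual 0)) :
    (∀ (p : M) (ι : Circle → Sig), FinslerSurface.IsAngleMeasure η p ι →
      ∃ E : FinslerSurface.Sphere2 ≃ₜ M,
        (∀ t ∈ Set.Icc (0 : ℝ) Real.pi, ∀ θ : ℝ,
          E (FinslerSurface.polarPoint t θ) =
            FinslerSurface.basepoint
              (FinslerSurface.flow hcomplete t (ι (Circle.exp θ)))) ∧
        ∀ x : FinslerSurface.Sphere2,
          (x : EuclideanSpace ℝ (Fin 3)) ≠ !₂[0, 0, 1] →
          (x : EuclideanSpace ℝ (Fin 3)) ≠ !₂[0, 0, -1] →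
            FinslerSurface.IsSmoothOrientationPreservingAt o E x) ∧
    Nonempty (M ≃ₜ FinslerSurface.Sphere2) ∧
    FinslerSurface.finslerDiam Sig = ENNReal.ofReal Real.pi := by
  have h : FinslerSurface.IsUnitSurface o η (FinslerSurface.flow hcomplete) :=
    ⟨hSig, hη, FinslerSurface.isUnitFlow_flow hK hcomplete⟩
  refine ⟨fun p ι hι => ?_, ?_, h.finslerDiam_eq⟩
  · obtain ⟨E, hE⟩ := h.exists_homeomorph hι.isFiberParam
    exact ⟨E, hE, fun x h1 h2 => h.isSmoothOrientationPreservingAt hι.contMDiff_comp_exp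
      hι.isFiberParam.base hι.pos hE (FinslerSurface.sin_colat_pos h1 h2)⟩
  · obtain ⟨m⟩ : Nonempty M := inferInstance
    obtain ⟨γ, hγ⟩ := hSig.exists_isFiberParam m
    obtain ⟨E, -⟩ := h.exists_homeomorph hγ
    exact ⟨E.symm⟩
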